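/- Let $b>0$. There exist constants $K_1,K_2>0$ depending only on $b$ such that the following holds for all integers $n\ge 4$ and $p\ge 3$. Let $X_1,\dots,X_n$ be independent random vectors in $\mathbb{R}^p$, $X_i=(X_{i1},\dots,X_{ip})'$, with $\mathrm{E}[X_{ij}]=0$ and $\mathrm{E}[X_{ij}^2]<\infty$ for all $i,j$, and let $Y_1,\dots,Y_n$ be independent Gaussian random vectors in $\mathbb{R}^p$ with $Y_i\sim N(0,\mathrm{E}[X_iX_i'])$. Put $S_n^X=n^{-1/2}\sum_{i=1}^nX_i$ and $S_n^Y=n^{-1/2}\sum_{i=1}^nY_i$, and let $$\rho_n(\mathcal{A}^{\mathrm{re}})=\sup_{A\in\mathcal{A}^{\mathrm{re}}}\left|\Pr(S_n^X\in A)-\Pr(S_n^Y\in A)\right|,$$ where $\mathcal{A}^{\mathrm{re}}$ is the class of all sets $\{w\in\mathbb{R}^p: a_j\le w_j\le b_j \text{ for all } j=1,\dots,p\}$ with $-\infty\le a_j\le b_j\le\infty$. Let $$L_n=\max_{1\le j\le p}\frac1n\sum_{i=1}^n\mathrm{E}[|X_{ij}|^3]\in[0,\infty],$$ and for $\phi>0$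 let $$M_{n,X}(\phi)=\frac1n\sum_{i=1}^n\mathrm{E}\left[\max_{1\le j\le p}|X_{ij}|^3\,1\left\{\max_{1\le j\le p}|X_{ij}|>\frac{\sqrt n}{4\phi\log p}\right\}\right],$$ let $M_{n,Y}(\phi)$ be defined in the same way with $Y_{ij}$ in place of $X_{ij}$, and put $M_n(\phi)=M_{n,X}(\phi)+M_{n,Y}(\phi)$. Suppose that $$\frac1n\sum_{i=1}^n\mathrm{E}[X_{ij}^2]\ge b\qquad\text{for all } j=1,\dots,p.$$ Then for every real number $\overline{L}_n\ge L_n$, $$\rho_n(\mathcal{A}^{\mathrm{re}})\le K_1\left[\left(\frac{\overline{L}_n^2\log^7p}{n}\right)^{1/6}+\frac{M_n(\phi_n)}{\overline{L}_n}\right],\qquad \phi_n=K_2\left(\frac{\overline{L}_n^2\log^4p}{n}\right)^{-1/6}.$$ -/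

import Mathlib

open MeasureTheory ProbabilityTheory

noncomputable section

namespace HighDimCLT

variable {n p : ℕ} {Ω : Type*} [MeasurableSpace Ω]

/-- The normalized sum `S_n = n^{-1/2} ∑ i, X i` of `n` random vectors. -/
def normSum (X : Fin n → Ω → EuclideanSpace ℝ (Fin p)) (ω : Ω) : EuclideanSpace ℝ (Fin p) :=
  (Real.sqrt n)⁻¹ • ∑ i, X i ω

/-- The second moment matrix `E[x xᵀ]` of a random vector (its covariance matrix if centered). -/
def momentMatrix (P : Measure Ω) (x : Ω → EuclideanSpace ℝ (Fin p)) :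
    Matrix (Fin p) (Fin p) ℝ :=
  Matrix.of fun j k => ∫ ω, x ω j * x ω k ∂P

/-- The hyperrectangles `{w | ∀ j, a j ≤ w j ≤ b j}`, where `-∞ ≤ a j ≤ b j ≤ ∞`. -/
def hyperrectangles (p : ℕ) : Set (Set (EuclideanSpace ℝ (Fin p))) :=
  {A | ∃ a b : Fin p → EReal, (∀ j, a j ≤ b j) ∧
    A = {w | ∀ j, a j ≤ (w j : EReal) ∧ (w j : EReal) ≤ b j}}

/-- `sup_{A ∈ 𝒜} |P(S ∈ A) - Q(T ∈ A)|` for random vectors `S` under `P` and `T` under `Q`. -/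
def rho {Ω' : Type*} [MeasurableSpace Ω'] (P : Measure Ω) (Q : Measure Ω')
    (S : Ω → EuclideanSpace ℝ (Fin p)) (T : Ω' → EuclideanSpace ℝ (Fin p))
    (𝒜 : Set (Set (EuclideanSpace ℝ (Fin p)))) : ENNReal :=
  ⨆ A ∈ 𝒜, ENNReal.ofReal |P.real {ω | S ω ∈ A} - Q.real {ω | T ω ∈ A}|

/-- `L_n = max_j n⁻¹ ∑ i, E|X_{ij}|³`, with value `∞` if a third moment is infinite. -/
def thirdMoment (P : Measure Ω) (X : Fin n → Ω → EuclideanSpace ℝ (Fin p)) : ENNReal :=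
  ⨆ j, (∑ i, ∫⁻ ω, ENNReal.ofReal (|X i ω j| ^ 3) ∂P) / n

/-- `max_j |w j|` -/
def maxAbs (w : EuclideanSpace ℝ (Fin p)) : ℝ := ⨆ j, |w j|

/-- `M_{n,X}(φ) = n⁻¹ ∑ i, E[max_j |X_{ij}|³ 1{max_j |X_{ij}| > √n / (4 φ log p)}]` -/
def truncMoment (P : Measure Ω) (X : Fin n → Ω → EuclideanSpace ℝ (Fin p)) (φ : ℝ) : ENNReal :=
  (∑ i, ∫⁻ ω, ENNReal.ofReal
    ({w | Real.sqrt n / (4 * φ * Real.log p) < maxAbs w}.indicator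
      (fun w => maxAbs w ^ 3) (X i ω)) ∂P) / n

end HighDimCLT

end

open HighDimCLT

namespace HighDimCLT

/-! ### A smooth cutoff -/

/-! A hyperrectangle is an orthant (or a limit of orthants) in the doubled coordinates `(w, -w)`, so
it suffices to compare distribution functions of sums of vectors with `2p` coordinates. The
indicator of `{w ≤ y}` is smoothed to `g (φ * softMax β (w - y) - 1)` with a cutoff `g`, which moves
the boundary by `O(1/φ)`. Its third-order Taylor remainder in a small direction `x` is at most a
constant times `φ β² ∑ π_j |x_j|³`, with Gibbs weights `π_j`, and vanishes outside a strip of width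
`O(1/φ)` around the boundary (`exists_isSmoothOrthant`).

Let every index, independently with probability `t`, take its summand from `X` rather than from `Y`.
By the Margulis–Russo formula the `t`-derivative of the smoothed probability is the mean of the
effects of swapping single summands. First and second moments match, so only Taylor remainders
survive. The Gibbs weights are averaged independently of the swapped summand and add up to one, so
the total is the largest coordinatewise third moment times the probability that the mixed sum lies
in the strip, plus truncated tails (`IsSmoothOrthant.abs_sum_replace_le`). The maximum over `j` thus
stays outside the expectation.

The strip probability of a mixed sum is at most the Gaussian one plus `2ρ`, where `ρ` is the largest
distance to the Gaussian distribution function over all `t` and all thresholds. Nazarov's inequality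
`measureReal_strip_le` bounds the Gaussian strip by `O(√(log p) / φ)`. This yields `ρ ≤ C √(log p) /
φ + ε ρ + tails` with `ε` of order `φ³ (log p)² L / √n`, and `ρ` is absorbed when `ε` is small
(`exists_abs_orthant_sub_le`). Taking `φ` as large as this permits, up to a constant, gives the
rate. -/

lemma deriv_eq_zero_of_const_compl_Icc {g : ℝ → ℝ} {u v : ℝ}
    (h0 : ∀ t < 0, g t = u) (h1 : ∀ t > 1, g t = v) {t : ℝ} (ht : t < 0 ∨ 1 < t) :
    deriv g t = 0 := by
  rcases ht with ht | ht
  · have : g =ᶠ[nhds t] fun _ => u := by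
      filter_upwards [Iio_mem_nhds ht] with s hs using h0 s hs
    rw [this.deriv_eq, deriv_const]
  · have : g =ᶠ[nhds t] fun _ => v := by
      filter_upwards [Ioi_mem_nhds ht] with s hs using h1 s hs
    rw [this.deriv_eq, deriv_const]

lemma exists_bound_of_zero_compl_Icc {g : ℝ → ℝ} (hg : Continuous g)
    (h : ∀ t, t < 0 ∨ 1 < t → g t = 0) : ∃ C, 0 ≤ C ∧ ∀ t, |g t| ≤ C := by
  obtain ⟨C, hC⟩ := (isCompact_Icc (a := (0 : ℝ)) (b := 1)).exists_bound_of_continuousOn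
    hg.continuousOn
  refine ⟨max C 0, le_max_right _ _, fun t => ?_⟩
  by_cases ht : t < 0 ∨ 1 < t
  · simp [h t ht]
  · push Not at ht
    exact (hC t ⟨ht.1, ht.2⟩).trans (le_max_left _ _)

/-- There is a `C³` cutoff, equal to `1` on `(-∞, 0]` and to `0` on `[1, ∞)`, with bounded
derivatives. -/
lemma exists_smooth_cutoff : ∃ (g g₁ g₂ g₃ : ℝ → ℝ) (C : ℝ), 0 ≤ C ∧
    (∀ t, HasDerivAt g (g₁ t) t) ∧ (∀ t, HasDerivAt g₁ (g₂ t) t) ∧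
    (∀ t, HasDerivAt g₂ (g₃ t) t) ∧ Continuous g₃ ∧
    (∀ t, |g₁ t| ≤ C) ∧ (∀ t, |g₂ t| ≤ C) ∧ (∀ t, |g₃ t| ≤ C) ∧
    (∀ t ≤ 0, g t = 1) ∧ (∀ t, 1 ≤ t → g t = 0) ∧ (∀ t, 0 ≤ g t) ∧ (∀ t, g t ≤ 1) ∧
    (∀ t, t < 0 ∨ 1 < t → g₁ t = 0) ∧ (∀ t, t < 0 ∨ 1 < t → g₂ t = 0) ∧
    (∀ t, t < 0 ∨ 1 < t → g₃ t = 0) := by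
  set g : ℝ → ℝ := fun t => 1 - Real.smoothTransition t with hgdef
  have hg : ContDiff ℝ 3 g := contDiff_const.sub Real.smoothTransition.contDiff
  have hg1 : ContDiff ℝ 2 (deriv g) := by
    have : ContDiff ℝ (2 + 1) g := by exact_mod_cast hg
    exact (contDiff_succ_iff_deriv.1 this).2.2
  have hg2 : ContDiff ℝ 1 (deriv (deriv g)) := by
    have : ContDiff ℝ (1 + 1) (deriv g) := by exact_mod_cast hg1
    exact (contDiff_succ_iff_deriv.1 this).2.2
  have hg3 : Continuous (deriv (deriv (deriv g))) := hg2.continuous_deriv le_rfl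
  have z0 : ∀ t ≤ 0, g t = 1 := fun t ht => by simp [hgdef, Real.smoothTransition.zero_of_nonpos ht]
  have z1 : ∀ t, 1 ≤ t → g t = 0 := fun t ht => by
    simp [hgdef, Real.smoothTransition.one_of_one_le ht]
  have d1 : ∀ t, t < 0 ∨ 1 < t → deriv g t = 0 := fun t =>
    deriv_eq_zero_of_const_compl_Icc
      (fun s hs => z0 s hs.le) (fun s hs => z1 s hs.le)
  have d2 : ∀ t, t < 0 ∨ 1 < t → deriv (deriv g) t = 0 := fun t =>
    deriv_eq_zero_of_const_compl_Icc
      (fun s hs => d1 s (.inl hs)) (fun s hs => d1 s (.inr hs))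
  have d3 : ∀ t, t < 0 ∨ 1 < t → deriv (deriv (deriv g)) t = 0 := fun t =>
    deriv_eq_zero_of_const_compl_Icc
      (fun s hs => d2 s (.inl hs)) (fun s hs => d2 s (.inr hs))
  obtain ⟨C₁, h1, h1'⟩ := exists_bound_of_zero_compl_Icc hg1.continuous d1
  obtain ⟨C₂, h2, h2'⟩ := exists_bound_of_zero_compl_Icc hg2.continuous d2
  obtain ⟨C₃, h3, h3'⟩ := exists_bound_of_zero_compl_Icc hg3 d3
  refine ⟨g, deriv g, deriv (deriv g), deriv (deriv (deriv g)), C₁ + C₂ + C₃, by positivity,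
    fun t => (hg.differentiable (by norm_num) t).hasDerivAt,
    fun t => (hg1.differentiable (by norm_num) t).hasDerivAt,
    fun t => (hg2.differentiable (by norm_num) t).hasDerivAt, hg3,
    fun t => (h1' t).trans (by linarith), fun t => (h2' t).trans (by linarith),
    fun t => (h3' t).trans (by linarith), z0, z1,
    fun t => sub_nonneg.2 (Real.smoothTransition.le_one t),
    fun t => sub_le_self _ (Real.smoothTransition.nonneg t), d1, d2, d3⟩

/-- Second-order Taylor expansion on `[0, 1]` with a bound on the third derivative. -/
lemma abs_taylor_two_le {f f₁ f₂ f₃ : ℝ → ℝ} {M : ℝ}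
    (h1 : ∀ t, HasDerivAt f (f₁ t) t) (h2 : ∀ t, HasDerivAt f₁ (f₂ t) t)
    (h3 : ∀ t, HasDerivAt f₂ (f₃ t) t) (hM : ∀ t ∈ Set.Icc (0 : ℝ) 1, |f₃ t| ≤ M) :
    |f 1 - f 0 - f₁ 0 - f₂ 0 / 2| ≤ M := by
  have key : ∀ (k k' : ℝ → ℝ), (∀ t, HasDerivAt k (k' t) t) → k 0 = 0 →
      (∀ t ∈ Set.Icc (0 : ℝ) 1, |k' t| ≤ M) → ∀ t ∈ Set.Icc (0 : ℝ) 1, |k t| ≤ M := by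
    intro k k' hk hk0 hkM t ht
    have hM0 : 0 ≤ M := (abs_nonneg _).trans (hkM t ht)
    have := (convex_Icc (0 : ℝ) 1).norm_image_sub_le_of_norm_hasDerivWithin_le
      (f := k) (f' := k') (fun x _ => (hk x).hasDerivWithinAt) hkM
      (Set.left_mem_Icc.2 zero_le_one) ht
    simp only [hk0, sub_zero, Real.norm_eq_abs] at this
    refine this.trans ?_
    rw [abs_of_nonneg ht.1]
    exact mul_le_of_le_one_right hM0 ht.2
  have b2 := key (fun t => f₂ t - f₂ 0) f₃ (fun t => (h3 t).sub_const _) (by simp) hM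
  have b1 := key (fun t => f₁ t - f₁ 0 - f₂ 0 * t) (fun t => f₂ t - f₂ 0)
    (fun t => (((h2 t).sub_const (f₁ 0)).fun_sub
      ((hasDerivAt_id' t).const_mul (f₂ 0))).congr_deriv (by ring))
    (by simp) b2
  have b0 := key (fun t => f t - f 0 - f₁ 0 * t - f₂ 0 / 2 * t ^ 2)
    (fun t => f₁ t - f₁ 0 - f₂ 0 * t)
    (fun t => ((((h1 t).sub_const (f 0)).fun_sub ((hasDerivAt_id' t).const_mul (f₁ 0))).fun_sub
      ((hasDerivAt_pow 2 t).const_mul (f₂ 0 / 2))).congr_deriv (by push_cast; ring))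
    (by simp) b1 1 (by simp)
  simpa using b0

/-! ### The soft maximum -/

section SoftMax

variable {ι : Type*} [Fintype ι]

/-- The Gibbs weights `exp(β w_j) / ∑ exp(β w_k)`. -/
noncomputable def gibbs (β : ℝ) (w : ι → ℝ) (j : ι) : ℝ :=
  Real.exp (β * w j) / ∑ k, Real.exp (β * w k)

/-- The mean of `f` under the Gibbs weights. -/
noncomputable def gibbsMean (β : ℝ) (f : ι → ℝ) (w : ι → ℝ) : ℝ := ∑ j, gibbs β w j * f j

/-- The soft maximum `β⁻¹ log ∑ exp(β w_j)`. -/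
noncomputable def softMax (β : ℝ) (w : ι → ℝ) : ℝ := β⁻¹ * Real.log (∑ j, Real.exp (β * w j))

lemma gibbs_nonneg (β : ℝ) (w : ι → ℝ) (j : ι) : 0 ≤ gibbs β w j := by
  unfold gibbs; positivity

variable [Nonempty ι]

lemma sum_exp_pos (β : ℝ) (w : ι → ℝ) : 0 < ∑ k, Real.exp (β * w k) :=
  Finset.sum_pos (fun _ _ => Real.exp_pos _) Finset.univ_nonempty

lemma sum_gibbs (β : ℝ) (w : ι → ℝ) : ∑ j, gibbs β w j = 1 := by
  simp only [gibbs, ← Finset.sum_div]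
  exact div_self (sum_exp_pos β w).ne'

lemma gibbs_le_one (β : ℝ) (w : ι → ℝ) (j : ι) : gibbs β w j ≤ 1 := by
  rw [← sum_gibbs β w]
  exact Finset.single_le_sum (fun k _ => gibbs_nonneg β w k) (Finset.mem_univ j)

lemma continuous_gibbs (β : ℝ) (j : ι) : Continuous fun w : ι → ℝ => gibbs β w j := by
  unfold gibbs
  exact Continuous.div (by fun_prop) (by fun_prop) fun w => (sum_exp_pos β w).ne'

lemma continuous_softMax (β : ℝ) : Continuous (softMax β : (ι → ℝ) → ℝ) := by
  unfold softMax
  exact continuous_const.mul (Continuous.log (by fun_prop) fun w => (sum_exp_pos β w).ne')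

/-- Every exponential changes by a factor between `e^{-1/2}` and `e^{1/2}`. This stability at scale
`1/(2β)` is the origin of the truncation level in the theorem. -/
lemma gibbs_add_le {β : ℝ} (hβ : 0 ≤ β) (w x : ι → ℝ) (hx : 2 * β * ‖x‖ ≤ 1) (j : ι) :
    gibbs β (w + x) j ≤ Real.exp 1 * gibbs β w j := by
  have hb : ∀ k, |β * x k| ≤ 1 / 2 := fun k => by
    rw [abs_mul, abs_of_nonneg hβ]
    nlinarith [mul_le_mul_of_nonneg_left (norm_le_pi_norm x k) hβ, Real.norm_eq_abs (x k)]
  have h1 : Real.exp (β * (w + x) j) ≤ Real.exp (1 / 2) * Real.exp (β * w j) := by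
    rw [← Real.exp_add, Real.exp_le_exp, Pi.add_apply]
    linarith [(abs_le.1 (hb j)).2]
  have h2 : Real.exp (-(1 / 2)) * ∑ k, Real.exp (β * w k) ≤ ∑ k, Real.exp (β * (w + x) k) := by
    rw [Finset.mul_sum]
    refine Finset.sum_le_sum fun k _ => ?_
    rw [← Real.exp_add, Real.exp_le_exp, Pi.add_apply]
    linarith [(abs_le.1 (hb k)).1]
  unfold gibbs
  calc _ ≤ (Real.exp (1 / 2) * Real.exp (β * w j)) /
        (Real.exp (-(1 / 2)) * ∑ k, Real.exp (β * w k)) := by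
        have := sum_exp_pos β w
        gcongr
    _ = _ := by
        rw [mul_div_mul_comm, ← Real.exp_sub]; norm_num

lemma softMax_le {β : ℝ} (hβ : 0 < β) {w : ι → ℝ} {s : ℝ} (h : ∀ j, w j ≤ s) :
    softMax β w ≤ s + Real.log (Fintype.card ι) / β := by
  have h1 : Real.log (∑ j, Real.exp (β * w j)) ≤ Real.log (Fintype.card ι) + β * s := by
    have : ∑ j, Real.exp (β * w j) ≤ Fintype.card ι * Real.exp (β * s) := by
      calc _ ≤ ∑ _j : ι, Real.exp (β * s) := by gcongr with j; exact h j
        _ = _ := by simp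
    refine (Real.log_le_log (sum_exp_pos β w) this).trans_eq ?_
    rw [Real.log_mul (by simp) (Real.exp_ne_zero _), Real.log_exp]
  unfold softMax
  calc _ ≤ β⁻¹ * (Real.log (Fintype.card ι) + β * s) := by gcongr
    _ = _ := by field_simp; ring

lemma le_softMax {β : ℝ} (hβ : 0 < β) (w : ι → ℝ) (j : ι) : w j ≤ softMax β w := by
  unfold softMax
  rw [le_inv_mul_iff₀ hβ, Real.le_log_iff_exp_le (sum_exp_pos β w)]
  exact Finset.single_le_sum (f := fun k => Real.exp (β * w k)) (fun k _ => (Real.exp_pos _).le)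
    (Finset.mem_univ j)

omit [Nonempty ι] in
lemma hasDerivAt_sum_exp_line (β : ℝ) (f w x : ι → ℝ) (t : ℝ) :
    HasDerivAt (fun t : ℝ => ∑ j, Real.exp (β * (w + t • x) j) * f j)
      (∑ j, Real.exp (β * (w + t • x) j) * (β * x j) * f j) t := by
  refine HasDerivAt.fun_sum fun j _ => ?_
  have : HasDerivAt (fun t : ℝ => β * (w + t • x) j) (β * x j) t := by
    simpa using (((hasDerivAt_id t).mul_const (x j)).const_add (w j)).const_mul β
  exact (this.exp).mul_const (f j)

lemma hasDerivAt_softMax_line {β : ℝ} (hβ : 0 < β) (w x : ι → ℝ) (t : ℝ) :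
    HasDerivAt (fun t : ℝ => softMax β (w + t • x)) (gibbsMean β x (w + t • x)) t := by
  have h := (hasDerivAt_sum_exp_line β (fun _ => 1) w x t)
  simp only [mul_one] at h
  refine ((h.log (sum_exp_pos β _).ne').const_mul β⁻¹).congr_deriv (Eq.symm ?_)
  simp only [gibbsMean, gibbs]
  rw [← mul_div_assoc, Finset.mul_sum, Finset.sum_div]
  refine Finset.sum_congr rfl fun j _ => ?_
  field_simp

omit [Nonempty ι] in
lemma gibbsMean_eq_div (β : ℝ) (f w : ι → ℝ) :
    gibbsMean β f w = (∑ j, Real.exp (β * w j) * f j) / ∑ j, Real.exp (β * w j) := by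
  simp only [gibbsMean, gibbs, Finset.sum_div, div_mul_eq_mul_div]

/-- The derivative is `β` times the covariance of `x` and `f` under the Gibbs weights. With `f = x`
and `f = x * x` it expresses all derivatives of the soft maximum up to order three through Gibbs
moments of `x`. -/
lemma hasDerivAt_gibbsMean_line (β : ℝ) (f w x : ι → ℝ) (t : ℝ) :
    HasDerivAt (fun t : ℝ => gibbsMean β f (w + t • x))
      (β * (gibbsMean β (x * f) (w + t • x) -
        gibbsMean β x (w + t • x) * gibbsMean β f (w + t • x))) t := by
  have h0 := (hasDerivAt_sum_exp_line β (fun _ => 1) w x t)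
  simp only [mul_one] at h0
  have h1 := hasDerivAt_sum_exp_line β f w x t
  simp only [gibbsMean_eq_div]
  refine (h1.fun_div h0 (sum_exp_pos β _).ne').congr_deriv (Eq.symm ?_)
  have e1 : ∑ j, Real.exp (β * (w + t • x) j) * (β * x j) * f j =
      β * ∑ j, Real.exp (β * (w + t • x) j) * (x * f) j := by
    rw [Finset.mul_sum]; exact Finset.sum_congr rfl fun j _ => by simp; ring
  have e2 : ∑ j, Real.exp (β * (w + t • x) j) * (β * x j) =
      β * ∑ j, Real.exp (β * (w + t • x) j) * x j := by
    rw [Finset.mul_sum]; exact Finset.sum_congr rfl fun j _ => by ring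
  rw [e1, e2]
  have := (sum_exp_pos β (w + t • x)).ne'
  field_simp

omit [Nonempty ι] in
lemma abs_gibbsMean_le (β : ℝ) (f w : ι → ℝ) :
    |gibbsMean β f w| ≤ gibbsMean β (fun j => |f j|) w := by
  unfold gibbsMean
  refine (Finset.abs_sum_le_sum_abs _ _).trans_eq (Finset.sum_congr rfl fun j _ => ?_)
  rw [abs_mul, abs_of_nonneg (gibbs_nonneg β w j)]

lemma abs_gibbsMean_pow_three_le (β : ℝ) (x w : ι → ℝ) :
    |gibbsMean β x w| ^ 3 ≤ gibbsMean β (fun j => |x j| ^ 3) w :=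
  (pow_le_pow_left₀ (abs_nonneg _) (abs_gibbsMean_le β x w) 3).trans <|
    Real.pow_arith_mean_le_arith_mean_pow _ _ _ (fun j _ => gibbs_nonneg β w j)
      (sum_gibbs β w) (fun _ _ => abs_nonneg _) 3

/-- Young's inequality `u v² ≤ u³/3 + 2v³/3`, that is `(u + 2v)(u - v)² ≥ 0`, averaged over two
independent draws from the Gibbs weights. -/
lemma abs_gibbsMean_mul_sq_le (β : ℝ) (x w : ι → ℝ) :
    |gibbsMean β x w| * |gibbsMean β (x * x) w| ≤ gibbsMean β (fun j => |x j| ^ 3) w := by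
  set π := gibbs β w
  have h0 : ∀ j, 0 ≤ π j := gibbs_nonneg β w
  have h1 : ∑ j, π j = 1 := sum_gibbs β w
  calc |gibbsMean β x w| * |gibbsMean β (x * x) w|
      ≤ (∑ j, π j * |x j|) * ∑ k, π k * |x k| ^ 2 := by
        refine mul_le_mul (abs_gibbsMean_le β x w) ((abs_gibbsMean_le β _ w).trans_eq ?_)
          (abs_nonneg _) (Finset.sum_nonneg fun j _ => mul_nonneg (h0 j) (abs_nonneg _))
        simp [gibbsMean, π, abs_mul, sq]
    _ = ∑ j, ∑ k, π j * π k * (|x j| * |x k| ^ 2) := by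
        rw [Finset.sum_mul_sum]
        exact Finset.sum_congr rfl fun j _ => Finset.sum_congr rfl fun k _ => by ring
    _ ≤ ∑ j, ∑ k, π j * π k * (|x j| ^ 3 / 3 + 2 * |x k| ^ 3 / 3) := by
        refine Finset.sum_le_sum fun j _ => Finset.sum_le_sum fun k _ =>
          mul_le_mul_of_nonneg_left ?_ (mul_nonneg (h0 j) (h0 k))
        have ha := abs_nonneg (x j)
        have hb := abs_nonneg (x k)
        nlinarith [mul_nonneg (add_nonneg ha (mul_nonneg zero_le_two hb))
          (sq_nonneg (|x j| - |x k|))]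
    _ = (∑ j, π j * |x j| ^ 3 / 3) * ∑ k, π k +
          (∑ j, π j) * ∑ k, 2 * (π k * |x k| ^ 3) / 3 := by
        rw [Finset.sum_mul_sum, Finset.sum_mul_sum, ← Finset.sum_add_distrib]
        refine Finset.sum_congr rfl fun j _ => ?_
        rw [← Finset.sum_add_distrib]
        exact Finset.sum_congr rfl fun k _ => by ring
    _ = _ := by
        rw [h1, mul_one, one_mul, ← Finset.sum_div, ← Finset.sum_div, ← Finset.mul_sum]
        simp only [gibbsMean, π]; ring

end SoftMax

/-! ### Smooth indicators of orthants. -/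

section SmoothIndicator

variable {ι : Type*} [Fintype ι] [Nonempty ι]

/-- The composition of a smooth function with an affine function of the soft maximum, expanded to
second order along a line. -/
lemma abs_taylor_comp_softMax_le {g g₁ g₂ g₃ : ℝ → ℝ} {C : ℝ}
    (hg : ∀ t, HasDerivAt g (g₁ t) t) (hg₁ : ∀ t, HasDerivAt g₁ (g₂ t) t)
    (hg₂ : ∀ t, HasDerivAt g₂ (g₃ t) t) (b₁ : ∀ t, |g₁ t| ≤ C) (b₂ : ∀ t, |g₂ t| ≤ C)
    (b₃ : ∀ t, |g₃ t| ≤ C) (hz₁ : ∀ t, t < 0 ∨ 1 < t → g₁ t = 0)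
    (hz₂ : ∀ t, t < 0 ∨ 1 < t → g₂ t = 0) (hz₃ : ∀ t, t < 0 ∨ 1 < t → g₃ t = 0)
    {β φ : ℝ} (hφ : 0 < φ) (hφβ : φ ≤ β) (u x : ι → ℝ) {A : ℝ} (hA : 0 ≤ A)
    (h : ∀ t ∈ Set.Icc (0 : ℝ) 1, 0 ≤ φ * softMax β (u + t • x) - 1 →
      φ * softMax β (u + t • x) - 1 ≤ 1 →
      gibbsMean β (fun j => |x j| ^ 3) (u + t • x) ≤ A) :
    |g (φ * softMax β (u + x) - 1) - g (φ * softMax β u - 1) -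
        ∑ j, φ * g₁ (φ * softMax β u - 1) * gibbs β u j * x j -
        (∑ j, ∑ k, (φ ^ 2 * g₂ (φ * softMax β u - 1) - φ * β * g₁ (φ * softMax β u - 1)) *
          gibbs β u j * gibbs β u k * (x j * x k) +
        ∑ j, φ * β * g₁ (φ * softMax β u - 1) * gibbs β u j * (x j * x j)) / 2| ≤
      13 * C * φ * β ^ 2 * A := by
  have hβ : 0 < β := hφ.trans_le hφβ
  have hC : 0 ≤ C := (abs_nonneg _).trans (b₁ 0)
  set F : ℝ → ℝ := fun t => φ * softMax β (u + t • x) - 1 with hF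
  set E₁ : ℝ → ℝ := fun t => gibbsMean β x (u + t • x) with hE₁
  set E₂ : ℝ → ℝ := fun t => gibbsMean β (x * x) (u + t • x) with hE₂
  set E₃ : ℝ → ℝ := fun t => gibbsMean β (x * (x * x)) (u + t • x) with hE₃
  have dF : ∀ t, HasDerivAt F (φ * E₁ t) t := fun t =>
    ((hasDerivAt_softMax_line hβ u x t).const_mul φ).sub_const 1
  have dE₁ : ∀ t, HasDerivAt E₁ (β * (E₂ t - E₁ t * E₁ t)) t :=
    hasDerivAt_gibbsMean_line β x u x
  have dE₂ : ∀ t, HasDerivAt E₂ (β * (E₃ t - E₁ t * E₂ t)) t :=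
    hasDerivAt_gibbsMean_line β (x * x) u x
  have d0 : ∀ t, HasDerivAt (fun t => g (F t)) (g₁ (F t) * (φ * E₁ t)) t := fun t =>
    (hg (F t)).comp t (dF t)
  have d1 : ∀ t, HasDerivAt (fun t => g₁ (F t) * (φ * E₁ t))
      (g₂ (F t) * (φ * E₁ t) * (φ * E₁ t) + g₁ (F t) * (φ * (β * (E₂ t - E₁ t * E₁ t)))) t :=
    fun t => ((hg₁ (F t)).comp t (dF t)).fun_mul ((dE₁ t).const_mul φ)
  have d2 : ∀ t, HasDerivAt (fun t => g₂ (F t) * (φ * E₁ t) * (φ * E₁ t) +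
        g₁ (F t) * (φ * (β * (E₂ t - E₁ t * E₁ t))))
      (φ ^ 3 * g₃ (F t) * (E₁ t ^ 3) + 3 * φ ^ 2 * β * g₂ (F t) * (E₁ t * E₂ t - E₁ t ^ 3) +
        φ * β ^ 2 * g₁ (F t) * (E₃ t - 3 * (E₁ t * E₂ t) + 2 * E₁ t ^ 3)) t := fun t => by
    have e1 := (dE₁ t).const_mul φ
    have e2 := ((dE₂ t).fun_sub ((dE₁ t).fun_mul (dE₁ t))).const_mul β |>.const_mul φ
    refine (((((hg₂ (F t)).comp t (dF t)).fun_mul e1).fun_mul e1).fun_add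
      (((hg₁ (F t)).comp t (dF t)).fun_mul e2)).congr_deriv ?_
    simp only [Function.comp_apply]
    ring
  -- The derivatives of the cutoff vanish off `[0, 1]`, so the Gibbs moment has to be controlled
  -- only where `F t ∈ [0, 1]`. There the coefficients add up to `1 + 3·2 + 6 = 13`, using `φ ≤ β`.
  have bound : ∀ t ∈ Set.Icc (0 : ℝ) 1, |φ ^ 3 * g₃ (F t) * (E₁ t ^ 3) +
      3 * φ ^ 2 * β * g₂ (F t) * (E₁ t * E₂ t - E₁ t ^ 3) +
      φ * β ^ 2 * g₁ (F t) * (E₃ t - 3 * (E₁ t * E₂ t) + 2 * E₁ t ^ 3)| ≤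
      13 * C * φ * β ^ 2 * A := by
    intro t ht
    by_cases hs : F t < 0 ∨ 1 < F t
    · rw [hz₁ _ hs, hz₂ _ hs, hz₃ _ hs]
      simp only [mul_zero, zero_mul, add_zero, abs_zero]
      positivity
    push Not at hs
    have hA' := h t ht hs.1 hs.2
    have a1 : |E₁ t ^ 3| ≤ A := by
      rw [abs_pow]; exact (abs_gibbsMean_pow_three_le β x _).trans hA'
    have a2 : |E₁ t * E₂ t| ≤ A := by
      rw [abs_mul]; exact (abs_gibbsMean_mul_sq_le β x _).trans hA'
    have a3 : |E₃ t| ≤ A := by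
      refine (abs_gibbsMean_le β _ _).trans (le_of_eq_of_le ?_ hA')
      congr 1; ext j; simp only [Pi.mul_apply, abs_mul]; ring
    have a4 : |E₁ t * E₂ t - E₁ t ^ 3| ≤ 2 * A := (abs_sub _ _).trans (by linarith)
    have a5 : |E₃ t - 3 * (E₁ t * E₂ t) + 2 * E₁ t ^ 3| ≤ 6 * A := by
      rw [abs_le] at *
      constructor <;> linarith
    have c1 : |φ ^ 3 * g₃ (F t) * (E₁ t ^ 3)| ≤ φ ^ 3 * C * A := by
      rw [abs_mul, abs_mul, abs_of_pos (by positivity : 0 < φ ^ 3)]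
      gcongr; exact b₃ _
    have c2 : |3 * φ ^ 2 * β * g₂ (F t) * (E₁ t * E₂ t - E₁ t ^ 3)| ≤
        3 * φ ^ 2 * β * C * (2 * A) := by
      rw [abs_mul, abs_mul, abs_of_pos (by positivity : 0 < 3 * φ ^ 2 * β)]
      gcongr; exact b₂ _
    have c3 : |φ * β ^ 2 * g₁ (F t) * (E₃ t - 3 * (E₁ t * E₂ t) + 2 * E₁ t ^ 3)| ≤
        φ * β ^ 2 * C * (6 * A) := by
      rw [abs_mul, abs_mul, abs_of_pos (by positivity : 0 < φ * β ^ 2)]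
      gcongr; exact b₁ _
    have q1 : φ ^ 3 * C * A ≤ φ * β ^ 2 * C * A := by
      have : φ ^ 3 ≤ φ * β ^ 2 := by
        calc φ ^ 3 = φ * φ ^ 2 := by ring
          _ ≤ _ := by gcongr
      gcongr
    have q2 : φ ^ 2 * β * C * A ≤ φ * β ^ 2 * C * A := by
      have : φ ^ 2 * β ≤ φ * β ^ 2 := by
        calc φ ^ 2 * β = φ * β * φ := by ring
          _ ≤ φ * β * β := by gcongr
          _ = _ := by ring
      gcongr
    refine (abs_add_three _ _ _).trans ?_
    linarith
  have main := abs_taylor_two_le d0 d1 d2 bound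
  have hF0 : F 0 = φ * softMax β u - 1 := by simp [hF]
  have hF1 : F 1 = φ * softMax β (u + x) - 1 := by simp [hF]
  have hE10 : E₁ 0 = ∑ j, gibbs β u j * x j := by simp [hE₁, gibbsMean]
  have hE20 : E₂ 0 = ∑ j, gibbs β u j * (x j * x j) := by simp [hE₂, gibbsMean]
  refine le_of_eq_of_le (congrArg abs ?_) main
  rw [hF0, hF1, hE10, hE20]
  have s1 : ∑ j, φ * g₁ (φ * softMax β u - 1) * gibbs β u j * x j =
      g₁ (φ * softMax β u - 1) * (φ * ∑ j, gibbs β u j * x j) := by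
    simp only [Finset.mul_sum]; exact Finset.sum_congr rfl fun j _ => by ring
  have s2 : ∑ j, φ * β * g₁ (φ * softMax β u - 1) * gibbs β u j * (x j * x j) =
      φ * β * g₁ (φ * softMax β u - 1) * ∑ j, gibbs β u j * (x j * x j) := by
    simp only [Finset.mul_sum]; exact Finset.sum_congr rfl fun j _ => by ring
  have s3 : ∑ j, ∑ k, (φ ^ 2 * g₂ (φ * softMax β u - 1) - φ * β * g₁ (φ * softMax β u - 1)) *
      gibbs β u j * gibbs β u k * (x j * x k) =
      (φ ^ 2 * g₂ (φ * softMax β u - 1) - φ * β * g₁ (φ * softMax β u - 1)) *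
      ((∑ j, gibbs β u j * x j) * ∑ k, gibbs β u k * x k) := by
    rw [Finset.sum_mul_sum]; simp only [Finset.mul_sum]
    exact Finset.sum_congr rfl fun j _ => Finset.sum_congr rfl fun k _ => by ring
  rw [s1, s2, s3]
  ring

/-- The data of a smooth approximation `m` of the indicator of `{w | w ≤ y}`, at scale `φ⁻¹`,
with a second-order expansion `a`, `c` whose remainder is controlled with the constant `K` and the
Gibbs weights of inverse temperature `β`. -/
structure IsSmoothOrthant (K β φ : ℝ) (y : ι → ℝ) (m : (ι → ℝ) → ℝ) (a : ι → (ι → ℝ) → ℝ)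
    (c : ι → ι → (ι → ℝ) → ℝ) (B : ℝ) : Prop where
  measurable : Measurable m
  measurable_fst : ∀ j, Measurable (a j)
  measurable_snd : ∀ j k, Measurable (c j k)
  nonneg : ∀ w, 0 ≤ m w
  le_one : ∀ w, m w ≤ 1
  bound_fst : ∀ j w, |a j w| ≤ B
  bound_snd : ∀ j k w, |c j k w| ≤ B
  eq_one : ∀ w, w ≤ y → m w = 1
  eq_zero : ∀ w, ¬ (∀ j, w j ≤ y j + 2 / φ) → m w = 0
  remainder_le : ∀ z x, |m (z + x) - m z - ∑ j, a j z * x j - ∑ j, ∑ k, c j k z * (x j * x k)| ≤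
    K * φ * β ^ 2 * ‖x‖ ^ 3
  remainder_small : ∀ z x, 2 * β * ‖x‖ ≤ 1 →
    |m (z + x) - m z - ∑ j, a j z * x j - ∑ j, ∑ k, c j k z * (x j * x k)| ≤
      K * φ * β ^ 2 * ({z | (∀ j, z j ≤ y j + 3 / φ) ∧ ¬ ∀ j, z j ≤ y j - 2 / φ}.indicator
        (fun z => ∑ j, gibbs β (z - y) j * |x j| ^ 3) z)

/-- The soft maximum exceeds the maximum by at most `log(card)/β ≤ 1/φ`. Hence `φ * softMax β (w -
y) - 1` is nonpositive for `w ≤ y`, and at least `1` once some coordinate exceeds `y` by `2/φ`. -/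
lemma exists_isSmoothOrthant : ∃ K : ℝ, 0 < K ∧ ∀ {ι : Type*} [Fintype ι] [Nonempty ι] {β φ : ℝ},
    0 < φ → φ ≤ β → φ * Real.log (Fintype.card ι) ≤ β → ∀ y : ι → ℝ,
      ∃ m a c B, IsSmoothOrthant K β φ y m a c B := by
  classical
  obtain ⟨g, g₁, g₂, g₃, C, hC, hg, hg₁, hg₂, -, b₁, b₂, b₃, z0, z1, gnn, gle, hz₁, hz₂, hz₃⟩ :=
    exists_smooth_cutoff
  -- The factor `e` pays for moving the Gibbs weights from `z + t • x` back to `z`; the summand `1`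
  -- keeps the constant positive even if `C = 0`.
  refine ⟨13 * C * Real.exp 1 + 1, by positivity, ?_⟩
  intro ι _ _ β φ hφ hφβ hcard y
  have hβ : 0 < β := hφ.trans_le hφβ
  have hlog : Real.log (Fintype.card ι) / β ≤ 1 / φ := by
    rw [div_le_div_iff₀ hβ hφ]; linarith
  have hgc : Continuous g := continuous_iff_continuousAt.2 fun t => (hg t).continuousAt
  have hg₁c : Continuous g₁ := continuous_iff_continuousAt.2 fun t => (hg₁ t).continuousAt
  have hg₂c : Continuous g₂ := continuous_iff_continuousAt.2 fun t => (hg₂ t).continuousAt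
  set F : (ι → ℝ) → ℝ := fun w => φ * softMax β (w - y) - 1 with hF
  have hFc : Continuous F := by
    have := (continuous_softMax (ι := ι) β).comp (continuous_id.sub (continuous_const (y := y)))
    exact (continuous_const.mul this).sub continuous_const
  have hπc : ∀ j, Continuous fun w : ι → ℝ => gibbs β (w - y) j := fun j =>
    (continuous_gibbs β j).comp (continuous_id.sub continuous_const)
  have hπ : ∀ (w : ι → ℝ) j, |gibbs β (w - y) j| ≤ 1 := fun w j => by
    rw [abs_of_nonneg (gibbs_nonneg _ _ _)]; exact gibbs_le_one _ _ _
  let a : ι → (ι → ℝ) → ℝ := fun j w => φ * g₁ (F w) * gibbs β (w - y) j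
  -- Half the Hessian; the diagonal term comes from differentiating the Gibbs weights.
  let c : ι → ι → (ι → ℝ) → ℝ := fun j k w =>
    ((φ ^ 2 * g₂ (F w) - φ * β * g₁ (F w)) * gibbs β (w - y) j * gibbs β (w - y) k +
      if j = k then φ * β * g₁ (F w) * gibbs β (w - y) j else 0) / 2
  have hmain : ∀ (z x : ι → ℝ) (A : ℝ), 0 ≤ A →
      (∀ t ∈ Set.Icc (0 : ℝ) 1, 0 ≤ F (z + t • x) → F (z + t • x) ≤ 1 →
        gibbsMean β (fun j => |x j| ^ 3) (z + t • x - y) ≤ A) →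
      |g (F (z + x)) - g (F z) - ∑ j, a j z * x j - ∑ j, ∑ k, c j k z * (x j * x k)| ≤
        13 * C * φ * β ^ 2 * A := by
    intro z x A hA h
    have hzt : ∀ t : ℝ, z - y + t • x = z + t • x - y := fun t => by abel
    have := abs_taylor_comp_softMax_le hg hg₁ hg₂ b₁ b₂ b₃ hz₁ hz₂ hz₃ hφ hφβ (z - y) x hA
      (fun t ht h0 h1 => by rw [hzt] at *; exact h t ht h0 h1)
    rw [show z - y + x = z + x - y by abel] at this
    refine le_of_eq_of_le (congrArg abs (congrArg₂ _ rfl ?_)) this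
    simp only [c, div_mul_eq_mul_div, ← Finset.sum_div, add_mul, Finset.sum_add_distrib, ite_mul,
      zero_mul, Finset.sum_ite_eq, Finset.mem_univ, if_true]
    rfl
  refine ⟨fun w => g (F w), a, c, φ * C + φ ^ 2 * C + 2 * (φ * β * C), ⟨?_, ?_, ?_, ?_, ?_, ?_, ?_,
    ?_, ?_, ?_, ?_⟩⟩
  · exact (hgc.comp hFc).measurable
  · exact fun j => (((continuous_const.mul (hg₁c.comp hFc)).mul (hπc j))).measurable
  · intro j k
    have e : Continuous fun w => φ * β * g₁ (F w) * gibbs β (w - y) j :=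
      (continuous_const.mul (hg₁c.comp hFc)).mul (hπc j)
    have e' : Continuous fun w =>
        (φ ^ 2 * g₂ (F w) - φ * β * g₁ (F w)) * gibbs β (w - y) j * gibbs β (w - y) k :=
      (((continuous_const.mul (hg₂c.comp hFc)).sub
        (continuous_const.mul (hg₁c.comp hFc))).mul (hπc j)).mul (hπc k)
    by_cases hjk : j = k
    · simp only [c, hjk, if_true] at *; exact ((e'.add e).div_const 2).measurable
    · simp only [c, hjk, if_false]; exact ((e'.add continuous_const).div_const 2).measurable
  · exact fun w => gnn _
  · exact fun w => gle _
  · intro j w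
    have : |a j w| ≤ φ * C := by
      simp only [a, abs_mul, abs_of_pos hφ]
      calc _ ≤ φ * C * 1 := by gcongr <;> [exact b₁ _; exact hπ _ _]
        _ = _ := by ring
    have h2 : 0 ≤ φ ^ 2 * C + 2 * (φ * β * C) := by positivity
    linarith
  · intro j k w
    have e1 : |φ ^ 2 * g₂ (F w) - φ * β * g₁ (F w)| ≤ φ ^ 2 * C + φ * β * C := by
      refine (abs_sub _ _).trans ?_
      rw [abs_mul, abs_mul, abs_of_pos (by positivity : 0 < φ ^ 2),
        abs_of_pos (by positivity : 0 < φ * β)]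
      gcongr <;> [exact b₂ _; exact b₁ _]
    have e2 : |(φ ^ 2 * g₂ (F w) - φ * β * g₁ (F w)) * gibbs β (w - y) j * gibbs β (w - y) k| ≤
        φ ^ 2 * C + φ * β * C := by
      rw [abs_mul, abs_mul]
      calc _ ≤ (φ ^ 2 * C + φ * β * C) * 1 * 1 := by gcongr <;> exact hπ _ _
        _ = _ := by ring
    have e3 : |if j = k then φ * β * g₁ (F w) * gibbs β (w - y) j else 0| ≤ φ * β * C := by
      split_ifs
      · rw [abs_mul, abs_mul, abs_of_pos (by positivity : 0 < φ * β)]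
        calc _ ≤ φ * β * C * 1 := by gcongr <;> [exact b₁ _; exact hπ _ _]
          _ = _ := by ring
      · simp only [abs_zero]; positivity
    have e4 := (abs_add_le ((φ ^ 2 * g₂ (F w) - φ * β * g₁ (F w)) * gibbs β (w - y) j *
      gibbs β (w - y) k) (if j = k then φ * β * g₁ (F w) * gibbs β (w - y) j else 0)).trans
      (add_le_add e2 e3)
    simp only [c]
    rw [abs_div, abs_two]
    have h2 : 0 ≤ φ * C := by positivity
    have h3 := abs_nonneg ((φ ^ 2 * g₂ (F w) - φ * β * g₁ (F w)) * gibbs β (w - y) j *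
      gibbs β (w - y) k + (if j = k then φ * β * g₁ (F w) * gibbs β (w - y) j else 0))
    linarith
  · intro w hw
    refine z0 _ ?_
    have := softMax_le hβ (w := w - y) (s := 0) fun j => by simpa using hw j
    have : φ * softMax β (w - y) ≤ φ * (1 / φ) := by gcongr; linarith
    rw [mul_one_div_cancel hφ.ne'] at this
    simp only [hF]; linarith
  · intro w hw
    push Not at hw
    obtain ⟨j, hj⟩ := hw
    refine z1 _ ?_
    have := le_softMax hβ (w - y) j
    simp only [Pi.sub_apply] at this
    have : φ * (2 / φ) ≤ φ * softMax β (w - y) := by gcongr; linarith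
    rw [mul_div_cancel₀ _ hφ.ne'] at this
    simp only [hF]; linarith
  · intro z x
    refine (hmain z x (‖x‖ ^ 3) (by positivity) fun t _ _ _ => ?_).trans ?_
    · calc gibbsMean β (fun j => |x j| ^ 3) (z + t • x - y)
          ≤ ∑ j, gibbs β (z + t • x - y) j * ‖x‖ ^ 3 := by
            unfold gibbsMean
            gcongr with j
            · exact gibbs_nonneg _ _ _
            · exact pow_le_pow_left₀ (abs_nonneg _) (norm_le_pi_norm x j) 3
        _ = ‖x‖ ^ 3 := by rw [← Finset.sum_mul, sum_gibbs, one_mul]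
    · have : 13 * C ≤ 13 * C * Real.exp 1 + 1 := by
        nlinarith [Real.add_one_le_exp 1]
      gcongr
  · intro z x hx
    have hxt : ∀ t ∈ Set.Icc (0 : ℝ) 1, 2 * β * ‖t • x‖ ≤ 1 := fun t ht => by
      rw [norm_smul, Real.norm_eq_abs, abs_of_nonneg ht.1]
      have : t * ‖x‖ ≤ ‖x‖ := mul_le_of_le_one_left (norm_nonneg _) ht.2
      nlinarith
    have hxφ : ∀ t ∈ Set.Icc (0 : ℝ) 1, ∀ j, |(t • x) j| ≤ 1 / φ := fun t ht j => by
      refine (norm_le_pi_norm (t • x) j).trans ?_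
      rw [le_div_iff₀ hφ]
      nlinarith [hxt t ht, norm_nonneg (t • x)]
    have hnn : ∀ z : ι → ℝ, 0 ≤ ∑ j, gibbs β (z - y) j * |x j| ^ 3 := fun z =>
      Finset.sum_nonneg fun j _ => mul_nonneg (gibbs_nonneg _ _ _) (by positivity)
    refine (hmain z x (Real.exp 1 * ({z | (∀ j, z j ≤ y j + 3 / φ) ∧
      ¬ ∀ j, z j ≤ y j - 2 / φ}.indicator (fun z => ∑ j, gibbs β (z - y) j * |x j| ^ 3) z))
      (mul_nonneg (Real.exp_pos _).le (Set.indicator_nonneg (fun z _ => hnn z) z)) ?_).trans ?_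
    · intro t ht h0 h1
      -- Here the soft maximum at `z + t • x - y` lies in `[1/φ, 2/φ]`, and the displacement is at
      -- most `1/φ` per coordinate. So `z ≤ y + 3/φ`; and `z ≤ y - 2/φ` would put the moved point
      -- below `y - 1/φ`, making the soft maximum nonpositive.
      have hz : z ∈ {z | (∀ j, z j ≤ y j + 3 / φ) ∧ ¬ ∀ j, z j ≤ y j - 2 / φ} := by
        constructor
        · intro j
          have e1 := le_softMax hβ (z + t • x - y) j
          have e2 : softMax β (z + t • x - y) ≤ 2 / φ := by
            rw [le_div_iff₀ hφ]; simp only [hF] at h1; linarith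
          have e3 := (abs_le.1 (hxφ t ht j)).1
          simp only [Pi.sub_apply, Pi.add_apply] at e1
          have : 3 / φ = 1 / φ + 2 / φ := by ring
          linarith
        · intro hle
          have e1 := softMax_le hβ (w := z + t • x - y) (s := -(1 / φ)) fun j => by
            have e3 := (abs_le.1 (hxφ t ht j)).2
            have := hle j
            have e4 : 2 / φ = 1 / φ + 1 / φ := by ring
            simp only [Pi.sub_apply, Pi.add_apply]
            linarith
          have e2 : softMax β (z + t • x - y) ≤ 0 := by linarith
          simp only [hF] at h0
          nlinarith
      rw [Set.indicator_of_mem hz, gibbsMean, Finset.mul_sum]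
      refine Finset.sum_le_sum fun j _ => ?_
      rw [← mul_assoc]
      gcongr
      rw [show z + t • x - y = (z - y) + t • x by abel]
      exact gibbs_add_le hβ.le _ _ (hxt t ht) j
    · have h0 : 0 ≤ ({z | (∀ j, z j ≤ y j + 3 / φ) ∧ ¬ ∀ j, z j ≤ y j - 2 / φ}.indicator
        (fun z => ∑ j, gibbs β (z - y) j * |x j| ^ 3) z) :=
        Set.indicator_nonneg (fun z _ => hnn z) z
      have : 0 ≤ φ * β ^ 2 * ({z | (∀ j, z j ≤ y j + 3 / φ) ∧
        ¬ ∀ j, z j ≤ y j - 2 / φ}.indicator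
        (fun z => ∑ j, gibbs β (z - y) j * |x j| ^ 3) z) := by positivity
      linarith

end SmoothIndicator

/-! ### Anti-concentration of Gaussian vectors over orthants -/

/-- The density ratio at `s` is `exp(u s - u²/2)`. As `u ≥ 0`, an upper bound on `s` is enough; `A`
may extend to `-∞`. -/
lemma gaussianReal_le_exp_mul {u K : ℝ} (hu : 0 ≤ u) {A : Set ℝ} (hA : MeasurableSet A)
    (hK : ∀ s ∈ A, s ≤ K) :
    gaussianReal u 1 A ≤ ENNReal.ofReal (Real.exp (u * K)) * gaussianReal 0 1 A := by
  rw [gaussianReal_apply _ one_ne_zero, gaussianReal_apply _ one_ne_zero,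
    ← lintegral_const_mul _ (measurable_gaussianPDF 0 1)]
  refine setLIntegral_mono' hA fun s hs => ?_
  rw [gaussianPDF, gaussianPDF, ← ENNReal.ofReal_mul (Real.exp_pos _).le]
  refine ENNReal.ofReal_le_ofReal ?_
  simp only [gaussianPDFReal, sub_zero]
  rw [mul_left_comm, ← Real.exp_add]
  gcongr
  have := mul_le_mul_of_nonneg_left (hK s hs) hu
  simp only [NNReal.coe_one]
  nlinarith [sq_nonneg u]

lemma gaussianReal_Ioc_le {r s a : ℝ} (hr : 0 ≤ r) (hs : r ≤ s) (ha : 0 ≤ a) :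
    (gaussianReal 0 1).real (Set.Ioc s (s + a)) ≤ a * Real.exp (-r ^ 2 / 2) := by
  refine ENNReal.toReal_le_of_le_ofReal (by positivity) ?_
  rw [gaussianReal_apply _ one_ne_zero]
  calc _ ≤ ∫⁻ _ in Set.Ioc s (s + a), ENNReal.ofReal (Real.exp (-r ^ 2 / 2)) := by
        refine setLIntegral_mono' measurableSet_Ioc fun x hx => ENNReal.ofReal_le_ofReal ?_
        simp only [gaussianPDFReal, sub_zero, NNReal.coe_one, mul_one]
        have h1 : (√(2 * Real.pi))⁻¹ ≤ 1 := by
          refine inv_le_one_of_one_le₀ (Real.one_le_sqrt.2 ?_)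
          linarith [Real.pi_gt_three]
        calc _ ≤ 1 * Real.exp (-x ^ 2 / 2) := by gcongr
          _ ≤ _ := by
            rw [one_mul]
            gcongr
            exact hs.trans hx.1.le
    _ = _ := by
        rw [setLIntegral_const, Real.volume_Ioc, mul_comm, ← ENNReal.ofReal_mul (by linarith)]
        congr 2; ring

section

variable {ι : Type*} [Fintype ι]

/-- Shifting a Gaussian vector along the covariances with its `j`-th coordinate. -/
lemma measureReal_le_exp_mul_of_shift {μ : Measure (ι → ℝ)} [IsGaussian μ] {j : ι}
    (hmean : ∫ w, w j ∂μ = 0) (hvar : Var[fun w => w j; μ] = 1) {u K : ℝ} (hu : 0 ≤ u)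
    {G G' : Set (ι → ℝ)} (hG' : MeasurableSet G')
    (hshift : ∀ w ∈ G, w + u • (fun l => cov[fun w => w l, fun w => w j; μ]) ∈ G')
    (hK : ∀ w ∈ G', w j ≤ K) :
    μ.real G ≤ Real.exp (u * K) * μ.real G' := by
  set c : ι → ℝ := fun l => cov[fun w => w l, fun w => w j; μ] with hc
  have hgl : HasGaussianLaw (fun w : ι → ℝ => w) μ := IsGaussian.hasGaussianLaw_id
  have hm : ∀ l, MemLp (fun w : ι → ℝ => w l) 2 μ := fun l => (hgl.eval l).memLp_two
  have hcj : c j = 1 := by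
    rw [hc]; simp only
    rw [covariance_self (measurable_pi_apply j).aemeasurable, hvar]
  -- The residual of the regression on the `j`-th coordinate: uncorrelated with it, hence
  -- independent by joint Gaussianity. Since `c j = 1`, adding `u • c` fixes `W` and moves `w j` by
  -- `u`, so the shift acts on a standard Gaussian variable alone.
  let W : (ι → ℝ) → ι → ℝ := fun w => w - w j • c
  have hWm : Measurable W := by fun_prop
  have hjm : Measurable fun w : ι → ℝ => w j := measurable_pi_apply j
  have hind : IndepFun W (fun w : ι → ℝ => w j) μ := by
    -- The criterion for independence concerns two families of coordinates, so `w j` is viewed as a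
    -- family indexed by `Unit`.
    let L : (ι → ℝ) →L[ℝ] (ι → ℝ) × (Unit → ℝ) :=
      (ContinuousLinearMap.id ℝ (ι → ℝ) - (ContinuousLinearMap.proj j).smulRight c).prod
        (ContinuousLinearMap.pi fun _ => ContinuousLinearMap.proj j)
    have hL : HasGaussianLaw (fun w : ι → ℝ => ((fun l => w l - w j * c l), fun _ : Unit => w j))
        μ := hgl.map L
    have := hL.indepFun_of_covariance_eval fun l _ => by
      rw [covariance_fun_sub_left (hm l) ((hm j).mul_const _) (hm j), covariance_mul_const_left,
        covariance_self hjm.aemeasurable, hvar, one_mul]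
      exact sub_self _
    exact this.comp (φ := id) (ψ := fun v : Unit → ℝ => v ()) measurable_id (measurable_pi_apply _)
  have hlaw : μ.map (fun w : ι → ℝ => w j) = gaussianReal 0 1 := by
    rw [(hgl.eval j).map_eq_gaussianReal, hmean, hvar, Real.toNNReal_one]
  have hprod : μ.map (fun w => (W w, w j)) = (μ.map W).prod (gaussianReal 0 1) := by
    rw [← hlaw]
    exact (indepFun_iff_map_prod_eq_prod_map_map hWm.aemeasurable hjm.aemeasurable).1 hind
  have : IsProbabilityMeasure (μ.map W) := Measure.isProbabilityMeasure_map hWm.aemeasurable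
  have hrec : ∀ w, W w + w j • c = w := fun w => by simp [W]
  let A : (ι → ℝ) → Set ℝ := fun w => {s | w + s • c ∈ G' ∧ s ≤ K}
  let E : Set ((ι → ℝ) × ℝ) := {q | q.1 + (q.2 + u) • c ∈ G' ∧ q.2 + u ≤ K}
  let E' : Set ((ι → ℝ) × ℝ) := {q | q.1 + q.2 • c ∈ G' ∧ q.2 ≤ K}
  have hE : MeasurableSet E :=
    ((by fun_prop : Measurable fun q : (ι → ℝ) × ℝ => q.1 + (q.2 + u) • c) hG').inter
      (measurableSet_le (measurable_snd.add_const u) measurable_const)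
  have hE' : MeasurableSet E' :=
    ((by fun_prop : Measurable fun q : (ι → ℝ) × ℝ => q.1 + q.2 • c) hG').inter
      (measurableSet_le measurable_snd measurable_const)
  have hA : ∀ w, MeasurableSet (A w) := fun w =>
    ((by fun_prop : Measurable fun s : ℝ => w + s • c) hG').inter
      (measurableSet_le measurable_id measurable_const)
  have hpair : Measurable fun w => (W w, w j) := hWm.prodMk hjm
  have key : μ G ≤ ENNReal.ofReal (Real.exp (u * K)) * μ G' := by
    calc μ G ≤ μ ((fun w => (W w, w j)) ⁻¹' E) := by
          refine measure_mono fun w hw => ?_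
          have h1 := hshift w hw
          refine ⟨?_, ?_⟩
          · simp only [add_smul, ← add_assoc, hrec]; exact h1
          · have := hK _ h1
            simpa [hcj] using this
      _ = ∫⁻ w, gaussianReal 0 1 ((· + u) ⁻¹' A w) ∂(μ.map W) := by
          rw [← Measure.map_apply hpair hE, hprod, Measure.prod_apply hE]
          rfl
      _ = ∫⁻ w, gaussianReal u 1 (A w) ∂(μ.map W) := by
          refine lintegral_congr fun w => ?_
          rw [← Measure.map_apply (measurable_add_const u) (hA w), gaussianReal_map_add_const,
            zero_add]
      _ ≤ ∫⁻ w, ENNReal.ofReal (Real.exp (u * K)) * gaussianReal 0 1 (A w) ∂(μ.map W) :=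
          lintegral_mono fun w => gaussianReal_le_exp_mul hu (hA w) fun s hs => hs.2
      _ = ENNReal.ofReal (Real.exp (u * K)) * ((μ.map W).prod (gaussianReal 0 1)) E' := by
          rw [Measure.prod_apply hE', lintegral_const_mul]
          · rfl
          · exact measurable_measure_prodMk_left hE'
      _ = ENNReal.ofReal (Real.exp (u * K)) * μ ((fun w => (W w, w j)) ⁻¹' E') := by
          rw [← hprod, Measure.map_apply hpair hE']
      _ ≤ _ := by
          gcongr
          intro w hw
          have := hw.1
          simpa only [hrec] using this
  have h2 := ENNReal.toReal_mono (ENNReal.mul_ne_top ENNReal.ofReal_ne_top (measure_ne_top _ _)) key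
  rwa [ENNReal.toReal_mul, ENNReal.toReal_ofReal (Real.exp_pos _).le] at h2

omit [Fintype ι] in
-- The variance of the difference is nonnegative. Consequently a shift along the covariances with
-- coordinate `j` raises no coordinate more than the `j`-th, and a maximizer stays a maximizer.
lemma covariance_le_one {μ : Measure (ι → ℝ)} [IsGaussian μ] {l j : ι}
    (hl : Var[fun w => w l; μ] = 1) (hj : Var[fun w => w j; μ] = 1) :
    cov[fun w => w l, fun w => w j; μ] ≤ 1 := by
  have hgl : HasGaussianLaw (fun w : ι → ℝ => w) μ := IsGaussian.hasGaussianLaw_id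
  have h := variance_sub (hgl.eval l).memLp_two (hgl.eval j).memLp_two
  have h0 := variance_nonneg ((fun w : ι → ℝ => w l) - fun w => w j) μ
  rw [h, hl, hj] at h0
  linarith

/-- Split the strip according to the coordinate `j` that maximizes `w - y`. Shifting along the
covariances with coordinate `j` carries such a piece into about `1/(a r)` disjoint layers above it,
each time at the price of a bounded factor if `y j ≤ r`. So the pieces together have mass `O(a r)`.
The coordinates with `y j ≥ r` are handled by the Gaussian density and a union bound. -/
lemma measureReal_strip_le_of_var_one {μ : Measure (ι → ℝ)} [IsGaussian μ]
    (hmean : ∀ j, ∫ w, w j ∂μ = 0) (hvar : ∀ j, Var[fun w => w j; μ] = 1)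
    {r : ℝ} (hr : 1 ≤ r) (hcard : (Fintype.card ι : ℝ) ≤ Real.exp (r ^ 2 / 2)) (y : ι → ℝ)
    {a : ℝ} (ha : 0 < a) :
    μ.real {w | (∀ j, w j ≤ y j + a) ∧ ¬ ∀ j, w j ≤ y j} ≤ (2 * Real.exp 2 + 1) * (a * r) := by
  classical
  have hr0 : 0 < r := by linarith
  rcases lt_or_ge 1 (a * r) with har | har
  · refine measureReal_le_one.trans ?_
    nlinarith [Real.exp_pos 2]
  let e := Fintype.equivFin ι
  -- In the cell `G j k`, `j` is the first maximizer of `w - y` and the maximum lies in the `k`-th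
  -- layer of thickness `a`. Breaking ties by `e` makes the cells disjoint outright, with no null
  -- sets to discard.
  let G : ι → ℕ → Set (ι → ℝ) := fun j k => {w | (∀ l, w l - y l ≤ w j - y j) ∧
    (∀ l, e l < e j → w l - y l < w j - y j) ∧ k * a < w j - y j ∧ w j - y j ≤ (k + 1) * a}
  have hGm : ∀ j k, MeasurableSet (G j k) := fun j k => by
    simp only [G, Set.ofPred_and, Set.ofPred_forall]
    exact (MeasurableSet.iInter fun l => measurableSet_le (by fun_prop) (by fun_prop)).inter
      ((MeasurableSet.iInter fun l => MeasurableSet.iInter fun _ =>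
        measurableSet_lt (by fun_prop) (by fun_prop)).inter
      ((measurableSet_lt (by fun_prop) (by fun_prop)).inter
        (measurableSet_le (by fun_prop) (by fun_prop))))
  have hcover : {w : ι → ℝ | (∀ j, w j ≤ y j + a) ∧ ¬ ∀ j, w j ≤ y j} ⊆
      ⋃ j ∈ Finset.univ, G j 0 := by
    rintro w ⟨h1, h2⟩
    push Not at h2
    obtain ⟨j₀, hj₀⟩ := h2
    have : Nonempty ι := ⟨j₀⟩
    obtain ⟨m, -, hm⟩ := Finset.exists_max_image Finset.univ (fun l => w l - y l)
      Finset.univ_nonempty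
    obtain ⟨j, hj, hj'⟩ := Finset.exists_min_image
      (Finset.univ.filter fun l => w l - y l = w m - y m) e ⟨m, by simp⟩
    simp only [Finset.mem_filter, Finset.mem_univ, true_and] at hj hj' hm
    simp only [Finset.mem_univ, Set.iUnion_true, Set.mem_iUnion]
    refine ⟨j, fun l => by rw [hj]; exact hm l trivial, fun l hl => ?_, ?_, ?_⟩
    · refine lt_of_le_of_ne (by rw [hj]; exact hm l trivial) fun heq => ?_
      exact absurd (hj' l (heq.trans hj)) (not_le.2 hl)
    · have := hm j₀ trivial
      push_cast
      linarith
    · have := h1 j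
      push_cast
      linarith
  -- The layers fill a height of at most `1/r`, the scale on which a shift near level `r` changes
  -- the Gaussian density by a bounded factor.
  set N : ℕ := ⌊1 / (a * r)⌋₊ with hN
  have har0 : 0 < a * r := by positivity
  have hN1 : (N : ℝ) * (a * r) ≤ 1 := by
    have := Nat.floor_le (one_div_pos.2 har0).le
    rwa [← hN, le_div_iff₀ har0] at this
  have hNhalf : 1 ≤ 2 * (a * r) * N := by
    have h1 := Nat.lt_floor_add_one (1 / (a * r))
    have h2 : (1 : ℝ) ≤ N := by
      exact_mod_cast (Nat.one_le_floor_iff _).2 (by rw [le_div_iff₀ har0]; linarith)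
    rw [← hN, div_lt_iff₀ har0] at h1
    nlinarith
  have hdisj : ∑ j, ∑ k ∈ Finset.range N, μ.real (G j k) ≤ 1 := by
    rw [← Finset.sum_product', ← measureReal_biUnion_finset]
    · exact measureReal_le_one
    · rintro ⟨j, k⟩ - ⟨j', k'⟩ - hne
      refine Set.disjoint_left.2 fun w hw hw' => hne ?_
      have hjj : j = j' := by
        by_contra hjj
        rcases lt_or_gt_of_ne (fun h => hjj (e.injective h) : e j ≠ e j') with h | h
        · exact absurd (hw'.2.1 j h) (not_lt.2 (hw.1 j'))
        · exact absurd (hw.2.1 j' h) (not_lt.2 (hw'.1 j))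
      subst hjj
      have h1 : (k : ℝ) < k' + 1 := lt_of_mul_lt_mul_right (hw.2.2.1.trans_le hw'.2.2.2) ha.le
      have h2 : (k' : ℝ) < k + 1 := lt_of_mul_lt_mul_right (hw'.2.2.1.trans_le hw.2.2.2) ha.le
      have h1' : k < k' + 1 := by exact_mod_cast h1
      have h2' : k' < k + 1 := by exact_mod_cast h2
      rw [show k = k' by omega]
    · exact fun q _ => hGm q.1 q.2
  have hlow : ∀ j, y j ≤ r → μ.real (G j 0) ≤
      2 * (a * r) * Real.exp 2 * ∑ k ∈ Finset.range N, μ.real (G j k) := by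
    intro j hj
    -- The shift by `k * a` takes layer `0` to layer `k`. There `w j ≤ r + 1/r ≤ 2r` and `k * a ≤
    -- 1/r`, so the price is at most `e²`.
    have hstep : ∀ k ∈ Finset.range N, μ.real (G j 0) ≤ Real.exp 2 * μ.real (G j k) := by
      intro k hk
      have hkN : (k : ℝ) + 1 ≤ N := by exact_mod_cast Finset.mem_range.1 hk
      have hka : (k + 1) * a * r ≤ 1 := by nlinarith
      have := measureReal_le_exp_mul_of_shift (hmean j) (hvar j) (u := k * a) (by positivity)
        (K := 2 * r) (G := G j 0) (hGm j k) ?_ ?_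
      · refine this.trans ?_
        gcongr
        nlinarith
      · rintro w ⟨h1, h2, h3, h4⟩
        have hc : ∀ l, cov[fun w => w l, fun w => w j; μ] ≤ 1 := fun l =>
          covariance_le_one (hvar l) (hvar j)
        have hcj : cov[fun w : ι → ℝ => w j, fun w => w j; μ] = 1 := by
          rw [covariance_self (measurable_pi_apply j).aemeasurable, hvar]
        have hcl : ∀ l, (k : ℝ) * a * cov[fun w => w l, fun w => w j; μ] ≤ k * a := fun l =>
          mul_le_of_le_one_right (by positivity) (hc l)
        push_cast at h3 h4
        refine ⟨fun l => ?_, fun l hl => ?_, ?_, ?_⟩ <;>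
          simp only [Pi.add_apply, Pi.smul_apply, smul_eq_mul, hcj]
        · linarith [h1 l, hcl l]
        · linarith [h2 l hl, hcl l]
        · linarith
        · linarith
      · rintro w ⟨-, -, -, h4⟩
        nlinarith
    have := Finset.sum_le_sum hstep
    rw [Finset.sum_const, Finset.card_range, nsmul_eq_mul, ← Finset.mul_sum] at this
    calc μ.real (G j 0) ≤ (2 * (a * r) * N) * μ.real (G j 0) :=
          le_mul_of_one_le_left measureReal_nonneg hNhalf
      _ = 2 * (a * r) * (N * μ.real (G j 0)) := by ring
      _ ≤ 2 * (a * r) * (Real.exp 2 * ∑ k ∈ Finset.range N, μ.real (G j k)) := by gcongr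
      _ = _ := by ring
  -- Summed over all coordinates this contributes at most `a`, because the number of coordinates is
  -- at most `exp(r²/2)`.
  have hhigh : ∀ j, r ≤ y j → μ.real (G j 0) ≤ a * Real.exp (-r ^ 2 / 2) := by
    intro j hj
    have hgl : HasGaussianLaw (fun w : ι → ℝ => w) μ := IsGaussian.hasGaussianLaw_id
    have hlaw : μ.map (fun w : ι → ℝ => w j) = gaussianReal 0 1 := by
      rw [(hgl.eval j).map_eq_gaussianReal, hmean, hvar, Real.toNNReal_one]
    refine le_trans ?_ (gaussianReal_Ioc_le hr0.le hj ha.le)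
    rw [← hlaw, map_measureReal_apply (measurable_pi_apply j) measurableSet_Ioc]
    refine measureReal_mono fun w hw => ?_
    have h3 := hw.2.2.1
    have h4 := hw.2.2.2
    push_cast at h3 h4
    exact ⟨by linarith, by linarith⟩
  have hsum : ∀ j, μ.real (G j 0) ≤ 2 * (a * r) * Real.exp 2 *
      ∑ k ∈ Finset.range N, μ.real (G j k) + a * Real.exp (-r ^ 2 / 2) := by
    intro j
    have h0 : 0 ≤ ∑ k ∈ Finset.range N, μ.real (G j k) :=
      Finset.sum_nonneg fun _ _ => measureReal_nonneg
    rcases le_total (y j) r with hj | hj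
    · exact (hlow j hj).trans (le_add_of_nonneg_right (by positivity))
    · exact (hhigh j hj).trans (le_add_of_nonneg_left (by positivity))
  calc _ ≤ μ.real (⋃ j ∈ Finset.univ, G j 0) := measureReal_mono hcover (measure_ne_top _ _)
    _ ≤ ∑ j, μ.real (G j 0) := measureReal_biUnion_finset_le _ _
    _ ≤ ∑ j, (2 * (a * r) * Real.exp 2 * ∑ k ∈ Finset.range N, μ.real (G j k) +
          a * Real.exp (-r ^ 2 / 2)) := Finset.sum_le_sum fun j _ => hsum j
    _ = 2 * (a * r) * Real.exp 2 * ∑ j, ∑ k ∈ Finset.range N, μ.real (G j k) +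
          a * (Fintype.card ι * Real.exp (-r ^ 2 / 2)) := by
        rw [Finset.sum_add_distrib, ← Finset.mul_sum]; simp; ring
    _ ≤ 2 * (a * r) * Real.exp 2 * 1 + a * 1 := by
        gcongr
        calc _ ≤ Real.exp (r ^ 2 / 2) * Real.exp (-r ^ 2 / 2) := by gcongr
          _ = 1 := by rw [← Real.exp_add]; ring_nf; exact Real.exp_zero
    _ ≤ _ := by nlinarith

/-- Nazarov's inequality: anti-concentration of a centered Gaussian vector near the boundary of an
orthant. -/
lemma measureReal_strip_le {μ : Measure (ι → ℝ)} [IsGaussian μ] (hmean : ∀ j, ∫ w, w j ∂μ = 0)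
    {b : ℝ} (hb : 0 < b) (hvar : ∀ j, b ≤ Var[fun w => w j; μ]) {r : ℝ} (hr : 1 ≤ r)
    (hcard : (Fintype.card ι : ℝ) ≤ Real.exp (r ^ 2 / 2)) (y : ι → ℝ) {a : ℝ} (ha : 0 < a) :
    μ.real {w | (∀ j, w j ≤ y j + a) ∧ ¬ ∀ j, w j ≤ y j} ≤
      (2 * Real.exp 2 + 1) / √b * (a * r) := by
  -- After standardizing, coordinate `j` has strip width `a / σ j ≤ a / √b`.
  set σ : ι → ℝ := fun j => √(Var[fun w => w j; μ]) with hσ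
  have hbσ : ∀ j, √b ≤ σ j := fun j => Real.sqrt_le_sqrt (hvar j)
  have hsb : 0 < √b := Real.sqrt_pos.2 hb
  have hσ0 : ∀ j, 0 < σ j := fun j => hsb.trans_le (hbσ j)
  let L : (ι → ℝ) →L[ℝ] (ι → ℝ) :=
    ContinuousLinearMap.pi fun j => (σ j)⁻¹ • ContinuousLinearMap.proj j
  have hL : ∀ w j, L w j = (σ j)⁻¹ * w j := fun w j => rfl
  have hLm : Measurable L := L.continuous.measurable
  have hmean' : ∀ j, ∫ w, w j ∂(μ.map L) = 0 := fun j => by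
    rw [integral_map hLm.aemeasurable (measurable_pi_apply j).aestronglyMeasurable]
    simp only [hL, integral_const_mul, hmean, mul_zero]
  have hvar' : ∀ j, Var[fun w => w j; μ.map L] = 1 := fun j => by
    rw [variance_map (measurable_pi_apply j).aemeasurable hLm.aemeasurable]
    have : (fun w : ι → ℝ => w j) ∘ L = fun w => (σ j)⁻¹ * w j := by ext w; simp [hL]
    rw [this, variance_const_mul, inv_pow, hσ]
    have h0 : 0 < Var[fun w => w j; μ] := hb.trans_le (hvar j)
    simp only
    rw [Real.sq_sqrt h0.le, inv_mul_cancel₀ h0.ne']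
  have hm : ∀ (z : ι → ℝ), MeasurableSet {w : ι → ℝ | ∀ j, w j ≤ z j} := fun z => measurableSet_Iic
  have := measureReal_strip_le_of_var_one hmean' hvar' hr hcard (fun j => (σ j)⁻¹ * y j)
    (div_pos ha hsb)
  have hms : MeasurableSet {w : ι → ℝ | (∀ j, w j ≤ (σ j)⁻¹ * y j + a / √b) ∧
      ¬ ∀ j, w j ≤ (σ j)⁻¹ * y j} := (hm _).inter (hm _).compl
  rw [map_measureReal_apply hLm hms] at this
  refine le_trans (measureReal_mono ?_) (this.trans_eq (by ring))
  rintro w ⟨h1, h2⟩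
  refine ⟨fun j => ?_, fun h3 => h2 fun j => ?_⟩
  · calc L w j = (σ j)⁻¹ * w j := hL w j
      _ ≤ (σ j)⁻¹ * (y j + a) := by
        have := (hσ0 j).le
        gcongr; exact h1 j
      _ = (σ j)⁻¹ * y j + a / σ j := by ring
      _ ≤ _ := by gcongr; exact hbσ j
  · have := h3 j
    rw [hL] at this
    exact le_of_mul_le_mul_left this (inv_pos.2 (hσ0 j))

end

/-! ### Interpolation with Bernoulli selectors -/

section Bernoulli

variable {α : Type*} [Fintype α] [DecidableEq α]

/-- The probability that the set of successes of independent Bernoulli(`t`) trials is `S`. -/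
def bernoulliWeight (t : ℝ) (S : Finset α) : ℝ := ∏ k, if k ∈ S then t else 1 - t

/-- The mean of `e` over the set of successes of independent Bernoulli(`t`) trials. -/
def bernoulliMean (t : ℝ) (e : Finset α → ℝ) : ℝ := ∑ S, bernoulliWeight t S * e S

lemma bernoulliWeight_nonneg {t : ℝ} (ht : t ∈ Set.Icc (0 : ℝ) 1) (S : Finset α) :
    0 ≤ bernoulliWeight t S :=
  Finset.prod_nonneg fun k _ => by split_ifs <;> linarith [ht.1, ht.2]

lemma sum_bernoulliWeight (t : ℝ) : ∑ S : Finset α, bernoulliWeight t S = 1 := by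
  have h := Finset.prod_add (fun _ : α => t) (fun _ => 1 - t) Finset.univ
  simp only [add_sub_cancel, Finset.prod_const_one, Finset.powerset_univ] at h
  rw [h]
  refine Finset.sum_congr rfl fun S _ => ?_
  rw [bernoulliWeight, Finset.prod_ite]
  congr 2
  · ext; simp
  · ext; simp

lemma bernoulliMean_mono {t : ℝ} (ht : t ∈ Set.Icc (0 : ℝ) 1) {e f : Finset α → ℝ}
    (h : ∀ S, e S ≤ f S) : bernoulliMean t e ≤ bernoulliMean t f :=
  Finset.sum_le_sum fun S _ => mul_le_mul_of_nonneg_left (h S) (bernoulliWeight_nonneg ht S)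

lemma abs_bernoulliMean_le {t : ℝ} (ht : t ∈ Set.Icc (0 : ℝ) 1) {e f : Finset α → ℝ}
    (h : ∀ S, |e S| ≤ f S) : |bernoulliMean t e| ≤ bernoulliMean t f := by
  refine (Finset.abs_sum_le_sum_abs _ _).trans (Finset.sum_le_sum fun S _ => ?_)
  rw [abs_mul, abs_of_nonneg (bernoulliWeight_nonneg ht S)]
  exact mul_le_mul_of_nonneg_left (h S) (bernoulliWeight_nonneg ht S)

lemma bernoulliMean_const (t c : ℝ) : bernoulliMean t (fun _ : Finset α => c) = c := by
  simp [bernoulliMean, ← Finset.sum_mul, sum_bernoulliWeight]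

lemma bernoulliMean_add (t : ℝ) (e f : Finset α → ℝ) :
    bernoulliMean t (fun S => e S + f S) = bernoulliMean t e + bernoulliMean t f := by
  simp [bernoulliMean, mul_add, Finset.sum_add_distrib]

lemma bernoulliMean_sub (t : ℝ) (e f : Finset α → ℝ) :
    bernoulliMean t (fun S => e S - f S) = bernoulliMean t e - bernoulliMean t f := by
  simp [bernoulliMean, mul_sub, Finset.sum_sub_distrib]

lemma bernoulliMean_const_mul (t c : ℝ) (e : Finset α → ℝ) :
    bernoulliMean t (fun S => c * e S) = c * bernoulliMean t e := by
  simp only [bernoulliMean, Finset.mul_sum]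
  exact Finset.sum_congr rfl fun S _ => by ring

lemma bernoulliMean_zero (e : Finset α → ℝ) : bernoulliMean 0 e = e ∅ := by
  rw [bernoulliMean, Finset.sum_eq_single ∅]
  · simp [bernoulliWeight]
  · intro S _ hS
    obtain ⟨k, hk⟩ := Finset.nonempty_iff_ne_empty.2 hS
    rw [bernoulliWeight, Finset.prod_eq_zero (Finset.mem_univ k) (by simp [hk]), zero_mul]
  · simp

lemma bernoulliMean_one (e : Finset α → ℝ) : bernoulliMean 1 e = e Finset.univ := by
  rw [bernoulliMean, Finset.sum_eq_single Finset.univ]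
  · simp [bernoulliWeight]
  · intro S _ hS
    obtain ⟨k, hk⟩ : ∃ k, k ∉ S := by
      by_contra h
      push Not at h
      exact hS (Finset.eq_univ_iff_forall.2 h)
    rw [bernoulliWeight, Finset.prod_eq_zero (Finset.mem_univ k) (by simp [hk]), zero_mul]
  · simp

lemma sum_finset_eq_sum_powerset_erase (i : α) (f : Finset α → ℝ) :
    ∑ S, f S = ∑ S ∈ (Finset.univ.erase i).powerset, (f S + f (insert i S)) := by
  have h := Finset.sum_powerset_insert (Finset.notMem_erase i Finset.univ) f
  rw [Finset.insert_erase (Finset.mem_univ i), Finset.powerset_univ] at h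
  rw [h, Finset.sum_add_distrib]

/-- The Margulis–Russo formula. -/
lemma hasDerivAt_bernoulliMean (e : Finset α → ℝ) (t : ℝ) :
    HasDerivAt (fun t => bernoulliMean t e)
      (bernoulliMean t fun S => ∑ i, (e (insert i S) - e (S.erase i))) t := by
  have h1 : ∀ S : Finset α, HasDerivAt (fun t => bernoulliWeight t S)
      (∑ i, (∏ k ∈ Finset.univ.erase i, if k ∈ S then t else 1 - t) *
        if i ∈ S then (1 : ℝ) else -1) t := by
    intro S
    have := HasDerivAt.fun_finsetProd (u := (Finset.univ : Finset α))
      (f := fun k (t : ℝ) => if k ∈ S then t else 1 - t)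
      (f' := fun k => if k ∈ S then (1 : ℝ) else -1) (x := t) (fun k _ => by
        by_cases hk : k ∈ S
        · simpa [hk] using hasDerivAt_id' t
        · simpa [hk] using (hasDerivAt_id' t).const_sub 1)
    simpa only [smul_eq_mul, bernoulliWeight] using this
  refine (HasDerivAt.fun_sum fun S (_ : S ∈ Finset.univ) =>
    (h1 S).mul_const (e S)).congr_deriv ?_
  simp only [bernoulliMean, Finset.sum_mul, Finset.mul_sum]
  rw [Finset.sum_comm]
  conv_rhs => rw [Finset.sum_comm]
  refine Finset.sum_congr rfl fun i _ => ?_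
  rw [sum_finset_eq_sum_powerset_erase i, sum_finset_eq_sum_powerset_erase i]
  -- For `i ∉ S`, the sets `S` and `insert i S` give the same increment, and their weights `1 - t`
  -- and `t` add up to one times the common product over the other indices.
  refine Finset.sum_congr rfl fun S hS => ?_
  have hi : i ∉ S := fun h => Finset.notMem_erase i Finset.univ (Finset.mem_powerset.1 hS h)
  have hp : ∏ k ∈ Finset.univ.erase i, (if k ∈ insert i S then t else 1 - t) =
      ∏ k ∈ Finset.univ.erase i, if k ∈ S then t else 1 - t :=
    Finset.prod_congr rfl fun k hk => by simp [Finset.ne_of_mem_erase hk]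
  rw [bernoulliWeight, bernoulliWeight, ← Finset.mul_prod_erase _ _ (Finset.mem_univ i),
    ← Finset.mul_prod_erase _ _ (Finset.mem_univ i), hp]
  simp only [hi, Finset.mem_insert, true_or, if_true, if_false, Finset.insert_idem,
    Finset.erase_insert hi, Finset.erase_eq_of_notMem hi]
  ring

/-- The mean value inequality for Russo's formula. It replaces telescoping along an ordering of the
summands: each infinitesimal change at time `t` refers to the mixed law at that same time. -/
lemma abs_bernoulliMean_sub_le {e : Finset α → ℝ} {D : ℝ}
    (h : ∀ t ∈ Set.Icc (0 : ℝ) 1,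
      |bernoulliMean t fun S => ∑ i, (e (insert i S) - e (S.erase i))| ≤ D)
    {t : ℝ} (ht : t ∈ Set.Icc (0 : ℝ) 1) : |bernoulliMean t e - e ∅| ≤ D := by
  have hD : 0 ≤ D := (abs_nonneg _).trans (h t ht)
  have := (convex_Icc (0 : ℝ) 1).norm_image_sub_le_of_norm_hasDerivWithin_le
    (fun x _ => (hasDerivAt_bernoulliMean e x).hasDerivWithinAt) h
    (Set.left_mem_Icc.2 zero_le_one) ht
  rw [bernoulliMean_zero, sub_zero] at this
  refine this.trans ?_
  rw [Real.norm_eq_abs, abs_of_nonneg ht.1]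
  exact mul_le_of_le_one_right hD ht.2

end Bernoulli

/-! ### The replacement step -/

section Replacement

variable {ι : Type*} [Fintype ι] {Ω : Type*} [MeasurableSpace Ω]

/-- The truncated third moment `E[‖T‖³ 1{2β‖T‖ > 1}]`. -/
noncomputable def tailMoment (P : Measure Ω) (β : ℝ) (T : Ω → ι → ℝ) : ℝ :=
  ∫ ω, {x : ι → ℝ | 1 < 2 * β * ‖x‖}.indicator (fun x => ‖x‖ ^ 3) (T ω) ∂P

/-- The set of points below `y + u` but not below `y - v`. -/
def orthantStrip (y : ι → ℝ) (u v : ℝ) : Set (ι → ℝ) :=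
  {z | (∀ j, z j ≤ y j + u) ∧ ¬ ∀ j, z j ≤ y j - v}

lemma measurableSet_orthant (y : ι → ℝ) : MeasurableSet {w : ι → ℝ | ∀ j, w j ≤ y j} :=
  measurableSet_Iic

lemma measurableSet_orthantStrip (y : ι → ℝ) (u v : ℝ) : MeasurableSet (orthantStrip y u v) :=
  (measurableSet_orthant fun j => y j + u).inter (measurableSet_orthant fun j => y j - v).compl

lemma measurable_tail (β : ℝ) :
    Measurable ({x : ι → ℝ | 1 < 2 * β * ‖x‖}.indicator fun x => ‖x‖ ^ 3) :=
  Measurable.indicator (by fun_prop) (measurableSet_lt measurable_const (by fun_prop))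

variable {P : Measure Ω} [IsProbabilityMeasure P]

omit [IsProbabilityMeasure P] in
lemma integrable_norm_cube {T : Ω → ι → ℝ} (h3 : MemLp T 3 P) :
    Integrable (fun ω => ‖T ω‖ ^ 3) P := by
  simpa using h3.integrable_norm_pow (p := 3) (by norm_num)

omit [IsProbabilityMeasure P] in
lemma integrable_tail {T : Ω → ι → ℝ} (h3 : MemLp T 3 P) (hT : Measurable T) (β : ℝ) :
    Integrable (fun ω => {x : ι → ℝ | 1 < 2 * β * ‖x‖}.indicator (fun x => ‖x‖ ^ 3) (T ω)) P :=
  (integrable_norm_cube h3).mono ((measurable_tail β).comp hT).aestronglyMeasurable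
    (.of_forall fun ω => by
      simp only [Real.norm_eq_abs]
      rw [abs_of_nonneg (Set.indicator_nonneg (fun _ _ => by positivity) _),
        abs_of_nonneg (by positivity)]
      exact Set.indicator_le_self' (fun _ _ => by positivity) _)

omit [IsProbabilityMeasure P] in
lemma tailMoment_nonneg (β : ℝ) (T : Ω → ι → ℝ) : 0 ≤ tailMoment P β T :=
  integral_nonneg fun _ => Set.indicator_nonneg (fun _ _ => by positivity) _

omit [IsProbabilityMeasure P] in
lemma integrable_abs_cube {T : Ω → ι → ℝ} (h3 : MemLp T 3 P) (hT : Measurable T) (j : ι) :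
    Integrable (fun ω => |T ω j| ^ 3) P :=
  (integrable_norm_cube h3).mono (by fun_prop) (.of_forall fun ω => by
    simp only [norm_pow, Real.norm_eq_abs, abs_abs, abs_norm]
    exact pow_le_pow_left₀ (abs_nonneg _) (norm_le_pi_norm (T ω) j) 3)

lemma integrable_of_abs_le {f : Ω → ℝ} (hf : Measurable f) {B : ℝ} (h : ∀ ω, |f ω| ≤ B) :
    Integrable f P :=
  Integrable.of_bound hf.aestronglyMeasurable B (.of_forall h)

variable [Nonempty ι] {K β φ B : ℝ} {y : ι → ℝ} {m : (ι → ℝ) → ℝ} {a : ι → (ι → ℝ) → ℝ}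
  {c : ι → ι → (ι → ℝ) → ℝ}

omit [Fintype ι] [Nonempty ι] [IsProbabilityMeasure P] in
lemma integral_mul_of_indepFun {Z T : Ω → ι → ℝ} (hZ : Measurable Z) (hT : Measurable T)
    (hZT : IndepFun Z T P) {f g : (ι → ℝ) → ℝ} (hf : Measurable f) (hg : Measurable g) :
    ∫ ω, f (Z ω) * g (T ω) ∂P = (∫ ω, f (Z ω) ∂P) * ∫ ω, g (T ω) ∂P :=
  hZT.integral_fun_comp_mul_comp hZ.aemeasurable hT.aemeasurable hf.aestronglyMeasurable
    hg.aestronglyMeasurable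

omit [Nonempty ι] in
/-- The second-order expansion of `E[m(Z + T)]` for `T` centered and independent of `Z`. -/
lemma IsSmoothOrthant.integral_comp_add (hm : IsSmoothOrthant K β φ y m a c B) {Z T : Ω → ι → ℝ}
    (hZ : Measurable Z) (hT : Measurable T) (hZT : IndepFun Z T P) (h3 : MemLp T 3 P)
    (hmean : ∀ j, ∫ ω, T ω j ∂P = 0) :
    Integrable (fun ω => m (Z ω + T ω) - m (Z ω) - ∑ j, a j (Z ω) * T ω j -
      ∑ j, ∑ k, c j k (Z ω) * (T ω j * T ω k)) P ∧
    ∫ ω, m (Z ω + T ω) ∂P = ∫ ω, m (Z ω) ∂P +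
      ∑ j, ∑ k, (∫ ω, c j k (Z ω) ∂P) * ∫ ω, T ω j * T ω k ∂P +
      ∫ ω, (m (Z ω + T ω) - m (Z ω) - ∑ j, a j (Z ω) * T ω j -
        ∑ j, ∑ k, c j k (Z ω) * (T ω j * T ω k)) ∂P := by
  have hmb : ∀ w, |m w| ≤ 1 := fun w => abs_le.2 ⟨by linarith [hm.nonneg w], hm.le_one w⟩
  have i1 : Integrable (fun ω => m (Z ω + T ω)) P :=
    integrable_of_abs_le (hm.measurable.comp (hZ.add hT)) fun ω => hmb _
  have i2 : Integrable (fun ω => m (Z ω)) P :=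
    integrable_of_abs_le (hm.measurable.comp hZ) fun ω => hmb _
  have hT2 : ∀ j, MemLp (fun ω => T ω j) 2 P := fun j =>
    ((h3.mono_exponent (by norm_num)).eval j)
  have i3 : ∀ j, Integrable (fun ω => a j (Z ω) * T ω j) P := fun j =>
    ((hT2 j).integrable (by norm_num)).bdd_mul ((hm.measurable_fst j).comp hZ).aestronglyMeasurable
      (.of_forall fun ω => hm.bound_fst j _)
  have i4 : ∀ j k, Integrable (fun ω => c j k (Z ω) * (T ω j * T ω k)) P := fun j k =>
    ((hT2 j).integrable_mul (hT2 k)).bdd_mul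
      ((hm.measurable_snd j k).comp hZ).aestronglyMeasurable
      (.of_forall fun ω => hm.bound_snd j k _)
  have i3' : Integrable (fun ω => ∑ j, a j (Z ω) * T ω j) P :=
    integrable_finsetSum _ fun j _ => i3 j
  have i4' : Integrable (fun ω => ∑ j, ∑ k, c j k (Z ω) * (T ω j * T ω k)) P :=
    integrable_finsetSum _ fun j _ => integrable_finsetSum _ fun k _ => i4 j k
  have i12 : Integrable (fun ω => m (Z ω + T ω) - m (Z ω)) P := i1.sub i2
  have i123 : Integrable (fun ω => m (Z ω + T ω) - m (Z ω) - ∑ j, a j (Z ω) * T ω j) P :=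
    i12.sub i3'
  refine ⟨i123.sub i4', ?_⟩
  rw [integral_sub i123 i4', integral_sub i12 i3', integral_sub i1 i2,
    integral_finsetSum _ fun j _ => i3 j,
    integral_finsetSum _ fun j _ => integrable_finsetSum _ fun k _ => i4 j k]
  have e3 : ∑ j, ∫ ω, a j (Z ω) * T ω j ∂P = 0 := Finset.sum_eq_zero fun j _ => by
    rw [integral_mul_of_indepFun hZ hT hZT (hm.measurable_fst j) (measurable_pi_apply j), hmean,
      mul_zero]
  have e4 : ∑ j, ∫ ω, ∑ k, c j k (Z ω) * (T ω j * T ω k) ∂P =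
      ∑ j, ∑ k, (∫ ω, c j k (Z ω) ∂P) * ∫ ω, T ω j * T ω k ∂P :=
    Finset.sum_congr rfl fun j _ => by
      rw [integral_finsetSum _ fun k _ => i4 j k]
      exact Finset.sum_congr rfl fun k _ =>
        integral_mul_of_indepFun hZ hT hZT (hm.measurable_snd j k)
          (g := fun x => x j * x k) (by fun_prop)
  rw [e3, e4]
  ring

lemma measurable_strip_gibbs (β : ℝ) (y : ι → ℝ) (u v : ℝ) (j : ι) :
    Measurable ((orthantStrip y u v).indicator fun z => gibbs β (z - y) j) :=
  Measurable.indicator ((continuous_gibbs β j).measurable.comp (by fun_prop))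
    (measurableSet_orthantStrip y u v)

omit [Nonempty ι] in
lemma strip_gibbs_nonneg (β : ℝ) (y : ι → ℝ) (u v : ℝ) (j : ι) (z : ι → ℝ) :
    0 ≤ (orthantStrip y u v).indicator (fun z => gibbs β (z - y) j) z :=
  Set.indicator_nonneg (fun _ _ => gibbs_nonneg _ _ _) _

lemma strip_gibbs_le_one (β : ℝ) (y : ι → ℝ) (u v : ℝ) (j : ι) (z : ι → ℝ) :
    (orthantStrip y u v).indicator (fun z => gibbs β (z - y) j) z ≤ 1 :=
  Set.indicator_apply_le' (fun _ => gibbs_le_one _ _ _) fun _ => zero_le_one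

lemma integrable_strip_gibbs {Z : Ω → ι → ℝ} (hZ : Measurable Z) (β : ℝ) (y : ι → ℝ) (u v : ℝ)
    (j : ι) :
    Integrable (fun ω => (orthantStrip y u v).indicator (fun z => gibbs β (z - y) j) (Z ω)) P :=
  integrable_of_abs_le ((measurable_strip_gibbs β y u v j).comp hZ) (B := 1) fun ω => by
    rw [abs_of_nonneg (strip_gibbs_nonneg _ _ _ _ _ _)]
    exact strip_gibbs_le_one _ _ _ _ _ _

/-- Because the Gibbs weights sum to one, all coordinates together cost a single strip probability,
with no factor for the dimension. -/
lemma sum_integral_strip_gibbs {Z : Ω → ι → ℝ} (hZ : Measurable Z) (β : ℝ) (y : ι → ℝ) (u v : ℝ) :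
    ∑ j, ∫ ω, (orthantStrip y u v).indicator (fun z => gibbs β (z - y) j) (Z ω) ∂P =
      P.real (Z ⁻¹' orthantStrip y u v) := by
  rw [← integral_finsetSum _ fun j _ => integrable_strip_gibbs hZ β y u v j,
    ← integral_indicator_one (hZ (measurableSet_orthantStrip y u v))]
  refine integral_congr_ae (.of_forall fun ω => ?_)
  by_cases h : Z ω ∈ orthantStrip y u v
  · simp [Set.indicator, h, sum_gibbs]
  · simp [Set.indicator, h]

omit [IsProbabilityMeasure P] in
/-- The bound on the remainder of the second-order expansion. -/
lemma IsSmoothOrthant.abs_integral_remainder_le (hm : IsSmoothOrthant K β φ y m a c B)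
    {Z T : Ω → ι → ℝ}
    (hZ : Measurable Z) (hT : Measurable T) (hZT : IndepFun Z T P) (h3 : MemLp T 3 P) :
    |∫ ω, (m (Z ω + T ω) - m (Z ω) - ∑ j, a j (Z ω) * T ω j -
        ∑ j, ∑ k, c j k (Z ω) * (T ω j * T ω k)) ∂P| ≤
      K * φ * β ^ 2 * (∑ j, (∫ ω, (orthantStrip y (3 / φ) (2 / φ)).indicator
          (fun z => gibbs β (z - y) j) (Z ω) ∂P) *
        (∫ ω, {x : ι → ℝ | 2 * β * ‖x‖ ≤ 1}.indicator (fun x => |x j| ^ 3) (T ω) ∂P) +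
        tailMoment P β T) := by
  set s : ι → (ι → ℝ) → ℝ := fun j => (orthantStrip y (3 / φ) (2 / φ)).indicator
    (fun z => gibbs β (z - y) j) with hs
  set t : ι → (ι → ℝ) → ℝ := fun j => {x : ι → ℝ | 2 * β * ‖x‖ ≤ 1}.indicator
    (fun x => |x j| ^ 3) with ht
  have hsm : ∀ j, Measurable (s j) := measurable_strip_gibbs β y _ _
  have htm : ∀ j, Measurable (t j) := fun j =>
    Measurable.indicator (by fun_prop) (measurableSet_le (by fun_prop) measurable_const)
  have hti : ∀ j, Integrable (fun ω => t j (T ω)) P := fun j =>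
    (integrable_abs_cube h3 hT j).mono ((htm j).comp hT).aestronglyMeasurable
      (.of_forall fun ω => by
        simp only [Real.norm_eq_abs, ht]
        rw [abs_of_nonneg (Set.indicator_nonneg (fun _ _ => by positivity) _),
          abs_of_nonneg (by positivity)]
        exact Set.indicator_le_self' (fun _ _ => by positivity) _)
  have hst : ∀ j, Integrable (fun ω => s j (Z ω) * t j (T ω)) P := fun j =>
    (hti j).bdd_mul (c := 1) ((hsm j).comp hZ).aestronglyMeasurable (.of_forall fun ω => by
      rw [Real.norm_eq_abs, abs_of_nonneg (strip_gibbs_nonneg _ _ _ _ _ _)]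
      exact strip_gibbs_le_one _ _ _ _ _ _)
  have hsum : Integrable (fun ω => ∑ j, s j (Z ω) * t j (T ω)) P :=
    integrable_finsetSum _ fun j _ => hst j
  have htail := integrable_tail h3 hT β
  have hbound : ∀ ω, |m (Z ω + T ω) - m (Z ω) - ∑ j, a j (Z ω) * T ω j -
      ∑ j, ∑ k, c j k (Z ω) * (T ω j * T ω k)| ≤ K * φ * β ^ 2 * (∑ j, s j (Z ω) * t j (T ω) +
        {x : ι → ℝ | 1 < 2 * β * ‖x‖}.indicator (fun x => ‖x‖ ^ 3) (T ω)) := by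
    intro ω
    by_cases h : 2 * β * ‖T ω‖ ≤ 1
    · refine (hm.remainder_small (Z ω) (T ω) h).trans_eq ?_
      have h' : ¬ 1 < 2 * β * ‖T ω‖ := not_lt.2 h
      simp only [ht, hs, Set.indicator, Set.mem_ofPred_eq, h, h', if_true, if_false, add_zero,
        orthantStrip, ite_mul, zero_mul]
      congr 1
      split_ifs <;> simp
    · refine (hm.remainder_le (Z ω) (T ω)).trans_eq ?_
      have h' : 1 < 2 * β * ‖T ω‖ := not_le.1 h
      simp [ht, Set.indicator, h, h']
  calc _ ≤ ∫ ω, K * φ * β ^ 2 * (∑ j, s j (Z ω) * t j (T ω) +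
        {x : ι → ℝ | 1 < 2 * β * ‖x‖}.indicator (fun x => ‖x‖ ^ 3) (T ω)) ∂P :=
        norm_integral_le_of_norm_le (f := fun ω => m (Z ω + T ω) - m (Z ω) -
          ∑ j, a j (Z ω) * T ω j - ∑ j, ∑ k, c j k (Z ω) * (T ω j * T ω k))
          ((hsum.add htail).const_mul _) (.of_forall hbound)
    _ = _ := by
        rw [integral_const_mul, integral_add hsum htail, integral_finsetSum _ fun j _ => hst j]
        congr 2
        exact Finset.sum_congr rfl fun j _ => integral_mul_of_indepFun hZ hT hZT (hsm j) (htm j)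

/-- Reinserting an independent summand `V` into the Gibbs weights. -/
lemma sum_strip_gibbs_mul_le (hφ : 0 < φ) (hφβ : φ ≤ β) {Z T V : Ω → ι → ℝ}
    (hZ : Measurable Z) (hT : Measurable T) (hV : Measurable V) (hZV : IndepFun Z V P)
    (hT3 : MemLp T 3 P) (hV3 : MemLp V 3 P) :
    ∑ j, (∫ ω, (orthantStrip y (3 / φ) (2 / φ)).indicator
          (fun z => gibbs β (z - y) j) (Z ω) ∂P) *
        (∫ ω, {x : ι → ℝ | 2 * β * ‖x‖ ≤ 1}.indicator (fun x => |x j| ^ 3) (T ω) ∂P) ≤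
      2 * Real.exp 1 * ∑ j, (∫ ω, (orthantStrip y (4 / φ) (3 / φ)).indicator
          (fun z => gibbs β (z - y) j) (Z ω + V ω) ∂P) * (∫ ω, |T ω j| ^ 3 ∂P) +
        2 * tailMoment P β V := by
  have hβ : 0 < β := hφ.trans_le hφβ
  set s : ι → (ι → ℝ) → ℝ := fun j => (orthantStrip y (3 / φ) (2 / φ)).indicator
    (fun z => gibbs β (z - y) j) with hs
  set s' : ι → (ι → ℝ) → ℝ := fun j => (orthantStrip y (4 / φ) (3 / φ)).indicator
    (fun z => gibbs β (z - y) j) with hs'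
  set t : ι → (ι → ℝ) → ℝ := fun j => {x : ι → ℝ | 2 * β * ‖x‖ ≤ 1}.indicator
    (fun x => |x j| ^ 3) with ht
  have hsm : ∀ j, Measurable (s j) := measurable_strip_gibbs β y _ _
  have hsm' : ∀ j, Measurable (s' j) := measurable_strip_gibbs β y _ _
  have htm : ∀ j, Measurable (t j) := fun j =>
    Measurable.indicator (by fun_prop) (measurableSet_le (by fun_prop) measurable_const)
  have hs0 : ∀ j z, 0 ≤ s j z := strip_gibbs_nonneg β y _ _
  have hs0' : ∀ j z, 0 ≤ s' j z := strip_gibbs_nonneg β y _ _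
  have ht0 : ∀ j x, 0 ≤ t j x := fun j x => Set.indicator_nonneg (fun _ _ => by positivity) _
  have htle : ∀ j x, t j x ≤ |x j| ^ 3 := fun j x =>
    Set.indicator_le_self' (fun _ _ => by positivity) _
  set d : ℝ := 1 / (2 * β) with hd
  have hd0 : 0 < d := by positivity
  have hsmall : ∀ x : ι → ℝ, 2 * β * ‖x‖ ≤ 1 ↔ ‖x‖ ≤ d := fun x => by
    rw [hd, le_div_iff₀ (by positivity), mul_comm]
  have htd : ∀ j x, t j x ≤ d ^ 3 := fun j x => by
    refine Set.indicator_apply_le' (fun h => ?_) fun _ => by positivity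
    exact pow_le_pow_left₀ (abs_nonneg _)
      ((norm_le_pi_norm x j).trans ((hsmall x).1 h)) 3
  have hti : ∀ j, Integrable (fun ω => t j (T ω)) P := fun j =>
    integrable_of_abs_le ((htm j).comp hT) (B := d ^ 3) fun ω => by
      rw [abs_of_nonneg (ht0 _ _)]; exact htd _ _
  have hsi : ∀ j, Integrable (fun ω => s j (Z ω)) P := fun j =>
    integrable_strip_gibbs hZ β y _ _ j
  have hsi' : ∀ j, Integrable (fun ω => s' j (Z ω + V ω)) P := fun j =>
    integrable_strip_gibbs (Z := fun ω => Z ω + V ω) (hZ.add hV) β y _ _ j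
  have hq0 : ∀ j, 0 ≤ ∫ ω, s j (Z ω) ∂P := fun j => integral_nonneg fun ω => hs0 _ _
  have htT0 : ∀ j, 0 ≤ ∫ ω, |T ω j| ^ 3 ∂P := fun j => integral_nonneg fun ω => by positivity
  set G : Set (ι → ℝ) := {x | 2 * β * ‖x‖ ≤ 1} with hG
  have hGm : MeasurableSet G := measurableSet_le (by fun_prop) measurable_const
  -- If `V` is small with probability at least `1/2`, restricting to that event costs a factor `2`
  -- and changing the Gibbs weights a factor `e`. Otherwise the tail moment of `V` is at least
  -- `d³/2`, which dominates the left side, itself at most `d³`.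
  rcases le_or_gt (1 / 2) (P.real (V ⁻¹' G)) with hbig | hbig
  · refine le_trans ?_ (le_add_of_nonneg_right
      (mul_nonneg zero_le_two (tailMoment_nonneg β V)))
    rw [Finset.mul_sum]
    refine Finset.sum_le_sum fun j _ => ?_
    rw [← mul_assoc]
    refine mul_le_mul ?_ (integral_mono (hti j) (integrable_abs_cube hT3 hT j)
      fun ω => htle j _) (integral_nonneg fun ω => ht0 _ _)
      (mul_nonneg (by positivity) (integral_nonneg fun ω => hs0' _ _))
    have hprod : (∫ ω, s j (Z ω) ∂P) * P.real (V ⁻¹' G) ≤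
        Real.exp 1 * ∫ ω, s' j (Z ω + V ω) ∂P := by
      rw [← integral_indicator_one (hV hGm), ← integral_const_mul (Real.exp 1)]
      change (∫ ω, s j (Z ω) ∂P) * (∫ ω, G.indicator 1 (V ω) ∂P) ≤ _
      rw [← integral_mul_of_indepFun hZ hV hZV (hsm j) (measurable_one.indicator hGm)]
      refine integral_mono_of_nonneg (.of_forall fun ω =>
        mul_nonneg (hs0 _ _) (Set.indicator_nonneg (fun _ _ => zero_le_one) _))
        ((hsi' j).const_mul _) (.of_forall fun ω => ?_)
      simp only
      by_cases hVG : V ω ∈ G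
      · rw [Set.indicator_of_mem hVG, Pi.one_apply, mul_one]
        by_cases hZs : Z ω ∈ orthantStrip y (3 / φ) (2 / φ)
        · have hVφ : ∀ k, |V ω k| ≤ 1 / φ := fun k => by
            refine (norm_le_pi_norm (V ω) k).trans (((hsmall _).1 hVG).trans ?_)
            rw [hd]; gcongr; linarith
          -- A small `V` has coordinates at most `d = 1/(2β) ≤ 1/φ`, so the strip widens by `1/φ` on
          -- each side.
          have hmem : Z ω + V ω ∈ orthantStrip y (4 / φ) (3 / φ) := by
            refine ⟨fun k => ?_, fun h => hZs.2 fun k => ?_⟩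
            · have h1 := hZs.1 k
              have h2 := (abs_le.1 (hVφ k)).2
              have : 4 / φ = 3 / φ + 1 / φ := by ring
              simp only [Pi.add_apply]; linarith
            · have h1 := h k
              have h2 := (abs_le.1 (hVφ k)).1
              have : 3 / φ = 2 / φ + 1 / φ := by ring
              simp only [Pi.add_apply] at h1; linarith
          simp only [hs, hs', Set.indicator_of_mem hZs, Set.indicator_of_mem hmem]
          have h1 := gibbs_add_le hβ.le (Z ω + V ω - y) (-V ω) (by rw [norm_neg]; exact hVG) j
          rwa [show Z ω + V ω - y + -V ω = Z ω - y by abel] at h1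
        · simp only [hs, Set.indicator_of_notMem hZs]
          exact mul_nonneg (Real.exp_pos _).le (hs0' _ _)
      · rw [Set.indicator_of_notMem hVG, mul_zero]
        exact mul_nonneg (Real.exp_pos _).le (hs0' _ _)
    have := mul_le_mul_of_nonneg_left hbig (hq0 j)
    linarith
  · have hle : ∑ j, (∫ ω, s j (Z ω) ∂P) * (∫ ω, t j (T ω) ∂P) ≤ d ^ 3 := by
      calc _ ≤ ∑ j, (∫ ω, s j (Z ω) ∂P) * d ^ 3 := by
            refine Finset.sum_le_sum fun j _ => mul_le_mul_of_nonneg_left ?_ (hq0 j)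
            calc ∫ ω, t j (T ω) ∂P ≤ ∫ _, d ^ 3 ∂P :=
                  integral_mono (hti j) (integrable_const _) fun ω => htd _ _
              _ = _ := by simp
        _ = P.real (Z ⁻¹' orthantStrip y (3 / φ) (2 / φ)) * d ^ 3 := by
            rw [← Finset.sum_mul, sum_integral_strip_gibbs hZ]
        _ ≤ _ := mul_le_of_le_one_left (by positivity) measureReal_le_one
    have hcompl : 1 / 2 ≤ P.real (V ⁻¹' Gᶜ) := by
      rw [Set.preimage_compl, measureReal_compl (hV hGm)]
      simp; linarith
    have htail : d ^ 3 * P.real (V ⁻¹' Gᶜ) ≤ tailMoment P β V := by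
      rw [← integral_indicator_one (hV hGm.compl), ← integral_const_mul]
      refine integral_mono_of_nonneg (.of_forall fun ω => mul_nonneg (by positivity)
        (Set.indicator_nonneg (fun _ _ => zero_le_one) _)) (integrable_tail hV3 hV β)
        (.of_forall fun ω => ?_)
      simp only
      by_cases hVG : V ω ∈ G
      · have h1 : ω ∉ V ⁻¹' Gᶜ := fun h => h hVG
        rw [Set.indicator_of_notMem h1, mul_zero]
        exact Set.indicator_nonneg (fun _ _ => by positivity) _
      · have h1 : ω ∈ V ⁻¹' Gᶜ := hVG
        have h2 : V ω ∈ {x : ι → ℝ | 1 < 2 * β * ‖x‖} := by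
          by_contra h
          exact hVG (show 2 * β * ‖V ω‖ ≤ 1 from le_of_not_gt h)
        rw [Set.indicator_of_mem h1, Set.indicator_of_mem h2, Pi.one_apply, mul_one]
        have h3 : d ≤ ‖V ω‖ := (not_le.1 fun h => hVG ((hsmall _).2 h)).le
        gcongr
    have h0 : 0 ≤ 2 * Real.exp 1 * ∑ j, (∫ ω, s' j (Z ω + V ω) ∂P) * (∫ ω, |T ω j| ^ 3 ∂P) :=
      mul_nonneg (by positivity) (Finset.sum_nonneg fun j _ =>
        mul_nonneg (integral_nonneg fun ω => hs0' _ _) (htT0 j))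
    have : d ^ 3 * (1 / 2) ≤ d ^ 3 * P.real (V ⁻¹' Gᶜ) := by gcongr
    linarith

end Replacement

/-! ### The comparison of independent sums over orthants -/

section Comparison

variable {ι : Type*} [Fintype ι] {Ω : Type*} [MeasurableSpace Ω] {α : Type*} [Fintype α]
  [DecidableEq α]

/-- The sum in which the summands with index in `S` are taken from `X`, the others from `Y`. -/
def mixedSum (X Y : α → Ω → ι → ℝ) (S : Finset α) (ω : Ω) : ι → ℝ :=
  ∑ k, if k ∈ S then X k ω else Y k ω

/-- The mixed sum without its `i`-th summand. -/
def mixedSumErase (X Y : α → Ω → ι → ℝ) (S : Finset α) (i : α) (ω : Ω) : ι → ℝ :=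
  ∑ k ∈ Finset.univ.erase i, if k ∈ S then X k ω else Y k ω

omit [Fintype ι] [MeasurableSpace Ω] in
lemma mixedSum_eq_add (X Y : α → Ω → ι → ℝ) (S : Finset α) (i : α) (ω : Ω) :
    mixedSum X Y S ω = mixedSumErase X Y S i ω + if i ∈ S then X i ω else Y i ω :=
  (Finset.sum_erase_add _ _ (Finset.mem_univ i)).symm

omit [Fintype ι] [MeasurableSpace Ω] in
lemma mixedSum_insert (X Y : α → Ω → ι → ℝ) (S : Finset α) (i : α) (ω : Ω) :
    mixedSum X Y (insert i S) ω = mixedSumErase X Y S i ω + X i ω := by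
  rw [mixedSum_eq_add X Y _ i, if_pos (Finset.mem_insert_self i S)]
  congr 1
  exact Finset.sum_congr rfl fun k hk => by simp [Finset.ne_of_mem_erase hk]

omit [Fintype ι] [MeasurableSpace Ω] in
lemma mixedSum_erase (X Y : α → Ω → ι → ℝ) (S : Finset α) (i : α) (ω : Ω) :
    mixedSum X Y (S.erase i) ω = mixedSumErase X Y S i ω + Y i ω := by
  rw [mixedSum_eq_add X Y _ i, if_neg (Finset.notMem_erase i S)]
  congr 1
  exact Finset.sum_congr rfl fun k hk => by simp [Finset.ne_of_mem_erase hk]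

omit [Fintype ι] in
lemma measurable_mixedSum {X Y : α → Ω → ι → ℝ} (hX : ∀ i, Measurable (X i))
    (hY : ∀ i, Measurable (Y i)) (S : Finset α) : Measurable (mixedSum X Y S) :=
  Finset.measurable_sum _ fun k _ => by split_ifs <;> [exact hX k; exact hY k]

omit [Fintype ι] in
lemma measurable_mixedSumErase {X Y : α → Ω → ι → ℝ} (hX : ∀ i, Measurable (X i))
    (hY : ∀ i, Measurable (Y i)) (S : Finset α) (i : α) : Measurable (mixedSumErase X Y S i) :=
  Finset.measurable_sum _ fun k _ => by split_ifs <;> [exact hX k; exact hY k]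

variable {P : Measure Ω}

omit [Fintype ι] in
lemma indepFun_mixedSumErase {X Y : α → Ω → ι → ℝ} (hX : ∀ i, Measurable (X i))
    (hY : ∀ i, Measurable (Y i)) (hind : iIndepFun (Sum.elim X Y) P) (S : Finset α) (i : α) :
    IndepFun (mixedSumErase X Y S i) (X i) P ∧ IndepFun (mixedSumErase X Y S i) (Y i) P := by
  have key : ∀ v : α ⊕ α, (v = .inl i ∨ v = .inr i) →
      IndepFun (mixedSumErase X Y S i) (Sum.elim X Y v) P := by
    intro v hv
    -- One variable is selected per index: the one present in the mixed sum for `k ≠ i`, and `v`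
    -- itself at `i`. The selection is injective, so the selected family is again independent.
    let g : α → α ⊕ α := fun k => if k = i then v else if k ∈ S then .inl k else .inr k
    have hg : Function.Injective g := by
      have hleft : ∀ k, Sum.elim id id (g k) = k := fun k => by
        simp only [g]
        split_ifs with h1 h2
        · rcases hv with rfl | rfl <;> simp [h1]
        · rfl
        · rfl
      exact Function.LeftInverse.injective hleft
    have h := (hind.precomp hg).indepFun_finsetSum_of_notMem
      (fun k => by rcases g k with k' | k' <;> [exact hX k'; exact hY k'])
      (Finset.notMem_erase i Finset.univ)
    have e1 : ∑ k ∈ Finset.univ.erase i, Sum.elim X Y (g k) = mixedSumErase X Y S i := by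
      ext ω : 1
      rw [Finset.sum_apply, mixedSumErase]
      refine Finset.sum_congr rfl fun k hk => ?_
      simp only [g, Finset.ne_of_mem_erase hk, if_false]
      split_ifs <;> rfl
    have e2 : g i = v := by simp [g]
    simp only [e1, e2] at h
    exact h
  exact ⟨key _ (.inl rfl), key _ (.inr rfl)⟩

variable [IsProbabilityMeasure P] [Nonempty ι] {K β φ B : ℝ} {y : ι → ℝ} {m : (ι → ℝ) → ℝ}
  {a : ι → (ι → ℝ) → ℝ} {c : ι → ι → (ι → ℝ) → ℝ}

/-- The effect of replacing one summand. -/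
lemma IsSmoothOrthant.abs_replace_le (hm : IsSmoothOrthant K β φ y m a c B) (hK : 0 ≤ K)
    (hφ : 0 < φ) (hφβ : φ ≤ β) {X Y : α → Ω → ι → ℝ}
    (hX : ∀ i, Measurable (X i)) (hY : ∀ i, Measurable (Y i)) (hind : iIndepFun (Sum.elim X Y) P)
    (hX3 : ∀ i, MemLp (X i) 3 P) (hY3 : ∀ i, MemLp (Y i) 3 P)
    (hX1 : ∀ i j, ∫ ω, X i ω j ∂P = 0) (hY1 : ∀ i j, ∫ ω, Y i ω j ∂P = 0)
    (h2 : ∀ i j k, ∫ ω, X i ω j * X i ω k ∂P = ∫ ω, Y i ω j * Y i ω k ∂P)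
    (S : Finset α) (i : α) :
    |∫ ω, m (mixedSum X Y (insert i S) ω) ∂P - ∫ ω, m (mixedSum X Y (S.erase i) ω) ∂P| ≤
      K * φ * β ^ 2 * (2 * Real.exp 1 * ∑ j, (∫ ω, (orthantStrip y (4 / φ) (3 / φ)).indicator
          (fun z => gibbs β (z - y) j) (mixedSum X Y S ω) ∂P) *
            (∫ ω, |X i ω j| ^ 3 ∂P + ∫ ω, |Y i ω j| ^ 3 ∂P) +
        5 * (tailMoment P β (X i) + tailMoment P β (Y i))) := by
  set Z := mixedSumErase X Y S i
  obtain ⟨iX, iY⟩ := indepFun_mixedSumErase hX hY hind S i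
  have hZ : Measurable Z := measurable_mixedSumErase hX hY S i
  obtain ⟨-, eX⟩ := hm.integral_comp_add hZ (hX i) iX (hX3 i) (hX1 i)
  obtain ⟨-, eY⟩ := hm.integral_comp_add hZ (hY i) iY (hY3 i) (hY1 i)
  have rX := hm.abs_integral_remainder_le hZ (hX i) iX (hX3 i)
  have rY := hm.abs_integral_remainder_le hZ (hY i) iY (hY3 i)
  have hins : ∫ ω, m (mixedSum X Y (insert i S) ω) ∂P = ∫ ω, m (Z ω + X i ω) ∂P := by
    simp only [mixedSum_insert, Z]
  have hers : ∫ ω, m (mixedSum X Y (S.erase i) ω) ∂P = ∫ ω, m (Z ω + Y i ω) ∂P := by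
    simp only [mixedSum_erase, Z]
  have tX0 := tailMoment_nonneg (P := P) β (X i)
  have tY0 := tailMoment_nonneg (P := P) β (Y i)
  -- `V` is the summand that the mixed sum over `S` really contains at `i`. Reinserting it yields
  -- Gibbs weights that do not depend on `i`, so that third moments can be summed over `i`.
  obtain ⟨V, hVm, hV3, hVind, hVtail, hVsum⟩ : ∃ V : Ω → ι → ℝ, Measurable V ∧ MemLp V 3 P ∧
      IndepFun Z V P ∧ tailMoment P β V ≤ tailMoment P β (X i) + tailMoment P β (Y i) ∧
      ∀ ω, mixedSum X Y S ω = Z ω + V ω := by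
    by_cases hi : i ∈ S
    · exact ⟨X i, hX i, hX3 i, iX, by linarith, fun ω => by
        rw [mixedSum_eq_add X Y S i, if_pos hi]⟩
    · exact ⟨Y i, hY i, hY3 i, iY, by linarith, fun ω => by
        rw [mixedSum_eq_add X Y S i, if_neg hi]⟩
  have sX := sum_strip_gibbs_mul_le (y := y) hφ hφβ hZ (hX i) hVm hVind (hX3 i) hV3
  have sY := sum_strip_gibbs_mul_le (y := y) hφ hφβ hZ (hY i) hVm hVind (hY3 i) hV3
  simp only [← hVsum] at sX sY
  have h0 : 0 ≤ K * φ * β ^ 2 := by positivity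
  rw [hins, hers, eX, eY]
  simp only [h2 i]
  rw [add_sub_add_left_eq_sub]
  -- The factor `5` in front of the tails: one from the remainders themselves, and four from the two
  -- copies of `2 * tailMoment P β V`.
  refine (abs_sub _ _).trans ((add_le_add rX rY).trans ?_)
  rw [← mul_add]
  refine mul_le_mul_of_nonneg_left ?_ h0
  simp only [mul_add, Finset.sum_add_distrib] at sX sY ⊢
  linarith

/-- The effect of replacing each summand in turn, starting from a given mixed sum. -/
lemma IsSmoothOrthant.abs_sum_replace_le (hm : IsSmoothOrthant K β φ y m a c B) (hK : 0 ≤ K)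
    (hφ : 0 < φ) (hφβ : φ ≤ β) {X Y : α → Ω → ι → ℝ}
    (hX : ∀ i, Measurable (X i)) (hY : ∀ i, Measurable (Y i)) (hind : iIndepFun (Sum.elim X Y) P)
    (hX3 : ∀ i, MemLp (X i) 3 P) (hY3 : ∀ i, MemLp (Y i) 3 P)
    (hX1 : ∀ i j, ∫ ω, X i ω j ∂P = 0) (hY1 : ∀ i j, ∫ ω, Y i ω j ∂P = 0)
    (h2 : ∀ i j k, ∫ ω, X i ω j * X i ω k ∂P = ∫ ω, Y i ω j * Y i ω k ∂P) {Λ : ℝ}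
    (hΛ : ∀ j, ∑ i, (∫ ω, |X i ω j| ^ 3 ∂P + ∫ ω, |Y i ω j| ^ 3 ∂P) ≤ Λ) (S : Finset α) :
    |∑ i, (∫ ω, m (mixedSum X Y (insert i S) ω) ∂P -
        ∫ ω, m (mixedSum X Y (S.erase i) ω) ∂P)| ≤
      K * φ * β ^ 2 * (2 * Real.exp 1 * Λ *
          P.real (mixedSum X Y S ⁻¹' orthantStrip y (4 / φ) (3 / φ)) +
        5 * ∑ i, (tailMoment P β (X i) + tailMoment P β (Y i))) := by
  refine (Finset.abs_sum_le_sum_abs _ _).trans ((Finset.sum_le_sum fun i _ =>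
    hm.abs_replace_le hK hφ hφβ hX hY hind hX3 hY3 hX1 hY1 h2 S i).trans ?_)
  -- With the sum over `i` innermost, the third moments of each coordinate add up to at most `Λ`
  -- before the Gibbs weights are summed over `j`.
  rw [← Finset.mul_sum, Finset.sum_add_distrib, ← Finset.mul_sum, ← Finset.mul_sum,
    Finset.sum_comm]
  have h0 : 0 ≤ K * φ * β ^ 2 := by positivity
  refine mul_le_mul_of_nonneg_left (add_le_add ?_ le_rfl) h0
  rw [mul_assoc _ Λ]
  refine mul_le_mul_of_nonneg_left ?_ (by positivity)
  simp only [← Finset.mul_sum]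
  rw [← sum_integral_strip_gibbs (measurable_mixedSum hX hY S) β y, Finset.mul_sum]
  refine Finset.sum_le_sum fun j _ => ?_
  rw [mul_comm]
  exact mul_le_mul_of_nonneg_right (hΛ j) (integral_nonneg fun ω => strip_gibbs_nonneg _ _ _ _ _ _)

/-- Comparison of the distribution functions of two independent sums with matching covariances,
given anti-concentration of the second one. -/
theorem exists_abs_orthant_sub_le : ∃ K : ℝ, 0 < K ∧ ∀ {ι : Type*} [Fintype ι] [Nonempty ι]
    {Ω : Type*} [MeasurableSpace Ω] {P : Measure Ω} [IsProbabilityMeasure P] {α : Type*} [Fintype α]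
    [DecidableEq α] {X Y : α → Ω → ι → ℝ} {β φ Λ κ : ℝ}, 0 < φ → φ ≤ β →
    φ * Real.log (Fintype.card ι) ≤ β →
    (∀ i, Measurable (X i)) → (∀ i, Measurable (Y i)) → iIndepFun (Sum.elim X Y) P →
    (∀ i, MemLp (X i) 3 P) → (∀ i, MemLp (Y i) 3 P) →
    (∀ i j, ∫ ω, X i ω j ∂P = 0) → (∀ i j, ∫ ω, Y i ω j ∂P = 0) →
    (∀ i j k, ∫ ω, X i ω j * X i ω k ∂P = ∫ ω, Y i ω j * Y i ω k ∂P) →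
    (∀ j, ∑ i, (∫ ω, |X i ω j| ^ 3 ∂P + ∫ ω, |Y i ω j| ^ 3 ∂P) ≤ Λ) →
    (∀ (y : ι → ℝ) (u : ℝ), 0 < u →
      P.real {ω | (∀ j, (∑ i, Y i ω) j ≤ y j + u) ∧ ¬ ∀ j, (∑ i, Y i ω) j ≤ y j} ≤ κ * u) →
    K * φ * β ^ 2 * Λ ≤ 1 → ∀ y : ι → ℝ,
    |P.real {ω | ∀ j, (∑ i, X i ω) j ≤ y j} - P.real {ω | ∀ j, (∑ i, Y i ω) j ≤ y j}| ≤
      8 * κ / φ + K * φ * β ^ 2 * ∑ i, (tailMoment P β (X i) + tailMoment P β (Y i)) := by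
  obtain ⟨K₀, hK₀, hsmooth⟩ := exists_isSmoothOrthant
  -- As `8e = 4 · 2e`, the smallness hypothesis makes the coefficient of `7κ/φ + 2ρ` at most `1/4`;
  -- and `8e ≥ 10` covers the tail coefficient left after absorption.
  refine ⟨K₀ * (8 * Real.exp 1), by positivity, ?_⟩
  intro ι _ _ Ω _ P _ α _ _ X Y β φ Λ κ hφ hφβ hcard hX hY hind hX3 hY3 hX1 hY1 h2 hΛ hκ hsmall
  set M : ℝ := ∑ i, (tailMoment P β (X i) + tailMoment P β (Y i)) with hM
  have hM0 : 0 ≤ M := Finset.sum_nonneg fun i _ =>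
    add_nonneg (tailMoment_nonneg _ _) (tailMoment_nonneg _ _)
  have hβ : 0 < β := hφ.trans_le hφβ
  let e : (ι → ℝ) → Finset α → ℝ := fun y S => P.real {ω | ∀ j, mixedSum X Y S ω j ≤ y j}
  let Q : ℝ → (ι → ℝ) → ℝ := fun t y => bernoulliMean t (e y)
  have hms : ∀ S, Measurable (mixedSum X Y S) := measurable_mixedSum hX hY
  have hempty : ∀ ω, mixedSum X Y ∅ ω = ∑ i, Y i ω := fun ω => by simp [mixedSum]
  have huniv : ∀ ω, mixedSum X Y Finset.univ ω = ∑ i, X i ω := fun ω => by simp [mixedSum]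
  have hQ0 : ∀ y, Q 0 y = P.real {ω | ∀ j, (∑ i, Y i ω) j ≤ y j} := fun y => by
    simp only [Q, bernoulliMean_zero, e, hempty]
  have hQ1 : ∀ y, Q 1 y = P.real {ω | ∀ j, (∑ i, X i ω) j ≤ y j} := fun y => by
    simp only [Q, bernoulliMean_one, e, huniv]
  have hem : ∀ (S : Finset α) (y : ι → ℝ), MeasurableSet {ω | ∀ j, mixedSum X Y S ω j ≤ y j} :=
    fun S y => hms S (measurableSet_orthant y)
  have hstrip : ∀ (S : Finset α) (y : ι → ℝ) (u v : ℝ), 0 ≤ u + v →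
      P.real (mixedSum X Y S ⁻¹' orthantStrip y u v) =
        e (fun j => y j + u) S - e (fun j => y j - v) S := fun S y u v huv => by
    simp only [e]
    rw [← measureReal_sdiff (fun ω hω j => (hω j).trans (by linarith)) (hem S _)]
    rfl
  have hanti : ∀ (y : ι → ℝ) (u v : ℝ), 0 < u + v →
      Q 0 (fun j => y j + u) - Q 0 (fun j => y j - v) ≤ κ * (u + v) := fun y u v huv => by
    have h := hκ (fun j => y j - v) (u + v) huv
    have h' := hstrip ∅ y u v huv.le
    simp only [Q, bernoulliMean_zero]
    rw [← h']
    refine le_of_eq_of_le (congrArg _ ?_) h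
    ext ω
    simp only [orthantStrip, Set.mem_preimage, Set.mem_ofPred_eq, hempty]
    have : ∀ j, y j - v + (u + v) = y j + u := fun j => by ring
    simp only [this]
  have hQb : ∀ t ∈ Set.Icc (0 : ℝ) 1, ∀ y, 0 ≤ Q t y ∧ Q t y ≤ 1 := fun t ht y => by
    constructor
    · rw [← bernoulliMean_const (α := α) t 0]
      exact bernoulliMean_mono ht fun S => measureReal_nonneg
    · rw [← bernoulliMean_const (α := α) t 1]
      exact bernoulliMean_mono ht fun S => measureReal_le_one
  -- The supremum runs over all times and thresholds because the estimate at `(t, y)` involves strip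
  -- probabilities at other times and shifted thresholds. It is finite, as the absorption requires.
  let ρ : ℝ := ⨆ q : Set.Icc (0 : ℝ) 1 × (ι → ℝ), |Q q.1 q.2 - Q 0 q.2|
  have hbdd : BddAbove (Set.range fun q : Set.Icc (0 : ℝ) 1 × (ι → ℝ) =>
      |Q q.1 q.2 - Q 0 q.2|) := by
    refine ⟨1, ?_⟩
    rintro _ ⟨⟨⟨t, ht⟩, y⟩, rfl⟩
    have h1 := hQb t ht y
    have h0 := hQb 0 (by simp) y
    exact abs_le.2 ⟨by linarith [h1.1, h0.2], by linarith [h1.2, h0.1]⟩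
  have hρ : ∀ t ∈ Set.Icc (0 : ℝ) 1, ∀ y, |Q t y - Q 0 y| ≤ ρ := fun t ht y =>
    le_ciSup hbdd (⟨t, ht⟩, y)
  have hρ0 : 0 ≤ ρ := (abs_nonneg _).trans (hρ 0 (by simp) fun _ => 0)
  have hκ0 : 0 ≤ κ := by
    have := measureReal_nonneg.trans (hκ (fun _ => 0) 1 one_pos)
    linarith
  have hΛ0 : 0 ≤ Λ :=
    (Finset.sum_nonneg fun i _ => add_nonneg (integral_nonneg fun ω => by positivity)
    (integral_nonneg fun ω => by positivity)).trans (hΛ (Classical.arbitrary ι))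
  set A : ℝ := K₀ * φ * β ^ 2 with hA
  have hA0 : 0 ≤ A := by positivity
  -- `7κ/φ` bounds the Gaussian strip of width `4/φ + 3/φ`; `2ρ` is the error of passing to the
  -- mixed law at its two boundaries.
  set Δ : ℝ := A * (2 * Real.exp 1 * Λ * (7 * κ / φ + 2 * ρ) + 5 * M) with hΔ
  have hsmoothed : ∀ (y : ι → ℝ) (m a c B), IsSmoothOrthant K₀ β φ y m a c B →
      ∀ t ∈ Set.Icc (0 : ℝ) 1,
        |bernoulliMean t (fun S => ∫ ω, m (mixedSum X Y S ω) ∂P) -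
          ∫ ω, m (mixedSum X Y ∅ ω) ∂P| ≤ Δ := by
    intro y m a c B hm t ht
    refine abs_bernoulliMean_sub_le (fun s hs => ?_) ht
    refine (abs_bernoulliMean_le hs fun S => hm.abs_sum_replace_le hK₀.le hφ hφβ hX hY hind hX3
      hY3 hX1 hY1 h2 hΛ S).trans ?_
    rw [bernoulliMean_const_mul, bernoulliMean_add, bernoulliMean_const, bernoulliMean_const_mul]
    refine mul_le_mul_of_nonneg_left (add_le_add (mul_le_mul_of_nonneg_left ?_ (by positivity))
      le_rfl) hA0
    have hpos : 0 < 4 / φ + 3 / φ := by positivity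
    simp only [hstrip _ y _ _ hpos.le]
    rw [bernoulliMean_sub]
    have h1 := hanti y (4 / φ) (3 / φ) hpos
    have h3 := (abs_le.1 (hρ s hs fun j => y j + 4 / φ)).2
    have h4 := (abs_le.1 (hρ s hs fun j => y j - 3 / φ)).1
    have h5 : κ * (4 / φ + 3 / φ) = 7 * κ / φ := by ring
    simp only [Q] at h1 h3 h4
    linarith
  have hint : ∀ (y : ι → ℝ) (m a c B), IsSmoothOrthant K₀ β φ y m a c B → ∀ S,
      Integrable (fun ω => m (mixedSum X Y S ω)) P := fun y m a c B hm S =>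
    integrable_of_abs_le (hm.measurable.comp (hms S)) (B := 1) fun ω =>
      abs_le.2 ⟨by linarith [hm.nonneg (mixedSum X Y S ω)], hm.le_one _⟩
  have hlower : ∀ (y : ι → ℝ) (m a c B), IsSmoothOrthant K₀ β φ y m a c B → ∀ S,
      e y S ≤ ∫ ω, m (mixedSum X Y S ω) ∂P := by
    intro y m a c B hm S
    simp only [e]
    rw [← integral_indicator_one (hem S y)]
    refine integral_mono_of_nonneg (.of_forall fun ω =>
      Set.indicator_nonneg (fun _ _ => zero_le_one) _) (hint y m a c B hm S)
      (.of_forall fun ω => Set.indicator_apply_le' (fun h => ?_) fun _ => hm.nonneg _)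
    exact (hm.eq_one _ h).ge
  have hupper : ∀ (y : ι → ℝ) (m a c B), IsSmoothOrthant K₀ β φ y m a c B → ∀ S,
      ∫ ω, m (mixedSum X Y S ω) ∂P ≤ e (fun j => y j + 2 / φ) S := by
    intro y m a c B hm S
    simp only [e]
    rw [← integral_indicator_one (hem S _)]
    refine integral_mono_of_nonneg (.of_forall fun ω => hm.nonneg _)
      ((integrable_const 1).indicator (hem S _)) (.of_forall fun ω => ?_)
    by_cases h : ω ∈ {ω | ∀ j, mixedSum X Y S ω j ≤ y j + 2 / φ}
    · simp only [Set.indicator_of_mem h, Pi.one_apply]; exact hm.le_one _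
    · simp only [Set.indicator_of_notMem h]; exact (hm.eq_zero _ h).le
  have hstep : ∀ t ∈ Set.Icc (0 : ℝ) 1, ∀ y, |Q t y - Q 0 y| ≤ 2 * κ / φ + Δ := by
    intro t ht y
    have h2φ : 0 < 2 / φ := by positivity
    have hk : κ * (2 / φ) = 2 * κ / φ := by ring
    rw [abs_le]
    constructor
    -- For the lower bound the smooth indicator must lie below the indicator at `y`, so its
    -- threshold is lowered by `2/φ`.
    · obtain ⟨m, a, c, B, hm⟩ := hsmooth hφ hφβ hcard fun j => y j - 2 / φ
      have h1 := (abs_le.1 (hsmoothed _ m a c B hm t ht)).1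
      have h2 := bernoulliMean_mono ht (hupper _ m a c B hm)
      have h3 := hlower _ m a c B hm ∅
      have h4 := hanti y 0 (2 / φ) (by linarith)
      simp only [sub_add_cancel, add_zero, zero_add] at h2 h4
      simp only [Q, bernoulliMean_zero] at h4 ⊢
      linarith
    · obtain ⟨m, a, c, B, hm⟩ := hsmooth hφ hφβ hcard y
      have h1 := (abs_le.1 (hsmoothed _ m a c B hm t ht)).2
      have h2 := bernoulliMean_mono ht (hlower _ m a c B hm)
      have h3 := hupper _ m a c B hm ∅
      have h4 := hanti y (2 / φ) 0 (by linarith)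
      simp only [sub_zero, add_zero] at h4
      simp only [Q, bernoulliMean_zero] at h4 ⊢
      linarith
  -- With the smallness condition this reads `ρ ≤ 2κ/φ + (7κ/φ + 2ρ)/4 + 5AM`, whence `ρ ≤ 7.5 κ/φ +
  -- 10AM`.
  have hrec : ρ ≤ 2 * κ / φ + Δ := ciSup_le fun q => hstep q.1 q.1.2 q.2
  intro y
  rw [← hQ1, ← hQ0]
  refine (hρ 1 (by simp) y).trans ?_
  have hs1 : A * (2 * Real.exp 1 * Λ) ≤ 1 / 4 := by
    have : K₀ * (8 * Real.exp 1) * φ * β ^ 2 * Λ = 4 * (A * (2 * Real.exp 1 * Λ)) := by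
      rw [hA]; ring
    linarith
  have hκφ : 0 ≤ κ / φ := by positivity
  have h1 : A * (2 * Real.exp 1 * Λ) * (7 * (κ / φ) + 2 * ρ) ≤ 1 / 4 * (7 * (κ / φ) + 2 * ρ) :=
    mul_le_mul_of_nonneg_right hs1 (by positivity)
  have h3 : Δ = A * (2 * Real.exp 1 * Λ) * (7 * (κ / φ) + 2 * ρ) + 5 * (A * M) := by
    rw [hΔ]; ring
  have h4 : 10 * (A * M) ≤ K₀ * (8 * Real.exp 1) * φ * β ^ 2 * M := by
    have : K₀ * (8 * Real.exp 1) * φ * β ^ 2 * M = 8 * Real.exp 1 * (A * M) := by rw [hA]; ring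
    rw [this]
    have := Real.add_one_le_exp 1
    have hAM : 0 ≤ A * M := by positivity
    nlinarith
  have h5 : 2 * κ / φ = 2 * (κ / φ) := by ring
  have h6 : 8 * κ / φ = 8 * (κ / φ) := by ring
  rw [h6]
  linarith

end Comparison

/-- Comparison of the distribution functions of two independent sums with matching covariances,
for families on different probability spaces. -/
theorem exists_abs_orthant_sub_le' : ∃ K : ℝ, 0 < K ∧ ∀ {ι : Type*} [Fintype ι] [Nonempty ι]
    {Ω : Type*} [MeasurableSpace Ω] {P : Measure Ω} [IsProbabilityMeasure P]
    {Ω' : Type*} [MeasurableSpace Ω'] {Q : Measure Ω'} [IsProbabilityMeasure Q] {α : Type*}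
    [Fintype α] [DecidableEq α] {X : α → Ω → ι → ℝ} {Y : α → Ω' → ι → ℝ} {β φ Λ κ : ℝ}, 0 < φ →
    φ ≤ β → φ * Real.log (Fintype.card ι) ≤ β →
    (∀ i, AEMeasurable (X i) P) → (∀ i, AEMeasurable (Y i) Q) → iIndepFun X P → iIndepFun Y Q →
    (∀ i, MemLp (X i) 3 P) → (∀ i, MemLp (Y i) 3 Q) →
    (∀ i j, ∫ ω, X i ω j ∂P = 0) → (∀ i j, ∫ ω, Y i ω j ∂Q = 0) →
    (∀ i j k, ∫ ω, X i ω j * X i ω k ∂P = ∫ ω, Y i ω j * Y i ω k ∂Q) →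
    (∀ j, ∑ i, (∫ ω, |X i ω j| ^ 3 ∂P + ∫ ω, |Y i ω j| ^ 3 ∂Q) ≤ Λ) →
    (∀ (y : ι → ℝ) (u : ℝ), 0 < u →
      Q.real {ω | (∀ j, (∑ i, Y i ω) j ≤ y j + u) ∧ ¬ ∀ j, (∑ i, Y i ω) j ≤ y j} ≤ κ * u) →
    K * φ * β ^ 2 * Λ ≤ 1 → ∀ y : ι → ℝ,
    |P.real {ω | ∀ j, (∑ i, X i ω) j ≤ y j} - Q.real {ω | ∀ j, (∑ i, Y i ω) j ≤ y j}| ≤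
      8 * κ / φ + K * φ * β ^ 2 * ∑ i, (tailMoment P β (X i) + tailMoment Q β (Y i)) := by
  obtain ⟨K, hK, hmain⟩ := exists_abs_orthant_sub_le
  refine ⟨K, hK, ?_⟩
  intro ι _ _ Ω _ P _ Ω' _ Q _ α _ _ X Y β φ Λ κ hφ hφβ hcard hX hY hiX hiY hX3 hY3 hX1 hY1 h2 hΛ
    hκ hsmall y
  let L : α ⊕ α → Measure (ι → ℝ) := Sum.elim (fun i => P.map (X i)) (fun i => Q.map (Y i))
  have hLp : ∀ v, IsProbabilityMeasure (L v) := by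
    rintro (i | i)
    · exact Measure.isProbabilityMeasure_map (hX i)
    · exact Measure.isProbabilityMeasure_map (hY i)
  -- All hypotheses and the conclusion depend only on the laws of the summands and on independence
  -- within each family, so both families may be realized as independent coordinates of one product
  -- space.
  let μ₀ : Measure (α ⊕ α → ι → ℝ) := Measure.pi L
  let X₀ : α → (α ⊕ α → ι → ℝ) → ι → ℝ := fun i ω => ω (.inl i)
  let Y₀ : α → (α ⊕ α → ι → ℝ) → ι → ℝ := fun i ω => ω (.inr i)
  have hX₀ : ∀ i, Measurable (X₀ i) := fun i => measurable_pi_apply _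
  have hY₀ : ∀ i, Measurable (Y₀ i) := fun i => measurable_pi_apply _
  have hind : iIndepFun (Sum.elim X₀ Y₀) μ₀ := by
    have h := iIndepFun_pi (μ := L) (X := fun _ => id) fun _ => aemeasurable_id
    convert h using 1
    funext v
    rcases v with i | i <;> rfl
  have lX : ∀ i, HasLaw (X₀ i) (P.map (X i)) μ₀ := fun i =>
    ⟨(hX₀ i).aemeasurable, (measurePreserving_eval L (.inl i)).map_eq⟩
  have lY : ∀ i, HasLaw (Y₀ i) (Q.map (Y i)) μ₀ := fun i =>
    ⟨(hY₀ i).aemeasurable, (measurePreserving_eval L (.inr i)).map_eq⟩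
  have intX : ∀ i (f : (ι → ℝ) → ℝ), Measurable f → ∫ ω, f (X₀ i ω) ∂μ₀ = ∫ ω, f (X i ω) ∂P :=
    fun i f hf => by
      rw [← integral_map (hX i) hf.aestronglyMeasurable, ← (lX i).map_eq,
        integral_map (hX₀ i).aemeasurable hf.aestronglyMeasurable]
  have intY : ∀ i (f : (ι → ℝ) → ℝ), Measurable f → ∫ ω, f (Y₀ i ω) ∂μ₀ = ∫ ω, f (Y i ω) ∂Q :=
    fun i f hf => by
      rw [← integral_map (hY i) hf.aestronglyMeasurable, ← (lY i).map_eq,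
        integral_map (hY₀ i).aemeasurable hf.aestronglyMeasurable]
  have m3X : ∀ i, MemLp (X₀ i) 3 μ₀ := fun i => by
    have h := (memLp_map_measure_iff (g := id) (f := X i) measurable_id.aestronglyMeasurable
      (hX i)).2 (hX3 i)
    rw [← (lX i).map_eq] at h
    exact (memLp_map_measure_iff measurable_id.aestronglyMeasurable (hX₀ i).aemeasurable).1 h
  have m3Y : ∀ i, MemLp (Y₀ i) 3 μ₀ := fun i => by
    have h := (memLp_map_measure_iff (g := id) (f := Y i) measurable_id.aestronglyMeasurable
      (hY i)).2 (hY3 i)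
    rw [← (lY i).map_eq] at h
    exact (memLp_map_measure_iff measurable_id.aestronglyMeasurable (hY₀ i).aemeasurable).1 h
  have iX₀ : iIndepFun X₀ μ₀ := hind.precomp Sum.inl_injective
  have iY₀ : iIndepFun Y₀ μ₀ := hind.precomp Sum.inr_injective
  have sumX : ∀ s : Set (ι → ℝ), MeasurableSet s →
      μ₀.real {ω | ∑ i, X₀ i ω ∈ s} = P.real {ω | ∑ i, X i ω ∈ s} := fun s hs => by
    have hms : MeasurableSet {v : α → ι → ℝ | ∑ i, v i ∈ s} :=
      (Finset.measurable_sum Finset.univ fun i _ => measurable_pi_apply i) hs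
    have h1 := (iX₀.hasLaw_pi lX).measure_eq (p := fun v => ∑ i, v i ∈ s) hms
    have h2 := (hiX.hasLaw_pi fun i => ⟨hX i, rfl⟩).measure_eq (p := fun v => ∑ i, v i ∈ s) hms
    rw [measureReal_def, measureReal_def, h1, h2]
  have sumY : ∀ s : Set (ι → ℝ), MeasurableSet s →
      μ₀.real {ω | ∑ i, Y₀ i ω ∈ s} = Q.real {ω | ∑ i, Y i ω ∈ s} := fun s hs => by
    have hms : MeasurableSet {v : α → ι → ℝ | ∑ i, v i ∈ s} :=
      (Finset.measurable_sum Finset.univ fun i _ => measurable_pi_apply i) hs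
    have h1 := (iY₀.hasLaw_pi lY).measure_eq (p := fun v => ∑ i, v i ∈ s) hms
    have h2 := (hiY.hasLaw_pi fun i => ⟨hY i, rfl⟩).measure_eq (p := fun v => ∑ i, v i ∈ s) hms
    rw [measureReal_def, measureReal_def, h1, h2]
  have h := hmain (P := μ₀) (X := X₀) (Y := Y₀) (β := β) (φ := φ) (Λ := Λ) (κ := κ) hφ hφβ hcard
    hX₀ hY₀ hind m3X m3Y
    (fun i j => (intX i (fun x => x j) (by fun_prop)).trans (hX1 i j))
    (fun i j => (intY i (fun x => x j) (by fun_prop)).trans (hY1 i j))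
    (fun i j k => by
      rw [intX i (fun x => x j * x k) (by fun_prop), intY i (fun x => x j * x k) (by fun_prop), h2])
    (fun j => by
      refine le_of_eq_of_le (Finset.sum_congr rfl fun i _ => ?_) (hΛ j)
      rw [intX i (fun x => |x j| ^ 3) (by fun_prop), intY i (fun x => |x j| ^ 3) (by fun_prop)])
    (fun y u hu => by
      refine le_of_eq_of_le (sumY {w | (∀ j, w j ≤ y j + u) ∧ ¬ ∀ j, w j ≤ y j} ?_) (hκ y u hu)
      exact (measurableSet_orthant fun j => y j + u).inter (measurableSet_orthant y).compl)
    hsmall y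
  have e1 := sumX {w | ∀ j, w j ≤ y j} (measurableSet_orthant y)
  have e2 := sumY {w | ∀ j, w j ≤ y j} (measurableSet_orthant y)
  have e3 : ∀ i, tailMoment μ₀ β (X₀ i) = tailMoment P β (X i) := fun i =>
    intX i _ (measurable_tail β)
  have e4 : ∀ i, tailMoment μ₀ β (Y₀ i) = tailMoment Q β (Y i) := fun i =>
    intY i _ (measurable_tail β)
  simp only [Set.mem_ofPred_eq] at e1 e2
  rw [e1, e2] at h
  simpa only [e3, e4] using h

/-! ### Infinite thresholds -/

/-- A real number approximating `c`, with the values `± k` at `± ∞`. -/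
noncomputable def finiteThreshold (c : EReal) (k : ℕ) : ℝ :=
  if c = ⊤ then k else if c = ⊥ then -k else c.toReal

/-- For each fixed `w` the two conditions agree from some `k` on, so indicators of the approximating
orthants converge pointwise, also at boundary points. -/
lemma eventually_le_finiteThreshold_iff (c : EReal) (w : ℝ) :
    ∀ᶠ k in Filter.atTop, w ≤ finiteThreshold c k ↔ (w : EReal) ≤ c := by
  induction c using EReal.rec with
  | bot =>
    obtain ⟨N, hN⟩ := exists_nat_gt (-w)
    filter_upwards [Filter.eventually_ge_atTop N] with k hk
    have : (N : ℝ) ≤ k := by exact_mod_cast hk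
    simp only [finiteThreshold, bot_ne_top, if_true, if_false, le_bot_iff, EReal.coe_ne_bot,
      iff_false, not_le]
    linarith
  | coe r => simp [finiteThreshold]
  | top =>
    obtain ⟨N, hN⟩ := exists_nat_gt w
    filter_upwards [Filter.eventually_ge_atTop N] with k hk
    have : (N : ℝ) ≤ k := by exact_mod_cast hk
    simp only [finiteThreshold, if_true, le_top, iff_true]
    linarith

/-! ### Hyperrectangles as limits of orthants in doubled coordinates. -/

variable {p : ℕ}

/-- The linear map `w ↦ (w, -w)`. -/
noncomputable def signedCoords : EuclideanSpace ℝ (Fin p) →L[ℝ] (Fin p ⊕ Fin p → ℝ) :=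
  ContinuousLinearMap.pi fun j =>
    (Sum.elim (fun _ => 1) (fun _ => -1) j : ℝ) • EuclideanSpace.proj (Sum.elim id id j)

lemma signedCoords_apply (w : EuclideanSpace ℝ (Fin p)) (j : Fin p ⊕ Fin p) :
    signedCoords w j = (Sum.elim (fun _ => 1) (fun _ => -1) j : ℝ) * w (Sum.elim id id j) := rfl

lemma signedCoords_inl (w : EuclideanSpace ℝ (Fin p)) (j : Fin p) :
    signedCoords w (.inl j) = w j := by simp [signedCoords_apply]

lemma signedCoords_inr (w : EuclideanSpace ℝ (Fin p)) (j : Fin p) :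
    signedCoords w (.inr j) = -w j := by simp [signedCoords_apply]

lemma measurableSet_of_mem_hyperrectangles {A : Set (EuclideanSpace ℝ (Fin p))}
    (hA : A ∈ hyperrectangles p) : MeasurableSet A := by
  obtain ⟨a, b, -, rfl⟩ := hA
  simp only [Set.ofPred_forall, Set.ofPred_and]
  exact MeasurableSet.iInter fun j =>
    (measurableSet_le measurable_const (by fun_prop)).inter
      (measurableSet_le (by fun_prop) measurable_const)

/-- `a ≤ w ≤ b` means `w ≤ b` and `-w ≤ -a`. Infinite thresholds are reached by dominated
convergence of indicators, which preserves the uniform bound. -/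
lemma abs_measureReal_hyperrectangle_sub_le {μ ν : Measure (EuclideanSpace ℝ (Fin p))}
    [IsFiniteMeasure μ] [IsFiniteMeasure ν] {D : ℝ}
    (h : ∀ y : Fin p ⊕ Fin p → ℝ, |μ.real {w | ∀ j, signedCoords w j ≤ y j} -
      ν.real {w | ∀ j, signedCoords w j ≤ y j}| ≤ D)
    {A : Set (EuclideanSpace ℝ (Fin p))} (hA : A ∈ hyperrectangles p) :
    |μ.real A - ν.real A| ≤ D := by
  obtain ⟨a, b, -, rfl⟩ := hA
  let y : ℕ → Fin p ⊕ Fin p → ℝ := fun k =>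
    Sum.elim (fun j => finiteThreshold (b j) k) (fun j => finiteThreshold (-a j) k)
  have hlim : ∀ w : EuclideanSpace ℝ (Fin p), ∀ᶠ k in Filter.atTop,
      w ∈ {w | ∀ j, signedCoords w j ≤ y k j} ↔
        w ∈ {w : EuclideanSpace ℝ (Fin p) | ∀ j, a j ≤ (w j : EReal) ∧ (w j : EReal) ≤ b j} := by
    intro w
    have h1 := Filter.eventually_all.2 fun j => eventually_le_finiteThreshold_iff (b j) (w j)
    have h2 := Filter.eventually_all.2 fun j => eventually_le_finiteThreshold_iff (-a j) (-w j)
    filter_upwards [h1, h2] with k hk1 hk2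
    simp only [Sum.forall, signedCoords_inl, signedCoords_inr, y, Sum.elim_inl, Sum.elim_inr, hk1,
      hk2, EReal.coe_neg, EReal.neg_le_neg_iff]
    exact ⟨fun h j => ⟨h.2 j, h.1 j⟩, fun h => ⟨fun j => (h j).2, fun j => (h j).1⟩⟩
  have hms : ∀ k, MeasurableSet {w : EuclideanSpace ℝ (Fin p) | ∀ j, signedCoords w j ≤ y k j} :=
    fun k => signedCoords.continuous.measurable (measurableSet_orthant (y k))
  have tend : ∀ (ξ : Measure (EuclideanSpace ℝ (Fin p))) [IsFiniteMeasure ξ],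
      Filter.Tendsto (fun k => ξ.real {w | ∀ j, signedCoords w j ≤ y k j}) Filter.atTop
        (nhds (ξ.real {w | ∀ j, a j ≤ (w j : EReal) ∧ (w j : EReal) ≤ b j})) := fun ξ _ =>
    (ENNReal.tendsto_toReal (measure_ne_top _ _)).comp
      (tendsto_measure_of_tendsto_indicator_of_isFiniteMeasure _ ξ hms hlim)
  exact le_of_tendsto ((tend μ).sub (tend ν)).abs (.of_forall fun k => h (y k))

/-! ### Moments of the matching Gaussian vectors -/

section Moments

variable {n p : ℕ} {Ω : Type*} [MeasurableSpace Ω] {P : Measure Ω} [IsProbabilityMeasure P]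

/-- The absolute third moment of the standard Gaussian distribution. -/
noncomputable def gaussianThirdMoment : ℝ := ∫ x, |x| ^ 3 ∂(gaussianReal 0 1)

lemma gaussianThirdMoment_nonneg : 0 ≤ gaussianThirdMoment :=
  integral_nonneg fun x => by positivity

lemma integral_abs_cube_gaussianReal (v : NNReal) :
    ∫ x, |x| ^ 3 ∂(gaussianReal 0 v) = √v ^ 3 * gaussianThirdMoment := by
  have h : (gaussianReal 0 1).map (√v * ·) = gaussianReal 0 v := by
    rw [gaussianReal_map_const_mul]
    congr 1
    · simp
    · ext; simp
  rw [← h, integral_map (by fun_prop) (by fun_prop), gaussianThirdMoment, ← integral_const_mul]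
  refine integral_congr_ae (.of_forall fun x => ?_)
  simp only [abs_mul, abs_of_nonneg (Real.sqrt_nonneg _)]
  ring

omit [IsProbabilityMeasure P] in
lemma integrable_abs_cube_of_memLp {f : Ω → ℝ} (hf : MemLp f 3 P) :
    Integrable (fun ω => |f ω| ^ 3) P := by
  simpa using hf.integrable_norm_pow (p := 3) (by norm_num)

/-- Lyapunov's inequality, from integrating `3 s f² ≤ 2|f|³ + s³`, that is `(2|f| + s)(|f| - s)² ≥
0`, at `s² = E[f²]`. -/
lemma sqrt_integral_sq_pow_three_le {f : Ω → ℝ} (hf : MemLp f 3 P) :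
    √(∫ ω, f ω * f ω ∂P) ^ 3 ≤ ∫ ω, |f ω| ^ 3 ∂P := by
  set s := √(∫ ω, f ω * f ω ∂P) with hs
  have hs0 : 0 ≤ s := Real.sqrt_nonneg _
  have hsq : ∫ ω, f ω * f ω ∂P = s ^ 2 :=
    (Real.sq_sqrt (integral_nonneg fun ω => mul_self_nonneg _)).symm
  have hf2 : MemLp f 2 P := hf.mono_exponent (by norm_num)
  have i2 : Integrable (fun ω => f ω * f ω) P := hf2.integrable_mul hf2
  have i3 := integrable_abs_cube_of_memLp hf
  have h : ∫ ω, 3 * s * (f ω * f ω) ∂P ≤ ∫ ω, (2 * |f ω| ^ 3 + s ^ 3) ∂P := by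
    refine integral_mono (i2.const_mul _) ((i3.const_mul 2).add (integrable_const _)) fun ω => ?_
    have h1 : f ω * f ω = |f ω| ^ 2 := by rw [sq_abs, sq]
    simp only [h1]
    nlinarith [mul_nonneg (add_nonneg (mul_nonneg zero_le_two (abs_nonneg (f ω))) hs0)
      (sq_nonneg (|f ω| - s))]
  rw [integral_const_mul, hsq, integral_add (i3.const_mul 2) (integrable_const _),
    integral_const_mul, integral_const, probReal_univ, one_smul] at h
  linarith

omit [IsProbabilityMeasure P] in
lemma momentMatrix_apply (x : Ω → EuclideanSpace ℝ (Fin p)) (j k : Fin p) :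
    momentMatrix P x j k = ∫ ω, x ω j * x ω k ∂P := rfl

omit [IsProbabilityMeasure P] in
lemma posSemidef_momentMatrix {x : Ω → EuclideanSpace ℝ (Fin p)}
    (hx : ∀ j, MemLp (fun ω => x ω j) 2 P) : (momentMatrix P x).PosSemidef := by
  refine .of_dotProduct_mulVec_nonneg ?_ fun v => ?_
  · ext j k
    simp [momentMatrix, mul_comm]
  · have hi : ∀ j k, Integrable (fun ω => v j * (x ω j * x ω k * v k)) P := fun j k =>
      (((hx j).integrable_mul (hx k)).mul_const (v k)).const_mul (v j)
    have : star v ⬝ᵥ (momentMatrix P x).mulVec v = ∫ ω, (∑ j, v j * x ω j) ^ 2 ∂P := by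
      calc star v ⬝ᵥ (momentMatrix P x).mulVec v
          = ∑ j, ∑ k, ∫ ω, v j * (x ω j * x ω k * v k) ∂P := by
            simp [dotProduct, Matrix.mulVec, momentMatrix, Finset.mul_sum, integral_const_mul,
              integral_mul_const]
        _ = ∫ ω, ∑ j, ∑ k, v j * (x ω j * x ω k * v k) ∂P := by
            rw [integral_finsetSum _ fun j _ => integrable_finsetSum _ fun k _ => hi j k]
            exact Finset.sum_congr rfl fun j _ => (integral_finsetSum _ fun k _ => hi j k).symm
        _ = _ := by
            refine integral_congr_ae (.of_forall fun ω => ?_)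
            simp only [sq, Finset.sum_mul_sum]
            exact Finset.sum_congr rfl fun j _ => Finset.sum_congr rfl fun k _ => by ring
    rw [this]
    exact integral_nonneg fun ω => sq_nonneg _

variable {Ω' : Type*} [MeasurableSpace Ω'] {Q : Measure Ω'} {x : Ω → EuclideanSpace ℝ (Fin p)}
  {z : Ω' → EuclideanSpace ℝ (Fin p)}

omit [IsProbabilityMeasure P] in
lemma hasLaw_coord (hx : ∀ j, MemLp (fun ω => x ω j) 2 P)
    (hz : HasLaw z (multivariateGaussian 0 (momentMatrix P x)) Q) (j : Fin p) :
    HasLaw (fun ω => z ω j) (gaussianReal 0 (momentMatrix P x j j).toNNReal) Q := by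
  have h := (measurePreserving_eval_multivariateGaussian (μ := 0)
    (posSemidef_momentMatrix hx) (i := j))
  exact HasLaw.comp ⟨h.measurable.aemeasurable, by simpa using h.map_eq⟩ hz

omit [IsProbabilityMeasure P] in
lemma integral_coord_eq_zero (hx : ∀ j, MemLp (fun ω => x ω j) 2 P)
    (hz : HasLaw z (multivariateGaussian 0 (momentMatrix P x)) Q) (j : Fin p) :
    ∫ ω, z ω j ∂Q = 0 := by
  rw [(hasLaw_coord hx hz j).integral_eq, integral_id_gaussianReal]

omit [IsProbabilityMeasure P] in
lemma covariance_coord_eq (hx : ∀ j, MemLp (fun ω => x ω j) 2 P)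
    (hz : HasLaw z (multivariateGaussian 0 (momentMatrix P x)) Q) (j k : Fin p) :
    cov[fun ω => z ω j, fun ω => z ω k; Q] = ∫ ω, x ω j * x ω k ∂P := by
  rw [hz.covariance_fun_comp (f := fun w : EuclideanSpace ℝ (Fin p) => w j)
    (g := fun w : EuclideanSpace ℝ (Fin p) => w k) (by fun_prop) (by fun_prop),
    covariance_eval_multivariateGaussian (posSemidef_momentMatrix hx)]
  rfl

lemma memLp_coord (hz : HasGaussianLaw z Q) (j : Fin p) {q : ENNReal} (hq : q ≠ ⊤) :
    MemLp (fun ω => z ω j) q Q :=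
  (hz.map_fun (EuclideanSpace.proj j : EuclideanSpace ℝ (Fin p) →L[ℝ] ℝ)).memLp hq

omit [IsProbabilityMeasure P] in
lemma integral_coord_mul_eq (hx : ∀ j, MemLp (fun ω => x ω j) 2 P)
    (hz : HasLaw z (multivariateGaussian 0 (momentMatrix P x)) Q) (j k : Fin p) :
    ∫ ω, z ω j * z ω k ∂Q = ∫ ω, x ω j * x ω k ∂P := by
  have hg : HasGaussianLaw z Q := hz.hasGaussianLaw
  have := hg.isProbabilityMeasure
  have h := covariance_eq_sub (memLp_coord hg j (q := 2) (by norm_num))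
    (memLp_coord hg k (q := 2) (by norm_num))
  rw [covariance_coord_eq hx hz, integral_coord_eq_zero hx hz, zero_mul, sub_zero] at h
  exact h.symm

/-- The coordinate is Gaussian with variance `E[x_j²]`, so Lyapunov's inequality applies. Hence a
bound on the third moments of `X` also controls those of `Y`. -/
lemma integral_abs_cube_coord_le (hx : ∀ j, MemLp (fun ω => x ω j) 3 P)
    (hz : HasLaw z (multivariateGaussian 0 (momentMatrix P x)) Q) (j : Fin p) :
    ∫ ω, |z ω j| ^ 3 ∂Q ≤ gaussianThirdMoment * ∫ ω, |x ω j| ^ 3 ∂P := by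
  have hx2 : ∀ j, MemLp (fun ω => x ω j) 2 P := fun j => (hx j).mono_exponent (by norm_num)
  have h := (hasLaw_coord hx2 hz j).integral_comp (f := fun x : ℝ => |x| ^ 3) (by fun_prop)
  simp only [Function.comp_def] at h
  rw [h, integral_abs_cube_gaussianReal, mul_comm]
  refine mul_le_mul_of_nonneg_left ?_ gaussianThirdMoment_nonneg
  refine le_of_eq_of_le ?_ (sqrt_integral_sq_pow_three_le (hx j))
  rw [momentMatrix_apply, Real.coe_toNNReal _ (integral_nonneg fun ω => mul_self_nonneg _)]

/-! ### Third moments and truncated moments -/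

omit [IsProbabilityMeasure P] in
-- A finite bound on the sum makes every single third moment finite. The sign of `B` is not yet
-- known, so `max B 0` appears, the real value of `ENNReal.ofReal B`.
lemma memLp_three_of_thirdMoment_le (hn : n ≠ 0) {X : Fin n → Ω → EuclideanSpace ℝ (Fin p)}
    (hX : ∀ i, AEMeasurable (X i) P) {B : ℝ} (hB : thirdMoment P X ≤ ENNReal.ofReal B) :
    (∀ i j, MemLp (fun ω => X i ω j) 3 P) ∧
      ∀ j, ∑ i, ∫ ω, |X i ω j| ^ 3 ∂P ≤ n * max B 0 := by
  have hn0 : (n : ENNReal) ≠ 0 := by exact_mod_cast hn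
  have hsum : ∀ j, ∑ i, ∫⁻ ω, ENNReal.ofReal (|X i ω j| ^ 3) ∂P ≤ ENNReal.ofReal B * n := fun j =>
    (ENNReal.div_le_iff hn0 (ENNReal.natCast_ne_top n)).1 ((le_iSup (fun j =>
      (∑ i, ∫⁻ ω, ENNReal.ofReal (|X i ω j| ^ 3) ∂P) / n) j).trans hB)
  have htop : ENNReal.ofReal B * n ≠ ⊤ :=
    ENNReal.mul_ne_top ENNReal.ofReal_ne_top (ENNReal.natCast_ne_top n)
  have hm : ∀ i j, AEStronglyMeasurable (fun ω => X i ω j) P := fun i j =>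
    ((by fun_prop : Measurable fun w : EuclideanSpace ℝ (Fin p) => w j).comp_aemeasurable
      (hX i)).aestronglyMeasurable
  have hm3 : ∀ i j, AEStronglyMeasurable (fun ω => |X i ω j| ^ 3) P := fun i j =>
    (continuous_abs.pow 3).comp_aestronglyMeasurable (hm i j)
  have hfin : ∀ i j, ∫⁻ ω, ENNReal.ofReal (|X i ω j| ^ 3) ∂P ≠ ⊤ := fun i j =>
    ne_top_of_le_ne_top htop ((Finset.single_le_sum
      (f := fun i => ∫⁻ ω, ENNReal.ofReal (|X i ω j| ^ 3) ∂P) (fun _ _ => zero_le)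
      (Finset.mem_univ i)).trans (hsum j))
  refine ⟨fun i j => ?_, fun j => ?_⟩
  · rw [← integrable_norm_rpow_iff (hm i j) (by norm_num) (by norm_num)]
    have : Integrable (fun ω => |X i ω j| ^ 3) P :=
      (lintegral_ofReal_ne_top_iff_integrable (hm3 i j) (.of_forall fun ω => by positivity)).1
        (hfin i j)
    refine this.congr (.of_forall fun ω => ?_)
    simp only [Real.norm_eq_abs]
    rw [← Real.rpow_natCast]
    norm_num
  · have h := ENNReal.toReal_mono htop (hsum j)
    rw [ENNReal.toReal_sum fun i _ => hfin i j, ENNReal.toReal_mul, ENNReal.toReal_natCast,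
      ENNReal.toReal_ofReal', mul_comm] at h
    refine le_of_eq_of_le (Finset.sum_congr rfl fun i _ => ?_) h
    exact integral_eq_lintegral_of_nonneg_ae (.of_forall fun ω => by positivity) (hm3 i j)

lemma norm_signedCoords (hp : p ≠ 0) (w : EuclideanSpace ℝ (Fin p)) :
    ‖signedCoords w‖ = maxAbs w := by
  have : Nonempty (Fin p) := ⟨⟨0, Nat.pos_of_ne_zero hp⟩⟩
  have hb : BddAbove (Set.range fun j => |w j|) := (Set.finite_range _).bddAbove
  refine le_antisymm ((pi_norm_le_iff_of_nonneg (Real.iSup_nonneg fun j => abs_nonneg _)).2 ?_)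
    (ciSup_le fun j => ?_)
  · rintro (j | j)
    · rw [signedCoords_inl]; exact le_ciSup hb j
    · rw [signedCoords_inr, norm_neg]; exact le_ciSup hb j
  · have := norm_le_pi_norm (signedCoords w) (.inl j)
    rwa [signedCoords_inl] at this

omit [IsProbabilityMeasure P] in
/-- The truncated moment, as a real number, in terms of the normalized summands. -/
lemma truncMoment_eq_ofReal (hn : n ≠ 0) (hp : 1 < p) {X : Fin n → Ω → EuclideanSpace ℝ (Fin p)}
    (h3 : ∀ i, MemLp (fun ω => signedCoords (X i ω)) 3 P) {φ : ℝ} (hφ : 0 < φ) :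
    truncMoment P X φ = ENNReal.ofReal (√n * ∑ i,
      tailMoment P (2 * φ * Real.log p) (fun ω => (√n)⁻¹ • signedCoords (X i ω))) := by
  have hn0 : 0 < √(n : ℝ) := Real.sqrt_pos.2 (by exact_mod_cast Nat.pos_of_ne_zero hn)
  have hlog : 0 < Real.log p := Real.log_pos (by exact_mod_cast hp)
  set F : (Fin p ⊕ Fin p → ℝ) → ℝ :=
    {x : Fin p ⊕ Fin p → ℝ | 1 < 2 * (2 * φ * Real.log p) * ‖x‖}.indicator fun x => ‖x‖ ^ 3 with hF
  set f : EuclideanSpace ℝ (Fin p) → ℝ := {w | √n / (4 * φ * Real.log p) < maxAbs w}.indicator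
    (fun w => maxAbs w ^ 3) with hf
  have hfF : ∀ w, f w = √n ^ 3 * F ((√n)⁻¹ • signedCoords w) := by
    intro w
    have hnorm : ‖(√n)⁻¹ • signedCoords w‖ = (√n)⁻¹ * maxAbs w := by
      rw [norm_smul, norm_signedCoords (by omega), Real.norm_of_nonneg (by positivity)]
    -- For `β = 2 φ log p` the cutoff `2β‖x‖ > 1` of the normalized vectors is exactly the threshold
    -- `√n / (4 φ log p)`.
    have hiff : 1 < 2 * (2 * φ * Real.log p) * ((√n)⁻¹ * maxAbs w) ↔
        √n / (4 * φ * Real.log p) < maxAbs w := by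
      rw [div_lt_iff₀ (by positivity), show 2 * (2 * φ * Real.log p) * ((√n)⁻¹ * maxAbs w) =
        (maxAbs w * (4 * φ * Real.log p)) / √n by ring, one_lt_div hn0]
    simp only [hf, hF, Set.indicator, Set.mem_ofPred_eq, hnorm, hiff]
    split_ifs
    · field_simp
    · simp
  have hmF : Measurable F := measurable_tail _
  have h3' : ∀ i, MemLp (fun ω => (√n)⁻¹ • signedCoords (X i ω)) 3 P := fun i =>
    (h3 i).const_smul (√(n : ℝ))⁻¹
  have hint : ∀ i, Integrable (fun ω => F ((√n)⁻¹ • signedCoords (X i ω))) P := fun i =>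
    (integrable_norm_cube (h3' i)).mono
      (hmF.comp_aemeasurable (h3' i).aestronglyMeasurable.aemeasurable).aestronglyMeasurable
      (.of_forall fun ω => by
        simp only [Real.norm_eq_abs]
        rw [abs_of_nonneg (Set.indicator_nonneg (fun _ _ => by positivity) _),
          abs_of_nonneg (by positivity)]
        exact Set.indicator_le_self' (fun _ _ => by positivity) _)
  have hF0 : ∀ x, 0 ≤ F x := fun x => Set.indicator_nonneg (fun _ _ => by positivity) _
  have hterm : ∀ i, ∫⁻ ω, ENNReal.ofReal (f (X i ω)) ∂P = ENNReal.ofReal (√n ^ 3 *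
      tailMoment P (2 * φ * Real.log p) (fun ω => (√n)⁻¹ • signedCoords (X i ω))) := fun i => by
    simp only [hfF]
    rw [← ofReal_integral_eq_lintegral_ofReal ((hint i).const_mul _)
      (.of_forall fun ω => mul_nonneg (by positivity) (hF0 _)), integral_const_mul]
    rfl
  have hnn : ∀ i, 0 ≤ √(n : ℝ) ^ 3 *
      tailMoment P (2 * φ * Real.log p) (fun ω => (√n)⁻¹ • signedCoords (X i ω)) := fun i =>
    mul_nonneg (by positivity) (tailMoment_nonneg _ _)
  have hnpos : (0 : ℝ) < n := by exact_mod_cast Nat.pos_of_ne_zero hn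
  unfold truncMoment
  simp only [← hf, hterm]
  rw [← ENNReal.ofReal_sum_of_nonneg fun i _ => hnn i, ← ENNReal.ofReal_natCast n,
    ← ENNReal.ofReal_div_of_pos hnpos, ← Finset.mul_sum]
  congr 1
  have : √(n : ℝ) ^ 3 = √n * n := by
    rw [pow_succ, Real.sq_sqrt hnpos.le]; ring
  rw [this]
  field_simp

end Moments

/-! ### From orthants to the bound over hyperrectangles. -/

section Main

variable {n p : ℕ} {Ω Ω' : Type*} [MeasurableSpace Ω] [MeasurableSpace Ω'] {P : Measure Ω}
  {Q : Measure Ω'}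

omit [MeasurableSpace Ω] in
lemma signedCoords_normSum (X : Fin n → Ω → EuclideanSpace ℝ (Fin p)) (ω : Ω) :
    signedCoords (normSum X ω) = ∑ i, (√n)⁻¹ • signedCoords (X i ω) := by
  rw [normSum, map_smul, map_sum, Finset.smul_sum]

lemma one_lt_log {p : ℕ} (hp : 3 ≤ p) : 1 < Real.log p := by
  rw [Real.lt_log_iff_exp_lt (by positivity)]
  have : (3 : ℝ) ≤ p := by exact_mod_cast hp
  linarith [Real.exp_one_lt_three]

lemma log_two_mul_le {p : ℕ} (hp : 3 ≤ p) : Real.log (p + p) ≤ 2 * Real.log p := by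
  have h3 : (3 : ℝ) ≤ p := by exact_mod_cast hp
  rw [← Real.log_rpow (by positivity), show ((2 : ℝ)) = ((2 : ℕ) : ℝ) by norm_num,
    Real.rpow_natCast]
  exact Real.log_le_log (by positivity) (by nlinarith)

lemma variance_signedCoords_normSum [IsProbabilityMeasure Q]
    {X : Fin n → Ω → EuclideanSpace ℝ (Fin p)} {Y : Fin n → Ω' → EuclideanSpace ℝ (Fin p)}
    (hX2 : ∀ i j, MemLp (fun ω => X i ω j) 2 P) (hiY : iIndepFun Y Q)
    (hY : ∀ i, HasLaw (Y i) (multivariateGaussian 0 (momentMatrix P (X i))) Q)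
    (j : Fin p ⊕ Fin p) :
    Var[fun ω => signedCoords (normSum Y ω) j; Q] =
      (∑ i, ∫ ω, X i ω (Sum.elim id id j) ^ 2 ∂P) / n := by
  set l : Fin p := Sum.elim id id j
  have hg : ∀ i, HasGaussianLaw (Y i) Q := fun i => (hY i).hasGaussianLaw
  have h1 : ∀ ω, signedCoords (normSum Y ω) j =
      ((Sum.elim (fun _ => 1) (fun _ => -1) j : ℝ) * (√n)⁻¹) * (∑ i, fun ω => Y i ω l) ω := by
    intro ω
    simp [signedCoords_apply, normSum, mul_assoc, l]
  have hsq : ((Sum.elim (fun _ => 1) (fun _ => -1) j : ℝ) * (√n)⁻¹) ^ 2 = (n : ℝ)⁻¹ := by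
    rcases j with j | j <;> simp [Real.sq_sqrt]
  have hind : ∀ i k, i ≠ k → IndepFun (fun ω => Y i ω l) (fun ω => Y k ω l) Q := fun i k hik =>
    (hiY.indepFun hik).comp (φ := fun w : EuclideanSpace ℝ (Fin p) => w l)
      (ψ := fun w : EuclideanSpace ℝ (Fin p) => w l) (by fun_prop) (by fun_prop)
  simp only [h1]
  rw [variance_const_mul, hsq, IndepFun.variance_sum
    (fun i _ => memLp_coord (hg i) l (by norm_num)) (fun i _ k _ hik => hind i k hik),
    div_eq_inv_mul]
  congr 1
  refine Finset.sum_congr rfl fun i _ => ?_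
  have hm := memLp_coord (hg i) l (q := 2) (by norm_num)
  rw [← covariance_self hm.aestronglyMeasurable.aemeasurable, covariance_coord_eq (hX2 i) (hY i)]
  simp only [sq]

/-- Anti-concentration of the normalized Gaussian sum. -/
lemma measureReal_strip_normSum_le [IsProbabilityMeasure Q] (hp : 3 ≤ p)
    {X : Fin n → Ω → EuclideanSpace ℝ (Fin p)} {Y : Fin n → Ω' → EuclideanSpace ℝ (Fin p)}
    (hX2 : ∀ i j, MemLp (fun ω => X i ω j) 2 P) (hiY : iIndepFun Y Q)
    (hY : ∀ i, HasLaw (Y i) (multivariateGaussian 0 (momentMatrix P (X i))) Q) {b : ℝ} (hb : 0 < b)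
    (hvar : ∀ j, b ≤ (∑ i, ∫ ω, X i ω j ^ 2 ∂P) / n) (y : Fin p ⊕ Fin p → ℝ) {u : ℝ} (hu : 0 < u) :
    Q.real {ω | (∀ j, signedCoords (normSum Y ω) j ≤ y j + u) ∧
      ¬ ∀ j, signedCoords (normSum Y ω) j ≤ y j} ≤
      (2 * Real.exp 2 + 1) / √b * (2 * √(Real.log p)) * u := by
  have hg : ∀ i, HasGaussianLaw (Y i) Q := fun i => (hY i).hasGaussianLaw
  have hS : HasGaussianLaw (fun ω => signedCoords (normSum Y ω)) Q :=
    ((iIndepFun.hasGaussianLaw_fun_sum hg hiY).fun_smul (√n)⁻¹).map_fun signedCoords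
  have hSm := hS.aemeasurable
  have hgs := hS.isGaussian_map
  have hlog := one_lt_log hp
  have hmean : ∀ j, ∫ w, w j ∂(Q.map fun ω => signedCoords (normSum Y ω)) = 0 := fun j => by
    rw [integral_map hSm (measurable_pi_apply j).aestronglyMeasurable]
    simp only [signedCoords_apply, normSum, PiLp.smul_apply, smul_eq_mul, WithLp.ofLp_sum,
      Finset.sum_apply]
    rw [integral_const_mul, integral_const_mul, integral_finsetSum _ fun i _ =>
      (memLp_coord (hg i) _ (q := 1) (by norm_num)).integrable le_rfl]
    simp [fun i => integral_coord_eq_zero (hX2 i) (hY i)]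
  have hvar' : ∀ j, b ≤ Var[fun w => w j; Q.map fun ω => signedCoords (normSum Y ω)] := fun j => by
    rw [variance_map (measurable_pi_apply j).aemeasurable hSm]
    exact (hvar _).trans_eq (variance_signedCoords_normSum hX2 hiY hY j).symm
  -- `r = 2√(log p)` gives `exp(r²/2) = p²`, enough for the `2p` signed coordinates.
  have hr : 1 ≤ 2 * √(Real.log p) := by
    have := Real.one_le_sqrt.2 hlog.le
    linarith
  have hcard : (Fintype.card (Fin p ⊕ Fin p) : ℝ) ≤ Real.exp ((2 * √(Real.log p)) ^ 2 / 2) := by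
    rw [mul_pow, Real.sq_sqrt (by linarith), ← Real.log_le_iff_le_exp (by simp; omega)]
    simp only [Fintype.card_sum, Fintype.card_fin, Nat.cast_add]
    linarith [log_two_mul_le hp]
  have h := measureReal_strip_le hmean hb hvar' hr hcard y hu
  have hms : MeasurableSet {w : Fin p ⊕ Fin p → ℝ | (∀ j, w j ≤ y j + u) ∧ ¬ ∀ j, w j ≤ y j} :=
    (measurableSet_orthant fun j => y j + u).inter (measurableSet_orthant y).compl
  rw [map_measureReal_apply_of_aemeasurable hSm hms] at h
  exact h.trans_eq (by ring)

/-- The comparison over hyperrectangles, for a given smoothing parameter `φ`. -/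
theorem exists_abs_hyperrectangle_sub_le : ∃ K : ℝ, 0 < K ∧ ∀ {n p : ℕ} {Ω Ω' : Type*}
    [MeasurableSpace Ω] [MeasurableSpace Ω'] {P : Measure Ω} [IsProbabilityMeasure P]
    {Q : Measure Ω'} [IsProbabilityMeasure Q] {X : Fin n → Ω → EuclideanSpace ℝ (Fin p)}
    {Y : Fin n → Ω' → EuclideanSpace ℝ (Fin p)} {b L φ : ℝ}, n ≠ 0 → 3 ≤ p →
    (∀ i, AEMeasurable (X i) P) → iIndepFun X P →
    (∀ i j, MemLp (fun ω => X i ω j) 3 P) → (∀ i j, ∫ ω, X i ω j ∂P = 0) →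
    iIndepFun Y Q → (∀ i, HasLaw (Y i) (multivariateGaussian 0 (momentMatrix P (X i))) Q) →
    0 < b → (∀ j, b ≤ (∑ i, ∫ ω, X i ω j ^ 2 ∂P) / n) →
    (∀ j, ∑ i, ∫ ω, |X i ω j| ^ 3 ∂P ≤ n * L) → 0 < φ →
    K * φ ^ 3 * Real.log p ^ 2 * L ≤ √n →
    ∃ M : ℝ, 0 ≤ M ∧ truncMoment P X φ + truncMoment Q Y φ = ENNReal.ofReal M ∧
      ∀ A ∈ hyperrectangles p,
        |P.real {ω | normSum X ω ∈ A} - Q.real {ω | normSum Y ω ∈ A}| ≤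
          K / √b * √(Real.log p) / φ + K * φ ^ 3 * Real.log p ^ 2 * M / √n := by
  obtain ⟨K, hK, hmain⟩ := exists_abs_orthant_sub_le'
  -- `4K` is the factor in `K φ β² = 4K φ³ (log p)²`, and `1 + gaussianThirdMoment` accounts for the
  -- third moments of `X` and `Y` together; `16 = 8 · 2` comes from `8κ/φ` with `r = 2√(log p)`.
  set K' : ℝ := 4 * K * (1 + gaussianThirdMoment) + 16 * (2 * Real.exp 2 + 1) with hK'
  have hG := gaussianThirdMoment_nonneg
  refine ⟨K', by positivity, ?_⟩
  intro n p Ω Ω' _ _ P _ Q _ X Y b L φ hn hp hX hiX hX3 hX1 hiY hY hb hvar hL hφ hsmall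
  have hlog := one_lt_log hp
  have hn0 : (0 : ℝ) < n := by exact_mod_cast Nat.pos_of_ne_zero hn
  have hsn : 0 < √(n : ℝ) := Real.sqrt_pos.2 hn0
  have : Nonempty (Fin p) := ⟨⟨0, by omega⟩⟩
  have hg : ∀ i, HasGaussianLaw (Y i) Q := fun i => (hY i).hasGaussianLaw
  have hX2 : ∀ i j, MemLp (fun ω => X i ω j) 2 P := fun i j => (hX3 i j).mono_exponent (by norm_num)
  set s : ℝ := (√n)⁻¹ with hs
  have hs0 : 0 < s := inv_pos.2 hsn
  set β : ℝ := 2 * φ * Real.log p with hβ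
  have hφβ : φ ≤ β := by rw [hβ]; nlinarith
  have hcard : φ * Real.log (Fintype.card (Fin p ⊕ Fin p)) ≤ β := by
    simp only [Fintype.card_sum, Fintype.card_fin, Nat.cast_add]
    nlinarith [log_two_mul_le hp]
  let sg : Fin p ⊕ Fin p → ℝ := Sum.elim (fun _ => 1) (fun _ => -1)
  have hsg : ∀ j, |sg j| = 1 := by rintro (j | j) <;> simp [sg]
  have hcoord : ∀ (w : EuclideanSpace ℝ (Fin p)) j,
      (s • signedCoords w) j = s * sg j * w (Sum.elim id id j) := fun w j => by
    rw [Pi.smul_apply, signedCoords_apply, smul_eq_mul, mul_assoc]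
  have hcube : ∀ (w : EuclideanSpace ℝ (Fin p)) j,
      |(s • signedCoords w) j| ^ 3 = s ^ 3 * |w (Sum.elim id id j)| ^ 3 := fun w j => by
    rw [hcoord, abs_mul, abs_mul, hsg, abs_of_pos hs0]; ring
  have hX3' : ∀ i, MemLp (fun ω => signedCoords (X i ω)) 3 P := fun i =>
    MemLp.of_eval fun j => (hX3 i _).const_mul _
  have hY3' : ∀ i, MemLp (fun ω => signedCoords (Y i ω)) 3 Q := fun i =>
    ((hg i).map_fun signedCoords).memLp (by norm_num)
  have hY3 : ∀ i j, MemLp (fun ω => Y i ω j) 3 Q := fun i j => memLp_coord (hg i) j (by norm_num)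
  have hφm : Measurable fun w : EuclideanSpace ℝ (Fin p) => s • signedCoords w :=
    (signedCoords.continuous.const_smul s).measurable
  have hL0 : 0 ≤ n * L :=
    (Finset.sum_nonneg fun i _ => integral_nonneg fun ω => by positivity).trans
      (hL (Classical.arbitrary _))
  have hs3 : s ^ 3 * (n * L) = L / √n := by
    have : √(n : ℝ) ^ 3 = √n * n := by rw [pow_succ, Real.sq_sqrt hn0.le]; ring
    rw [hs, inv_pow, this]; field_simp
  set tX : ℝ := ∑ i, tailMoment P β (fun ω => s • signedCoords (X i ω)) with htX
  set tY : ℝ := ∑ i, tailMoment Q β (fun ω => s • signedCoords (Y i ω)) with htY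
  have htX0 : 0 ≤ tX := Finset.sum_nonneg fun i _ => tailMoment_nonneg _ _
  have htY0 : 0 ≤ tY := Finset.sum_nonneg fun i _ => tailMoment_nonneg _ _
  have hκ : ∀ (y : Fin p ⊕ Fin p → ℝ) (u : ℝ), 0 < u →
      Q.real {ω | (∀ j, (∑ i, s • signedCoords (Y i ω)) j ≤ y j + u) ∧
        ¬ ∀ j, (∑ i, s • signedCoords (Y i ω)) j ≤ y j} ≤
      (2 * Real.exp 2 + 1) / √b * (2 * √(Real.log p)) * u := fun y u hu => by
    simp only [hs, ← signedCoords_normSum]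
    exact measureReal_strip_normSum_le hp hX2 hiY hY hb hvar y hu
  have hΛ : ∀ j, ∑ i, (∫ ω, |(s • signedCoords (X i ω)) j| ^ 3 ∂P +
      ∫ ω, |(s • signedCoords (Y i ω)) j| ^ 3 ∂Q) ≤ (1 + gaussianThirdMoment) * (L / √n) := by
    intro j
    simp only [hcube, integral_const_mul, ← mul_add, ← Finset.mul_sum]
    rw [← hs3, mul_left_comm]
    refine mul_le_mul_of_nonneg_left ?_ (by positivity)
    calc _ ≤ ∑ i, (1 + gaussianThirdMoment) * ∫ ω, |X i ω (Sum.elim id id j)| ^ 3 ∂P :=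
          Finset.sum_le_sum fun i _ => by
            have := integral_abs_cube_coord_le (hX3 i) (hY i) (Sum.elim id id j)
            linarith
      _ ≤ _ := by
          rw [← Finset.mul_sum]
          exact mul_le_mul_of_nonneg_left (hL _) (by positivity)
  have hL0' : 0 ≤ L := nonneg_of_mul_nonneg_right hL0 hn0
  have hφβ2 : K * φ * β ^ 2 = 4 * K * (φ ^ 3 * Real.log p ^ 2) := by rw [hβ]; ring
  have hc0 : 0 ≤ φ ^ 3 * Real.log p ^ 2 := by positivity
  have hKK' : 4 * K * (1 + gaussianThirdMoment) ≤ K' := by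
    rw [hK']; linarith [Real.exp_pos 2]
  have hsm : K * φ * β ^ 2 * ((1 + gaussianThirdMoment) * (L / √n)) ≤ 1 := by
    rw [hφβ2, show 4 * K * (φ ^ 3 * Real.log p ^ 2) * ((1 + gaussianThirdMoment) * (L / √n)) =
      4 * K * (1 + gaussianThirdMoment) * (φ ^ 3 * Real.log p ^ 2 * L) / √n by ring,
      div_le_one hsn]
    refine (mul_le_mul_of_nonneg_right hKK' (by positivity)).trans ?_
    rwa [← mul_assoc, ← mul_assoc]
  have horth := hmain (X := fun i ω => s • signedCoords (X i ω))
    (Y := fun i ω => s • signedCoords (Y i ω)) hφ hφβ hcard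
    (fun i => hφm.comp_aemeasurable (hX i)) (fun i => hφm.comp_aemeasurable (hY i).aemeasurable)
    (hiX.comp (fun _ w => s • signedCoords w) fun _ => hφm)
    (hiY.comp (fun _ w => s • signedCoords w) fun _ => hφm)
    (fun i => (hX3' i).const_smul s) (fun i => (hY3' i).const_smul s)
    (fun i j => by simp only [hcoord, integral_const_mul, hX1, mul_zero])
    (fun i j => by
      simp only [hcoord, integral_const_mul, integral_coord_eq_zero (hX2 i) (hY i), mul_zero])
    (fun i j k => by
      have e : ∀ (w : EuclideanSpace ℝ (Fin p)), (s • signedCoords w) j * (s • signedCoords w) k =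
          s * sg j * (s * sg k) * (w (Sum.elim id id j) * w (Sum.elim id id k)) := fun w => by
        rw [hcoord, hcoord]; ring
      simp only [e, integral_const_mul, integral_coord_mul_eq (hX2 i) (hY i)])
    hΛ hκ hsm
  refine ⟨√n * tX + √n * tY, by positivity, ?_, fun A hA => ?_⟩
  · rw [truncMoment_eq_ofReal hn (by omega) hX3' hφ, truncMoment_eq_ofReal hn (by omega) hY3' hφ,
      ENNReal.ofReal_add (by positivity) (by positivity)]
  have hXm : AEMeasurable (normSum X) P :=
    (Finset.aemeasurable_fun_sum _ fun i _ => hX i).const_smul (√n)⁻¹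
  have hYm : AEMeasurable (normSum Y) Q :=
    (Finset.aemeasurable_fun_sum _ fun i _ => (hY i).aemeasurable).const_smul (√n)⁻¹
  have hAm := measurableSet_of_mem_hyperrectangles hA
  have hpX : IsProbabilityMeasure (P.map (normSum X)) := Measure.isProbabilityMeasure_map hXm
  have hpY : IsProbabilityMeasure (Q.map (normSum Y)) := Measure.isProbabilityMeasure_map hYm
  have hrect := abs_measureReal_hyperrectangle_sub_le (μ := P.map (normSum X))
    (ν := Q.map (normSum Y)) (fun y => by
      have hms : MeasurableSet {w : EuclideanSpace ℝ (Fin p) | ∀ j, signedCoords w j ≤ y j} :=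
        signedCoords.continuous.measurable (measurableSet_orthant y)
      have h := horth y
      simp only [hs, ← signedCoords_normSum] at h
      rw [map_measureReal_apply_of_aemeasurable hXm hms,
        map_measureReal_apply_of_aemeasurable hYm hms]
      exact h) hA
  rw [map_measureReal_apply_of_aemeasurable hXm hAm,
    map_measureReal_apply_of_aemeasurable hYm hAm] at hrect
  refine hrect.trans (add_le_add ?_ ?_)
  · rw [show 8 * ((2 * Real.exp 2 + 1) / √b * (2 * √(Real.log p))) / φ =
      16 * (2 * Real.exp 2 + 1) / √b * √(Real.log p) / φ by ring]
    have : 16 * (2 * Real.exp 2 + 1) ≤ K' := by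
      rw [hK']
      have : 0 ≤ 4 * K * (1 + gaussianThirdMoment) := by positivity
      linarith
    gcongr
  · rw [Finset.sum_add_distrib]
    change K * φ * β ^ 2 * (tX + tY) ≤ _
    rw [hφβ2, show K' * φ ^ 3 * Real.log p ^ 2 * (√n * tX + √n * tY) / √n =
      K' * (φ ^ 3 * Real.log p ^ 2) * (tX + tY) by field_simp]
    have : 4 * K ≤ K' := by
      refine le_trans ?_ hKK'
      nlinarith
    gcongr

end Main

/-- A bound on the third absolute moments is positive if the second moments do not vanish. -/
lemma thirdMoment_bound_pos {n p : ℕ} {Ω : Type*} [MeasurableSpace Ω] {P : Measure Ω}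
    [IsProbabilityMeasure P] {X : Fin n → Ω → EuclideanSpace ℝ (Fin p)} {b B : ℝ} (hb : 0 < b)
    (j : Fin p) (hX : ∀ i, MemLp (fun ω => X i ω j) 3 P)
    (hvar : b ≤ (∑ i, ∫ ω, X i ω j ^ 2 ∂P) / n)
    (hB : ∑ i, ∫ ω, |X i ω j| ^ 3 ∂P ≤ n * max B 0) : 0 < B := by
  -- Otherwise all third moments of the coordinate vanish, hence by Lyapunov's inequality all its
  -- second moments, against `b > 0`.
  by_contra hneg
  rw [max_eq_right (not_lt.1 hneg), mul_zero] at hB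
  have hnn : ∀ i ∈ Finset.univ, 0 ≤ ∫ ω, |X i ω j| ^ 3 ∂P :=
    fun i _ => integral_nonneg fun ω => by positivity
  have h0 := (Finset.sum_eq_zero_iff_of_nonneg hnn).1 (le_antisymm hB (Finset.sum_nonneg hnn))
  have h2 : ∀ i, ∫ ω, X i ω j ^ 2 ∂P = 0 := by
    intro i
    have h := sqrt_integral_sq_pow_three_le (hX i)
    rw [h0 i (Finset.mem_univ i)] at h
    have hs : √(∫ ω, X i ω j * X i ω j ∂P) = 0 := by
      have := le_antisymm h (by positivity)
      exact pow_eq_zero_iff (by norm_num) |>.1 this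
    have hle := Real.sqrt_eq_zero'.1 hs
    simp only [sq]
    exact le_antisymm hle (integral_nonneg fun ω => mul_self_nonneg _)
  simp only [h2, Finset.sum_const_zero, zero_div] at hvar
  linarith

/-- The sixth roots that occur in the Berry-Esseen rate, in terms of
`r = (L² l⁴ / n)^{1/6}`. -/
lemma exists_sixth_root {L l n : ℝ} (hL : 0 < L) (hl : 0 < l) (hn : 0 < n) :
    ∃ r : ℝ, 0 < r ∧ (L ^ 2 * l ^ 4 / n) ^ (-(1 / 6) : ℝ) = r⁻¹ ∧ r ^ 3 = L * l ^ 2 / √n ∧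
      (L ^ 2 * l ^ 7 / n) ^ (1 / 6 : ℝ) = √l * r := by
  have hA : 0 < L ^ 2 * l ^ 4 / n := by positivity
  have hr : 0 < (L ^ 2 * l ^ 4 / n) ^ (1 / 6 : ℝ) := Real.rpow_pos_of_pos hA _
  have h6 : ((L ^ 2 * l ^ 4 / n) ^ (1 / 6 : ℝ)) ^ 6 = L ^ 2 * l ^ 4 / n := by
    rw [← Real.rpow_mul_natCast hA.le]; norm_num
  refine ⟨_, hr, Real.rpow_neg hA.le _, ?_, ?_⟩
  · refine (pow_left_inj₀ (by positivity) (by positivity) two_ne_zero).1 ?_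
    rw [← pow_mul, h6, div_pow, Real.sq_sqrt hn.le]
    ring
  · have h : L ^ 2 * l ^ 7 / n = (√l * (L ^ 2 * l ^ 4 / n) ^ (1 / 6 : ℝ)) ^ (6 : ℕ) := by
      rw [mul_pow, h6, show √l ^ 6 = (√l ^ 2) ^ 3 by ring, Real.sq_sqrt hl.le]
      ring
    rw [h, ← Real.rpow_natCast, ← Real.rpow_mul (by positivity)]
    norm_num

end HighDimCLT

theorem mainTheorem1 (b : ℝ) (hb : 0 < b) :
    ∃ K₁ K₂ : ℝ, 0 < K₁ ∧ 0 < K₂ ∧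
      ∀ (n p : ℕ), 4 ≤ n → 3 ≤ p →
      ∀ (Ω : Type*) [MeasurableSpace Ω] (P : Measure Ω) [IsProbabilityMeasure P]
        (Ω' : Type*) [MeasurableSpace Ω'] (Q : Measure Ω') [IsProbabilityMeasure Q]
        (X : Fin n → Ω → EuclideanSpace ℝ (Fin p))
        (Y : Fin n → Ω' → EuclideanSpace ℝ (Fin p)),
        (∀ i, AEMeasurable (X i) P) →
        iIndepFun X P →
        (∀ i j, MemLp (fun ω => X i ω j) 2 P) →
        (∀ i j, ∫ ω, X i ω j ∂P = 0) →
        iIndepFun Y Q →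
        (∀ i, HasLaw (Y i) (multivariateGaussian 0 (momentMatrix P (X i))) Q) →
        (∀ j, b ≤ (∑ i, ∫ ω, (X i ω j) ^ 2 ∂P) / n) →
        ∀ Lbar : ℝ, thirdMoment P X ≤ ENNReal.ofReal Lbar →
        ∀ φ : ℝ, φ = K₂ * (Lbar ^ 2 * Real.log p ^ 4 / n) ^ (-(1 / 6) : ℝ) →
          rho P Q (normSum X) (normSum Y) (hyperrectangles p) ≤
            ENNReal.ofReal K₁ *
              (ENNReal.ofReal ((Lbar ^ 2 * Real.log p ^ 7 / n) ^ (1 / 6 : ℝ)) +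
                (truncMoment P X φ + truncMoment Q Y φ) / ENNReal.ofReal Lbar) := by
  obtain ⟨K, hK, hmain⟩ := exists_abs_hyperrectangle_sub_le
  have hsb : 0 < √b := Real.sqrt_pos.2 hb
  -- With `φ = ((K + 1) r)⁻¹` and `r³ = L (log p)² / √n`, the smallness condition becomes `K / (K +
  -- 1)³ ≤ 1`. The anti-concentration term `√(log p)/φ` produces the factor `K + 1`, and the summand
  -- `1` covers the coefficient of `M / L`.
  refine ⟨K / √b * (K + 1) + 1, (K + 1)⁻¹, by positivity, by positivity, ?_⟩
  intro n p hn hp Ω _ P _ Ω' _ Q _ X Y hX hiX _ hX0 hiY hY hvar Lbar hL φ hφ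
  have hn0 : n ≠ 0 := by omega
  have hnpos : (0 : ℝ) < n := by positivity
  obtain ⟨h3, hsum⟩ := memLp_three_of_thirdMoment_le hn0 hX hL
  have hLpos : 0 < Lbar :=
    thirdMoment_bound_pos hb ⟨0, by omega⟩ (fun i => h3 i _) (hvar _) (hsum _)
  have hlog : 0 < Real.log p := one_pos.trans (one_lt_log hp)
  obtain ⟨r, hr, hrφ, hr3, hrate⟩ := exists_sixth_root hLpos hlog hnpos
  have hsn : 0 < √(n : ℝ) := Real.sqrt_pos.2 hnpos
  have hφr : φ = (K + 1)⁻¹ * r⁻¹ := by rw [hφ, hrφ]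
  have hφpos : 0 < φ := by rw [hφr]; positivity
  have hc : K * (K + 1)⁻¹ ^ 3 ≤ 1 := by
    rw [inv_pow, ← div_eq_mul_inv, div_le_one (by positivity)]
    nlinarith [pow_pos hK 2, pow_pos hK 3]
  have hφ3 : K * φ ^ 3 * Real.log p ^ 2 = K * (K + 1)⁻¹ ^ 3 * (√n / Lbar) := by
    rw [hφr, mul_pow, inv_pow r, hr3]
    field_simp
  obtain ⟨M, hM0, hM, hA⟩ := hmain hn0 hp hX hiX h3 hX0 hiY hY hb hvar
    (fun j => (hsum j).trans_eq (by rw [max_eq_left hLpos.le])) hφpos (by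
      rw [hφ3, mul_assoc, div_mul_cancel₀ _ hLpos.ne']
      exact mul_le_of_le_one_left hsn.le hc)
  rw [hM, hrate, ← ENNReal.ofReal_div_of_pos hLpos, ← ENNReal.ofReal_add (by positivity)
    (by positivity), ← ENNReal.ofReal_mul (by positivity)]
  refine iSup₂_le fun A hAmem => ENNReal.ofReal_le_ofReal ((hA A hAmem).trans ?_)
  have h1 : K / √b * √(Real.log p) / φ = K / √b * (K + 1) * (√(Real.log p) * r) := by
    rw [hφr]
    field_simp
  have h2 : K * φ ^ 3 * Real.log p ^ 2 * M / √n ≤ M / Lbar := by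
    rw [hφ3]
    have : K * (K + 1)⁻¹ ^ 3 * (√n / Lbar) * M / √n = K * (K + 1)⁻¹ ^ 3 * (M / Lbar) := by
      field_simp
    rw [this]
    exact mul_le_of_le_one_left (by positivity) hc
  have h4 : 0 ≤ K / √b * (K + 1) * (M / Lbar) := by positivity
  have h5 : 0 ≤ √(Real.log p) * r := by positivity
  rw [h1]
  nlinarith
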